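/- Let $n\ge 1$, let $\mathbb B^n\subset\mathbb C^n$ be the unit ball, and for $z,w\in\mathbb B^n$ put $z\cdot\bar w=\sum_i z_i\bar w_i$. Let $\mathcal K(z,w)=\frac{n!}{\pi^n}(1-z\cdot\bar w)^{-(n+1)}$ be the Bergman kernel, $dV=\mathcal K(z,z)\,dV_e$ the invariant volume ($dV_e$ is Lebesgue measure), and $\tau$ the complex hyperbolic distance, $\cosh^2\frac{\tau(z,w)}2=\frac{|1-z\cdot\bar w|^2}{(1-|z|^2)(1-|w|^2)}$; for sets put $\mathrm{dist}(A,B)=\inf\{\tau(z,w): z\in A, w\in B\}$. Let $c(k)$ be the constant with $c(k)\int_{\mathbb B^n}\mathcal K(z,w)^k\mathcal K(w,z)^k\mathcal K(w,w)^{-k}dV(w)=\mathcal K(z,z)^k$. Let $\Gamma\subset SU(n,1)$ be a discrete subgroup, regarded as a group of automorphisms of $\mathbb B^n$ (a matrix is identified with the fractional linear map it defines), acting freely and with compact quotient; let $\rho:\Gamma\to U(m)$ be a unitary representation, $j\in\{1,\dots,m\}$, and let $J(\gamma,z)$ be the complex Jacobian determinant of $\gamma$ at $z$. Let $\mathcal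 F=\{z:\tau(z,z_0)<\tau(z,\gamma z_0)\ \forall\gamma\in\Gamma,\gamma\ne \mathrm{id}\}$ be a Dirichlet fundamental domain. For $k\in\mathbb N$ and $p\in\mathbb B^n$ put $$\Theta_p^{(j;k)}(z)=c(k)\sum_{\gamma\in\Gamma}\rho(\gamma^{-1})\,\mathcal K(\gamma z,p)^k e_j\,J(\gamma,z)^k ,$$ for a submanifold $\Lambda$ with a volume form $\nu$ put $\Theta_\Lambda^{(j;k)}(z)=\int_\Lambda \Theta_p^{(j;k)}(z)\,\mathcal K(p,p)^{-k/2}\nu(p)$, and put $(F,G)=\int_{\mathcal F}F(z)^T\overline{G(z)}\,\mathcal K(z,z)^{-k}dV(z)$. Let $X,Y$ be smooth embedded submanifolds of $\mathbb B^n$ of real dimensions $q_X,q_Y>0$, with $Y\subset X\subset\mathcal F$, and let $\nu_X,\nu_Y$ be positive (nowhere vanishing) volume forms on them with $0<\int_X\nu_X<\infty$, $0<\int_Y\nu_Y<\infty$. Suppose that $X$ is relatively compact in a $q_X$-dimensional submanifold of $\mathbb B^n$ to which $\nu_X$ extends as a positive volume form (which is automatic if $X$ is compact), and that $\mathrm{dist}(X,\partial\mathcal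 F)>0$. (i) If $q_X\le n$, then there is a constant $C=C(n,X,Y,\nu_X,\nu_Y)$, independent of $\Gamma,\mathcal F,\rho,m,j$, such that for all sufficiently large $k$ $$\bigl|(\Theta_X^{(j;k)},\Theta_Y^{(j;k)})\bigr|\le C\,k^{\,n-q_X/2}.$$ (ii) If $X\subset\{z\in\mathbb B^n: \operatorname{Im}z_1=\dots=\operatorname{Im}z_n=0\}$, then there is a constant $C=C(n,X,Y,\nu_X,\nu_Y)>0$, independent of $\Gamma,\mathcal F,\rho,m,j$, such that $$\lim_{k\to\infty}\frac{(\Theta_X^{(j;k)},\Theta_Y^{(j;k)})}{C\,k^{\,n-q_X/2}}=1 .$$ -/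

import Mathlib

open MeasureTheory Filter Topology
open scoped ContDiff ENNReal Matrix

noncomputable section

namespace BallQuotient

/-- `ℂⁿ` with its Euclidean norm. -/
abbrev E (n : ℕ) : Type := EuclideanSpace ℂ (Fin n)

/-- The open unit ball of `ℂⁿ`. -/
abbrev Ball (n : ℕ) : Type := Metric.ball (0 : E n) 1

/-- The centre of the ball. -/
def origin (n : ℕ) : Ball n := ⟨0, by simp⟩

instance (n : ℕ) : Nonempty (Ball n) := ⟨origin n⟩

/-! ### The group `SU(n,1)` and its action on the ball -/

/-- `σ = diag(1, …, 1, -1)`. -/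
def sig (n : ℕ) : Matrix (Fin n ⊕ Unit) (Fin n ⊕ Unit) ℂ :=
  Matrix.diagonal (Sum.elim (fun _ => 1) (fun _ => -1))

/-- `SU(n,1) = {A ∈ SL(n+1, ℂ) | Aᵀ σ Ā = σ}`. -/
def SU (n : ℕ) : Subgroup (Matrix.SpecialLinearGroup (Fin n ⊕ Unit) ℂ) where
  carrier := {A | A.1ᵀ * sig n * A.1.map (starRingEnd ℂ) = sig n}
  one_mem' := by
    simp [Matrix.map_one]
  mul_mem' := by
    intro A B hA hB
    simp only [Set.mem_ofPred_eq] at hA hB ⊢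
    rw [Matrix.SpecialLinearGroup.coe_mul, Matrix.transpose_mul, Matrix.map_mul]
    calc _ = B.1ᵀ * (A.1ᵀ * sig n *
            A.1.map (starRingEnd ℂ)) * B.1.map (starRingEnd ℂ) := by
          simp only [Matrix.mul_assoc]
      _ = _ := by rw [hA, hB]
  inv_mem' := by
    intro A hA
    simp only [Set.mem_ofPred_eq] at hA ⊢
    have h1 : A.1 * (A⁻¹).1 = 1 := by
      rw [← Matrix.SpecialLinearGroup.coe_mul, mul_inv_cancel, Matrix.SpecialLinearGroup.coe_one]
    have h2 : (A⁻¹).1ᵀ * A.1ᵀ = 1 := by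
      rw [← Matrix.transpose_mul, h1, Matrix.transpose_one]
    have h3 : A.1.map (starRingEnd ℂ) *
        (A⁻¹).1.map (starRingEnd ℂ) = 1 := by
      rw [← Matrix.map_mul, h1, Matrix.map_one _ (map_zero _) (map_one _)]
    calc _ = (A⁻¹).1ᵀ *
            (A.1ᵀ * sig n * A.1.map (starRingEnd ℂ)) *
            (A⁻¹).1.map (starRingEnd ℂ) := by
          rw [hA]
      _ = ((A⁻¹).1ᵀ * A.1ᵀ) * sig n *
            (A.1.map (starRingEnd ℂ) *
            (A⁻¹).1.map (starRingEnd ℂ)) := by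
          simp only [Matrix.mul_assoc]
      _ = _ := by rw [h2, h3, Matrix.one_mul, Matrix.mul_one]

/-- The matrix of an element of `SU(n,1)`. -/
def mat {n : ℕ} (A : SU n) : Matrix (Fin n ⊕ Unit) (Fin n ⊕ Unit) ℂ := A.1.1

/-- The homogeneous coordinates `(z₁, …, zₙ, 1)`. -/
def lift {n : ℕ} (z : E n) : Fin n ⊕ Unit → ℂ := Sum.elim (fun i => z i) (fun _ => 1)

/-- The numerators `a_{i1} z₁ + … + a_{in} zₙ + a_{i,n+1}`. -/
def num {n : ℕ} (A : SU n) (z : E n) : E n :=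
  WithLp.toLp 2 fun i => ((mat A) *ᵥ lift z) (Sum.inl i)

/-- The denominator `a_{n+1,1} z₁ + … + a_{n+1,n} zₙ + a_{n+1,n+1}`. -/
def den {n : ℕ} (A : SU n) (z : E n) : ℂ :=
  ((mat A) *ᵥ lift z) (Sum.inr ())

/-- The fractional linear transformation of `A`. -/
def frac {n : ℕ} (A : SU n) (z : E n) : E n := (den A z)⁻¹ • num A z

lemma form_eq {n : ℕ} (v : Fin n ⊕ Unit → ℂ) :
    v ⬝ᵥ (sig n *ᵥ (star v)) = ((∑ i, ‖v (Sum.inl i)‖ ^ 2 - ‖v (Sum.inr ())‖ ^ 2 : ℝ) : ℂ) := by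
  simp [sig, dotProduct, Matrix.mulVec_diagonal, Complex.mul_conj, Complex.normSq_eq_norm_sq,
    sub_eq_add_neg]

lemma form_mulVec {n : ℕ} (A : SU n) (v : Fin n ⊕ Unit → ℂ) :
    ((mat A) *ᵥ v) ⬝ᵥ (sig n *ᵥ (star ((mat A) *ᵥ v))) =
      v ⬝ᵥ (sig n *ᵥ (star v)) := by
  have h : (mat A)ᵀ * sig n * (mat A).map (starRingEnd ℂ) = sig n := A.2
  have hs : star ((mat A) *ᵥ v) =
      (mat A).map (starRingEnd ℂ) *ᵥ star v := by
    funext i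
    simp [Matrix.mulVec, dotProduct]
  rw [hs]
  conv_rhs => rw [← h]
  rw [← Matrix.mulVec_mulVec, ← Matrix.mulVec_mulVec]
  conv_rhs => rw [Matrix.dotProduct_mulVec, Matrix.vecMul_transpose]

lemma norm_num_sub {n : ℕ} (A : SU n) (z : E n) :
    ‖num A z‖ ^ 2 - ‖den A z‖ ^ 2 = ‖z‖ ^ 2 - 1 := by
  have h := form_mulVec A (lift z)
  rw [form_eq, form_eq] at h
  have h' := Complex.ofReal_injective h
  simpa [EuclideanSpace.norm_sq_eq, num, den, lift] using h'

lemma den_ne_zero {n : ℕ} (A : SU n) (z : Ball n) : den A z.1 ≠ 0 := by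
  intro h
  have h1 := norm_num_sub A z.1
  have h2 : ‖z.1‖ < 1 := mem_ball_zero_iff.1 z.2
  rw [h, norm_zero] at h1
  nlinarith [norm_nonneg z.1, sq_nonneg ‖num A z.1‖]

lemma frac_mem {n : ℕ} (A : SU n) (z : Ball n) : frac A z.1 ∈ Metric.ball (0 : E n) 1 := by
  have h1 := norm_num_sub A z.1
  have h2 : ‖z.1‖ < 1 := mem_ball_zero_iff.1 z.2
  have h3 : 0 < ‖den A z.1‖ := norm_pos_iff.2 (den_ne_zero A z)
  have h4 : ‖num A z.1‖ < ‖den A z.1‖ := by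
    apply lt_of_pow_lt_pow_left₀ 2 h3.le
    nlinarith [norm_nonneg z.1]
  rw [mem_ball_zero_iff, frac, norm_smul, norm_inv, inv_mul_lt_iff₀ h3]
  simpa using h4

lemma mulVec_lift {n : ℕ} (A : SU n) (z : Ball n) :
    (mat A) *ᵥ lift z.1 = den A z.1 • lift (frac A z.1) := by
  have h := den_ne_zero A z
  funext i
  rcases i with i | i
  · simp [lift, frac, num, mul_inv_cancel_left₀ h]
  · simp [lift, den]

/-- `SU(n,1)` acts on the ball by fractional linear transformations. -/
instance instMulActionBall (n : ℕ) : MulAction (SU n) (Ball n) where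
  smul A z := ⟨frac A z.1, frac_mem A z⟩
  one_smul z := by
    apply Subtype.ext
    change frac 1 z.1 = z.1
    ext i
    simp [frac, num, den, lift, mat]
  mul_smul A B z := by
    apply Subtype.ext
    change frac (A * B) z.1 = frac A (frac B z.1)
    have hB := den_ne_zero B z
    have key : (mat (A * B)) *ᵥ lift z.1 =
        den B z.1 • ((mat A) *ᵥ lift (frac B z.1)) := by
      rw [← Matrix.mulVec_smul, ← mulVec_lift, Matrix.mulVec_mulVec]
      rfl
    ext i
    have e1 : num (A * B) z.1 i = den B z.1 * num A (frac B z.1) i := congrFun key (Sum.inl i)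
    have e2 : den (A * B) z.1 = den B z.1 * den A (frac B z.1) := congrFun key (Sum.inr ())
    change (den (A * B) z.1)⁻¹ * num (A * B) z.1 i =
      (den A (frac B z.1))⁻¹ * num A (frac B z.1) i
    rw [e1, e2, mul_inv]
    field_simp

/-- The group of automorphisms of the ball given by a subgroup of `SU(n,1)`: a matrix and the
automorphism that it represents are identified, so scalar matrices count as the identity. -/
def autGroup {n : ℕ} (Γ : Subgroup (SU n)) : Subgroup (Equiv.Perm (Ball n)) :=
  Γ.map (MulAction.toPermHom (SU n) (Ball n))

/-- The complex Jacobian determinant `J(g, z)` of a self-map of the ball. -/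
def jac {n : ℕ} (g : Equiv.Perm (Ball n)) (z : Ball n) : ℂ := by
  classical exact
    (fderiv ℂ (fun w : E n => if h : w ∈ Metric.ball (0 : E n) 1 then ((g ⟨w, h⟩ : Ball n) : E n)
      else 0) z.1).det

/-- `Γ` is a discrete subgroup of `SU(n,1)` with smooth compact quotient `Γ \ 𝔹ⁿ`: it is discrete,
its automorphisms other than the identity have no fixed points, and the quotient is compact. -/
structure IsSmoothCocompact {n : ℕ} (Γ : Subgroup (SU n)) : Prop where
  discrete : DiscreteTopology Γ
  free : ∀ g ∈ autGroup Γ, g ≠ 1 → ∀ z : Ball n, g z ≠ z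
  compact : CompactSpace (Quotient (MulAction.orbitRel (autGroup Γ) (Ball n)))

/-! ### Complex hyperbolic distance and Dirichlet domains -/

/-- Complex hyperbolic distance:
`cosh² (τ(z,w)/2) = |1 - z·w̄|² / ((1 - |z|²)(1 - |w|²))`, where `z·w̄ = inner ℂ w z`. -/
def tau {n : ℕ} (z w : Ball n) : ℝ :=
  2 * Real.arcosh (‖1 - inner ℂ (w : E n) (z : E n)‖ /
    Real.sqrt ((1 - ‖(z : E n)‖ ^ 2) * (1 - ‖(w : E n)‖ ^ 2)))

/-- `dist(A, B) = inf {τ(z,w) | z ∈ A, w ∈ B}`, infinite if `A` or `B` is empty. -/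
def setDist {n : ℕ} (A B : Set (Ball n)) : ℝ≥0∞ :=
  ⨅ z ∈ A, ⨅ w ∈ B, ENNReal.ofReal (tau z w)

/-- The Dirichlet fundamental domain of `Γ` centred at `z₀`. -/
def dirichlet {n : ℕ} (Γ : Subgroup (SU n)) (z₀ : Ball n) : Set (Ball n) :=
  {z | ∀ g ∈ autGroup Γ, g ≠ 1 → tau z z₀ < tau z (g z₀)}

/-! ### Bergman kernel, Poincaré series, inner product -/

/-- The Bergman kernel `K(z,w) = (n!/πⁿ) (1 - z·w̄)^{-(n+1)}` of the ball. -/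
def bergman {n : ℕ} (z w : Ball n) : ℂ :=
  ((n.factorial : ℝ) / Real.pi ^ n : ℝ) / (1 - inner ℂ (w : E n) (z : E n)) ^ (n + 1)

/-- The positive real number `K(z,z)`. -/
def bergmanDiag {n : ℕ} (z : Ball n) : ℝ := (bergman z z).re

/-- The invariant volume `dV = K(z,z) dV_e`, where `dV_e` is Lebesgue measure on the ball. -/
def invVol (n : ℕ) : Measure (Ball n) :=
  ((volume : Measure (E n)).comap Subtype.val).withDensity fun z => ENNReal.ofReal (bergmanDiag z)

/-- The constant `c(𝔹ⁿ, k)` that makes `c K(z,w)^k` the reproducing kernel of the holomorphic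
functions with `∫ |f|² K(z,z)^{-k} dV < ∞`; it is determined by
`c ∫ K(z,w)^k K(w,z)^k K(w,w)^{-k} dV(w) = K(z,z)^k`, here at `z = 0`. -/
def kernelConst (n k : ℕ) : ℂ :=
  bergman (origin n) (origin n) ^ k /
    ∫ w, bergman (origin n) w ^ k * bergman w (origin n) ^ k / bergman w w ^ k ∂(invVol n)

/-- `Θ̂^{(j;k)}(z,p) = Θ_p^{(j;k)}(z) = c ∑_{γ ∈ Γ} ρ(γ⁻¹) (K(γz,p)^k e_j) J(γ,z)^k`. -/
def thetaPoint {n m : ℕ} (Γ : Subgroup (SU n)) (ρ : autGroup Γ →* Matrix.unitaryGroup (Fin m) ℂ)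
    (j : Fin m) (k : ℕ) (z p : Ball n) : Fin m → ℂ :=
  kernelConst n k • ∑' γ : autGroup Γ,
    jac γ.1 z ^ k • ((ρ γ⁻¹ : Matrix (Fin m) (Fin m) ℂ) *ᵥ Pi.single j (bergman (γ.1 z) p ^ k))

/-- `Θ_Λ^{(j;k)}(z) = ∫_Λ Θ̂^{(j;k)}(z,p) K(p,p)^{-k/2} ν(p)`; here `ν` is carried by `Λ`. -/
def theta {n m : ℕ} (Γ : Subgroup (SU n)) (ρ : autGroup Γ →* Matrix.unitaryGroup (Fin m) ℂ)
    (ν : Measure (Ball n)) (j : Fin m) (k : ℕ) (z : Ball n) : Fin m → ℂ :=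
  ∫ p, (bergmanDiag p ^ (-(k : ℝ) / 2)) • thetaPoint Γ ρ j k z p ∂ν

/-- `(F, G) = ∫_{Γ \ 𝔹ⁿ} F(z)ᵀ conj(G(z)) K(z,z)^{-k} dV`, the integral being taken over a
fundamental domain `S`. -/
def innerProd {n m : ℕ} (S : Set (Ball n)) (k : ℕ) (F G : Ball n → Fin m → ℂ) : ℂ :=
  ∫ z in S, (F z ⬝ᵥ star (G z)) * ((bergmanDiag z ^ k)⁻¹ : ℝ) ∂(invVol n)

/-! ### Submanifolds and volume forms -/

/-- A smooth local parametrization `φ : U → X` of a `q`-dimensional embedded submanifold `X`. -/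
structure IsLocalParam {n : ℕ} (q : ℕ) (X : Set (Ball n)) (U : Set (EuclideanSpace ℝ (Fin q)))
    (φ : EuclideanSpace ℝ (Fin q) → Ball n) : Prop where
  isOpen : IsOpen U
  smooth : ContDiffOn ℝ ∞ (fun t => (φ t : E n)) U
  immersion : ∀ t ∈ U, Function.Injective (fderiv ℝ (fun t => (φ t : E n)) t)
  embedding : IsEmbedding (U.domRestrict φ)
  image : ∃ V : Set (Ball n), IsOpen V ∧ φ '' U = X ∩ V

/-- `X` is a (smooth, embedded) `q`-dimensional submanifold of the ball. -/
def IsSubmanifold {n : ℕ} (q : ℕ) (X : Set (Ball n)) : Prop :=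
  ∀ x ∈ X, ∃ U φ, IsLocalParam q X U φ ∧ x ∈ φ '' U

/-- A volume form on `X` is used only to integrate functions over `X`, for the orientation that it
defines. It is given here by the corresponding measure `A ↦ ∫_{A ∩ X} ν`: in local parametrizations
it is `f(t) dt₁ ⋯ dt_q` with a smooth function `f > 0`. -/
def IsVolumeForm {n : ℕ} (q : ℕ) (X : Set (Ball n)) (ν : Measure (Ball n)) : Prop :=
  ν Xᶜ = 0 ∧ ∀ x ∈ X, ∃ U φ, IsLocalParam q X U φ ∧ x ∈ φ '' U ∧
    ∃ f : EuclideanSpace ℝ (Fin q) → ℝ, ContDiffOn ℝ ∞ f U ∧ (∀ t ∈ U, 0 < f t) ∧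
      ν.restrict (φ '' U) =
        ((volume.restrict U).withDensity fun t => ENNReal.ofReal (f t)).map φ

/-- `(X, ν)` is smooth up to its ends: `X` is relatively compact in a `q`-dimensional submanifold
`Z` of the ball, and `ν` is the restriction of a volume form of `Z`. For compact `X` one may take
`Z = X`. -/
def IsRegularUpToEnds {n : ℕ} (q : ℕ) (X : Set (Ball n)) (ν : Measure (Ball n)) : Prop :=
  ∃ (Z : Set (Ball n)) (νZ : Measure (Ball n)), IsSubmanifold q Z ∧ IsVolumeForm q Z νZ ∧
    IsCompact (closure X) ∧ closure X ⊆ Z ∧ ν = νZ.restrict X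

end BallQuotient

end

/-! ### The two-point invariant of complex hyperbolic space. -/

noncomputable section

namespace BallQuotient

variable {n : ℕ}

/-! ### The overlap `cosh⁻² (τ/2)` of two points -/

/-! Normalize the kernels by `K(z,z)^{-k/2} K(p,p)^{-k/2}`. The term of the Poincaré series
belonging to `γ` then has absolute value `overlap (γ z) p ^ ((n+1)k/2)`, where `overlap =
cosh⁻²(τ/2)` is invariant under the group. Every geometric statement is phrased through `overlap`
instead of `τ`.

The inner product unfolds. The Hermitian product of two theta series is a sum over `Γ` of translates
of a single function, and a Dirichlet domain is a fundamental domain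
(`isFundamentalDomain_dirichlet`), so the integral over it becomes an integral over the whole ball.
There the reproducing property (`reproducing`) evaluates it. Hence the product of the point series
at `p` and `q` is the `j`-th component of the normalized series of `p` at `q`
(`setIntegral_normTheta`), and `innerProd_theta` integrates this over `X × Y`.

The identity term dominates. A metric ball of fixed radius about any `p ∈ X` stays inside the domain
(`exists_overlap_gt_mem_dirichlet`), while `γ q` lies outside the domain for `q ∈ X` and `γ ≠ 1`. So
`overlap (γ q) p ≤ a < 1`, and together with the uniform convergence of the series
(`exists_tsum_overlap_le`) the remaining terms contribute at most `c(k)` times an exponentially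
small quantity (`norm_normTheta_sub_le`). Only this error involves `Γ`, `ρ`, `m` and `j`, so they
affect how large `k` must be but not the constants of the theorem.

What is left is Laplace's method. The reciprocal of `c(k)` is a Gaussian-type integral in `2n` real
dimensions, so `c(k)` grows like `k^n` (`exists_tendsto_kernelReal`). The integral of `overlap p y ^
((n+1)k/2)` over `p ∈ X` is at most of order `k^{-q_X/2}` uniformly in `y`, and for `y ∈ X` it has a
positive limit after rescaling (`exists_integral_overlap_le`, `exists_tendsto_integral_overlap`).
Bounding the identity term by its absolute value gives (i). At real points the kernel is positive,
so the identity term equals its absolute value and nothing cancels; this gives the exact asymptotics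
in (ii) (`poincareTerm_one_of_real`, `exists_tendsto_leadingTerm`). -/

lemma one_sub_sq_pos (z : Ball n) : 0 < 1 - ‖(z : E n)‖ ^ 2 := by
  have h : ‖(z : E n)‖ < 1 := mem_ball_zero_iff.1 z.2
  nlinarith [norm_nonneg (z : E n)]

lemma norm_inner_lt_one (z w : Ball n) : ‖inner ℂ (w : E n) (z : E n)‖ < 1 := by
  have h : ‖(z : E n)‖ < 1 := mem_ball_zero_iff.1 z.2
  have h' : ‖(w : E n)‖ < 1 := mem_ball_zero_iff.1 w.2
  have := norm_inner_le_norm (𝕜 := ℂ) (w : E n) (z : E n)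
  nlinarith [norm_nonneg (z : E n), norm_nonneg (w : E n)]

lemma one_sub_inner_ne_zero (z w : Ball n) : 1 - inner ℂ (w : E n) (z : E n) ≠ 0 := by
  intro h
  have h1 := norm_inner_lt_one z w
  rw [← sub_eq_zero.1 h] at h1
  simp at h1

lemma norm_one_sub_inner_pos (z w : Ball n) : 0 < ‖1 - inner ℂ (w : E n) (z : E n)‖ :=
  norm_pos_iff.2 (one_sub_inner_ne_zero z w)

/-- `cosh⁻² (τ(z,w)/2)`. -/
def overlap (z w : Ball n) : ℝ :=
  (1 - ‖(z : E n)‖ ^ 2) * (1 - ‖(w : E n)‖ ^ 2) / ‖1 - inner ℂ (w : E n) (z : E n)‖ ^ 2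

lemma overlap_pos (z w : Ball n) : 0 < overlap z w :=
  div_pos (mul_pos (one_sub_sq_pos z) (one_sub_sq_pos w)) (pow_pos (norm_one_sub_inner_pos z w) 2)

lemma norm_one_sub_inner_comm (z w : E n) : ‖1 - inner ℂ w z‖ = ‖1 - inner ℂ z w‖ := by
  rw [← RCLike.norm_conj, map_sub, map_one, inner_conj_symm]

lemma overlap_comm (z w : Ball n) : overlap z w = overlap w z := by
  rw [overlap, overlap, norm_one_sub_inner_comm, mul_comm (1 - ‖(z : E n)‖ ^ 2)]

/-- Both sides are the same polynomial in `‖z‖²`, `‖w‖²` and the real and imaginary parts of the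
inner product. The point is that `overlap⁻¹ - 1` acquires a nonnegative numerator quadratic in `z -
w`, the source of all Gaussian bounds and limits below. -/
lemma norm_one_sub_inner_sq (z w : E n) :
    ‖1 - inner ℂ w z‖ ^ 2 = (1 - ‖z‖ ^ 2) * (1 - ‖w‖ ^ 2) +
      (‖z - w‖ ^ 2 * (1 - ‖w‖ ^ 2) + ‖inner ℂ w (z - w)‖ ^ 2) := by
  have h1 : ‖z - w‖ ^ 2 = ‖z‖ ^ 2 - 2 * (inner ℂ w z).re + ‖w‖ ^ 2 := by
    rw [@norm_sub_sq ℂ, ← inner_re_symm]; rfl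
  have h2 : inner ℂ w (z - w) = inner ℂ w z - ((‖w‖ ^ 2 : ℝ) : ℂ) := by
    rw [inner_sub_right, inner_self_eq_norm_sq_to_K]; norm_cast
  rw [h1, h2]
  generalize inner ℂ w z = u
  simp only [← Complex.normSq_eq_norm_sq, Complex.normSq_apply, Complex.sub_re, Complex.sub_im,
    Complex.one_re, Complex.one_im, Complex.ofReal_re, Complex.ofReal_im]
  ring

lemma inv_overlap (z w : Ball n) :
    (overlap z w)⁻¹ = 1 + (‖(z : E n) - w‖ ^ 2 * (1 - ‖(w : E n)‖ ^ 2) +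
      ‖inner ℂ (w : E n) ((z : E n) - w)‖ ^ 2) /
        ((1 - ‖(z : E n)‖ ^ 2) * (1 - ‖(w : E n)‖ ^ 2)) := by
  have hz := (one_sub_sq_pos z).ne'
  have hw := (one_sub_sq_pos w).ne'
  rw [overlap, inv_div, norm_one_sub_inner_sq, add_div, div_self (mul_ne_zero hz hw)]

/-- Drop the inner product term in `inv_overlap` and use `1 - ‖z‖² ≤ 1`. This compares hyperbolic
decay with Euclidean distance, uniformly on the ball. -/
lemma one_add_sq_le_inv_overlap (z w : Ball n) :
    1 + ‖(z : E n) - w‖ ^ 2 ≤ (overlap z w)⁻¹ := by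
  have hz := one_sub_sq_pos z
  have hw := one_sub_sq_pos w
  rw [inv_overlap, add_le_add_iff_left, le_div_iff₀ (mul_pos hz hw)]
  have h2 : 0 ≤ ‖(z : E n) - w‖ ^ 2 * (1 - ‖(w : E n)‖ ^ 2) := by positivity
  nlinarith [sq_nonneg ‖(z : E n)‖, sq_nonneg ‖inner ℂ (w : E n) ((z : E n) - w)‖]

lemma overlap_le_one (z w : Ball n) : overlap z w ≤ 1 := by
  have h := one_add_sq_le_inv_overlap z w
  have h1 : 1 ≤ (overlap z w)⁻¹ := by nlinarith [sq_nonneg ‖(z : E n) - w‖]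
  exact (one_le_inv₀ (overlap_pos z w)).1 h1

lemma overlap_origin (w : Ball n) : overlap w (origin n) = 1 - ‖(w : E n)‖ ^ 2 := by
  simp [overlap, origin]

lemma tau_eq (z w : Ball n) : tau z w = 2 * Real.arcosh (Real.sqrt (overlap z w))⁻¹ := by
  rw [tau, overlap, Real.sqrt_div' _ (by positivity), Real.sqrt_sq (norm_nonneg _), inv_div]

/-- `tau` is a strictly decreasing function of `overlap`, so the Dirichlet condition can be handled
without `arcosh`. -/
lemma tau_lt_tau_iff (z w z' w' : Ball n) :
    tau z w < tau z' w' ↔ overlap z' w' < overlap z w := by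
  have h := overlap_pos z w
  have h' := overlap_pos z' w'
  rw [tau_eq, tau_eq, mul_lt_mul_iff_right₀ two_pos,
    Real.arcosh_lt_arcosh (by positivity) (by positivity),
    inv_lt_inv₀ (by positivity) (by positivity), Real.sqrt_lt_sqrt_iff h'.le]

/-! ### Invariance under `SU(n,1)` -/

lemma coe_smul (A : SU n) (z : Ball n) : ((A • z : Ball n) : E n) = frac A z := rfl

lemma form_mulVec_mulVec (A : SU n) (v w : Fin n ⊕ Unit → ℂ) :
    ((mat A) *ᵥ v) ⬝ᵥ (sig n *ᵥ (star ((mat A) *ᵥ w))) = v ⬝ᵥ (sig n *ᵥ (star w)) := by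
  have h : (mat A)ᵀ * sig n * (mat A).map (starRingEnd ℂ) = sig n := A.2
  have hs : star ((mat A) *ᵥ w) = (mat A).map (starRingEnd ℂ) *ᵥ star w := by
    funext i
    simp [Matrix.mulVec, dotProduct]
  rw [hs]
  conv_rhs => rw [← h]
  rw [← Matrix.mulVec_mulVec, ← Matrix.mulVec_mulVec]
  conv_rhs => rw [Matrix.dotProduct_mulVec, Matrix.vecMul_transpose]

lemma form_lift (z w : E n) :
    lift z ⬝ᵥ (sig n *ᵥ (star (lift w))) = inner ℂ w z - 1 := by
  simp [sig, dotProduct, Matrix.mulVec_diagonal, lift, PiLp.inner_apply, sub_eq_add_neg]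

/-- The form of signature `(n,1)` on lifts is `⟨w,z⟩ - 1`, and `A` sends the lift of `z` to `den A
z` times the lift of `A • z`. Invariance of the form is therefore this cocycle rule, from which the
laws for `overlap` and the Bergman kernel follow. -/
lemma one_sub_inner_smul (A : SU n) (z w : Ball n) :
    den A z * (starRingEnd ℂ) (den A w) *
      (1 - inner ℂ ((A • w : Ball n) : E n) ((A • z : Ball n) : E n)) =
      1 - inner ℂ (w : E n) (z : E n) := by
  have h := form_mulVec_mulVec A (lift z.1) (lift w.1)
  rw [mulVec_lift, mulVec_lift, form_lift, star_smul, Matrix.mulVec_smul, smul_dotProduct,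
    dotProduct_smul, form_lift] at h
  rw [coe_smul, coe_smul, ← neg_inj, neg_sub, ← h]
  simp only [smul_eq_mul]
  change _ = den A z.1 * ((starRingEnd ℂ) (den A w.1) * _)
  ring

lemma one_sub_sq_smul (A : SU n) (z : Ball n) :
    ‖den A z‖ ^ 2 * (1 - ‖((A • z : Ball n) : E n)‖ ^ 2) = 1 - ‖(z : E n)‖ ^ 2 := by
  have h := one_sub_inner_smul A z z
  rw [inner_self_eq_norm_sq_to_K, inner_self_eq_norm_sq_to_K, Complex.mul_conj,
    Complex.normSq_eq_norm_sq] at h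
  apply Complex.ofReal_injective
  push_cast at h ⊢
  exact h

lemma overlap_smul_smul (A : SU n) (z w : Ball n) : overlap (A • z) (A • w) = overlap z w := by
  have hz := norm_pos_iff.2 (den_ne_zero A z)
  have hw := norm_pos_iff.2 (den_ne_zero A w)
  rw [overlap, overlap, ← one_sub_sq_smul A z, ← one_sub_sq_smul A w, ← one_sub_inner_smul A z w,
    norm_mul, norm_mul, RCLike.norm_conj]
  have := (norm_one_sub_inner_pos (A • z) (A • w)).ne'
  field_simp

/-! ### Transitivity -/

/-- The boost that takes the centre of the ball to `p`. -/
def boostMatrix (p : E n) (s : ℝ) : Matrix (Fin n ⊕ Unit) (Fin n ⊕ Unit) ℂ :=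
  Matrix.fromBlocks
    (1 + Matrix.replicateCol Unit (fun i => ((s ^ 2 / (1 + s) : ℝ) : ℂ) * p i) *
      Matrix.replicateRow Unit (fun i => (starRingEnd ℂ) (p i)))
    (Matrix.replicateCol Unit fun i => (s : ℂ) * p i)
    (Matrix.replicateRow Unit fun i => (s : ℂ) * (starRingEnd ℂ) (p i))
    (Matrix.diagonal fun _ => (s : ℂ))

lemma sum_mul_conj (p : E n) : ∑ i, p i * (starRingEnd ℂ) (p i) = ((‖p‖ ^ 2 : ℝ) : ℂ) := by
  rw [EuclideanSpace.norm_sq_eq]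
  push_cast
  exact Finset.sum_congr rfl fun i _ => by
    rw [Complex.mul_conj, Complex.normSq_eq_norm_sq]; norm_cast

/-- The Schur complement of the corner entry `s` is a rank-one perturbation of the identity, with
coefficient `s²/(1+s) - s = -s/(1+s)`. -/
lemma det_boostMatrix (p : E n) {s : ℝ} (hs : 0 < s) (hp : s ^ 2 * (1 - ‖p‖ ^ 2) = 1) :
    (boostMatrix p s).det = 1 := by
  have hsC : (s : ℂ) ≠ 0 := by exact_mod_cast hs.ne'
  have hs1 : (1 + s : ℂ) ≠ 0 := by exact_mod_cast (by positivity : (1 + s : ℝ) ≠ 0)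
  let : Invertible (Matrix.diagonal fun _ : Unit => (s : ℂ)) :=
    ⟨Matrix.diagonal fun _ => (s : ℂ)⁻¹, by simp [hsC], by simp [hsC]⟩
  have hinv : ⅟ (Matrix.diagonal fun _ : Unit => (s : ℂ)) = Matrix.diagonal fun _ => (s : ℂ)⁻¹ :=
    rfl
  rw [boostMatrix, Matrix.det_fromBlocks₂₂, hinv]
  have hM : (1 + Matrix.replicateCol Unit (fun i => ((s ^ 2 / (1 + s) : ℝ) : ℂ) * p i) *
      Matrix.replicateRow Unit (fun i => (starRingEnd ℂ) (p i)) : Matrix (Fin n) (Fin n) ℂ) -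
      (Matrix.replicateCol Unit fun i => (s : ℂ) * p i : Matrix (Fin n) Unit ℂ) *
        (Matrix.diagonal fun _ => (s : ℂ)⁻¹ : Matrix Unit Unit ℂ) *
      (Matrix.replicateRow Unit fun i => (s : ℂ) * (starRingEnd ℂ) (p i) :
        Matrix Unit (Fin n) ℂ) =
      1 + Matrix.replicateCol Unit (fun i => ((s ^ 2 / (1 + s) - s : ℝ) : ℂ) * p i) *
      Matrix.replicateRow Unit (fun i => (starRingEnd ℂ) (p i)) := by
    ext i l
    simp [Matrix.mul_apply, Matrix.replicateCol, Matrix.replicateRow]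
    field_simp
    ring
  rw [hM, Matrix.det_one_add_replicateCol_mul_replicateRow]
  have e : (fun i => (starRingEnd ℂ) (p i)) ⬝ᵥ
      (fun i => ((s ^ 2 / (1 + s) - s : ℝ) : ℂ) * p i) =
      ((s ^ 2 / (1 + s) - s : ℝ) : ℂ) * ((‖p‖ ^ 2 : ℝ) : ℂ) := by
    rw [← sum_mul_conj, dotProduct, Finset.mul_sum]
    exact Finset.sum_congr rfl fun i _ => by ring
  rw [e, Matrix.det_diagonal]
  simp only [Finset.univ_unique, Finset.prod_singleton]
  norm_cast
  have : (1 + s) ≠ 0 := by positivity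
  field_simp
  nlinarith

lemma boostMatrix_mem (p : E n) {s : ℝ} (hs : 0 < s) (hp : s ^ 2 * (1 - ‖p‖ ^ 2) = 1) :
    (boostMatrix p s)ᵀ * sig n * (boostMatrix p s).map (starRingEnd ℂ) = sig n := by
  have hs1 : (1 + s : ℂ) ≠ 0 := by exact_mod_cast (by positivity : (1 + s : ℝ) ≠ 0)
  have hpC : (s : ℂ) ^ 2 * (1 - ((‖p‖ ^ 2 : ℝ) : ℂ)) = 1 := by exact_mod_cast hp
  have hsum := sum_mul_conj p
  have hsum' : ∑ i, (starRingEnd ℂ) (p i) * p i = ((‖p‖ ^ 2 : ℝ) : ℂ) := by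
    rw [← hsum]; exact Finset.sum_congr rfl fun i _ => mul_comm _ _
  have hsig : sig n = Matrix.fromBlocks 1 0 0 (-1) := by
    ext (i | i) (l | l) <;> simp [sig, Matrix.diagonal, Matrix.one_apply]
  set N : ℂ := ((‖p‖ ^ 2 : ℝ) : ℂ)
  set P : Matrix (Fin n) Unit ℂ := Matrix.replicateCol Unit fun i => p i with hP
  set Q : Matrix Unit (Fin n) ℂ := Matrix.replicateRow Unit fun i => (starRingEnd ℂ) (p i) with hQ
  have hQP : Q * P = N • (1 : Matrix Unit Unit ℂ) := by
    ext i l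
    simp [hP, hQ, Matrix.mul_apply, Matrix.replicateCol, Matrix.replicateRow, ← hsum']
  have hb : boostMatrix p s = Matrix.fromBlocks (1 + (s ^ 2 / (1 + s) : ℂ) • (P * Q)) ((s : ℂ) • P)
      ((s : ℂ) • Q) ((s : ℂ) • 1) := by
    ext (i | i) (l | l) <;>
    simp [boostMatrix, hP, hQ, Matrix.mul_apply, Matrix.replicateCol, Matrix.replicateRow,
      Matrix.diagonal, Matrix.one_apply, mul_assoc]
  have hbt : (boostMatrix p s)ᵀ = (boostMatrix p s).map (starRingEnd ℂ) := by
    ext (i | i) (l | l) <;>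
    simp [boostMatrix, Matrix.mul_apply, Matrix.replicateCol, Matrix.replicateRow,
      Matrix.diagonal, Matrix.one_apply, mul_assoc, mul_comm, eq_comm]
  -- The boost is Hermitian, so the defining relation of the group is the transpose of this one. The
  -- four blocks reduce to `Q P = ‖p‖²` and `s²‖p‖² = s² - 1`.
  have key : boostMatrix p s * sig n * boostMatrix p s = sig n := by
    rw [hb, hsig, Matrix.fromBlocks_multiply, Matrix.fromBlocks_multiply]
    have hPQPQ : P * Q * (P * Q) = N • (P * Q) := by
      rw [Matrix.mul_assoc, ← Matrix.mul_assoc Q, hQP]; simp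
    have hPQP : P * Q * P = N • P := by rw [Matrix.mul_assoc, hQP]; simp
    have hQPQ : Q * (P * Q) = N • Q := by rw [← Matrix.mul_assoc, hQP]; simp
    have hN : (s : ℂ) ^ 2 * N = s ^ 2 - 1 := by linear_combination -hpC
    congr 1
    · simp only [Matrix.mul_one, Matrix.mul_zero, add_zero, Matrix.add_mul, Matrix.mul_add,
        Matrix.one_mul, Matrix.mul_neg, zero_add, Matrix.neg_mul, Matrix.smul_mul, Matrix.mul_smul,
        hPQPQ, smul_smul]
      rw [add_assoc, add_assoc, add_eq_left]
      generalize P * Q = R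
      match_scalars
      field_simp
      linear_combination (s : ℂ) ^ 2 * hN
    · simp only [Matrix.mul_one, Matrix.mul_zero, add_zero, Matrix.add_mul, 
        Matrix.one_mul, Matrix.mul_neg, zero_add, Matrix.smul_mul, Matrix.mul_smul,
        hPQP, smul_smul]
      match_scalars
      field_simp
      linear_combination (s : ℂ) * hN
    · simp only [Matrix.mul_one, Matrix.mul_zero, add_zero, Matrix.mul_add,
        Matrix.one_mul, Matrix.mul_neg, zero_add, Matrix.neg_mul, Matrix.smul_mul, Matrix.mul_smul,
        hQPQ, smul_smul]
      match_scalars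
      field_simp
      linear_combination (s : ℂ) * hN
    · simp only [Matrix.mul_one, Matrix.mul_zero, add_zero, 
        Matrix.mul_neg, zero_add, Matrix.smul_mul, Matrix.mul_smul,
        hQP, smul_smul]
      match_scalars
      linear_combination hN
  have hbm : (boostMatrix p s).map (starRingEnd ℂ) = (boostMatrix p s)ᵀ := hbt.symm
  rw [hbm]
  have := congrArg Matrix.transpose key
  rw [Matrix.transpose_mul, Matrix.transpose_mul] at this
  have hst : (sig n)ᵀ = sig n := by simp [sig]
  rw [hst] at this
  rw [Matrix.mul_assoc]; exact this

lemma exists_smul_origin (p : Ball n) : ∃ A : SU n, A • origin n = p := by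
  have hp := one_sub_sq_pos p
  -- The Lorentz factor of `p`: the last column of the boost is `(s p, s)`, which represents the
  -- point `p`.
  set s : ℝ := (Real.sqrt (1 - ‖(p : E n)‖ ^ 2))⁻¹ with hs
  have hs0 : 0 < s := by positivity
  have hsp : s ^ 2 * (1 - ‖(p : E n)‖ ^ 2) = 1 := by
    rw [hs, inv_pow, Real.sq_sqrt hp.le, inv_mul_cancel₀ hp.ne']
  refine ⟨⟨⟨boostMatrix p.1 s, det_boostMatrix p.1 hs0 hsp⟩, boostMatrix_mem p.1 hs0 hsp⟩, ?_⟩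
  apply Subtype.ext
  rw [coe_smul]
  ext i
  have hsC : (s : ℂ) ≠ 0 := by exact_mod_cast hs0.ne'
  simp [frac, num, den, mat, boostMatrix, Matrix.mulVec, dotProduct, lift, origin,
    Matrix.replicateCol, Matrix.replicateRow, hsC]

lemma exists_smul_eq (z w : Ball n) : ∃ A : SU n, A • z = w := by
  obtain ⟨A, hA⟩ := exists_smul_origin z
  obtain ⟨B, hB⟩ := exists_smul_origin w
  exact ⟨B * A⁻¹, by rw [mul_smul, inv_smul_eq_iff.2 hA.symm, hB]⟩

/-- A quasi-triangle inequality. -/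
lemma overlap_mul_overlap_le (z p w : Ball n) :
    overlap z p * overlap w p ≤ 4 * overlap z w := by
  -- With `p` at the centre, the left side is exactly the numerator of `overlap z w`, whose
  -- denominator is at most `4`.
  obtain ⟨A, hA⟩ := exists_smul_eq p (origin n)
  rw [← overlap_smul_smul A z p, ← overlap_smul_smul A w p, ← overlap_smul_smul A z w, hA,
    overlap_origin, overlap_origin, overlap]
  generalize A • z = z
  generalize A • w = w
  have h1 := norm_one_sub_inner_pos z w
  have h2 : ‖1 - inner ℂ (w : E n) (z : E n)‖ ≤ 2 := by
    refine (norm_sub_le _ _).trans ?_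
    rw [norm_one]
    linarith [norm_inner_lt_one z w]
  rw [mul_div_assoc', le_div_iff₀ (by positivity)]
  have h3 := mul_pos (one_sub_sq_pos z) (one_sub_sq_pos w)
  have h4 : ‖1 - inner ℂ (w : E n) (z : E n)‖ ^ 2 ≤ 4 := by nlinarith
  nlinarith

end BallQuotient

end

/-! ### Jacobians, kernel and volume under automorphisms. -/

noncomputable section

namespace BallQuotient

variable {n : ℕ}

/-! ### The Jacobian of a fractional linear transformation -/

/-- The matrix of the derivative of `frac A` at `z`. -/
def fracDeriv (A : SU n) (z : E n) : Matrix (Fin n) (Fin n) ℂ := fun i l =>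
  (den A z)⁻¹ * mat A (Sum.inl i) (Sum.inl l) -
    (den A z)⁻¹ ^ 2 * num A z i * mat A (Sum.inr ()) (Sum.inl l)

lemma num_apply (A : SU n) (z : E n) (i : Fin n) :
    num A z i = ∑ l, mat A (Sum.inl i) (Sum.inl l) * z l + mat A (Sum.inl i) (Sum.inr ()) := by
  simp [num, Matrix.mulVec, dotProduct, lift]

lemma den_apply (A : SU n) (z : E n) :
    den A z = ∑ l, mat A (Sum.inr ()) (Sum.inl l) * z l + mat A (Sum.inr ()) (Sum.inr ()) := by
  simp [den, Matrix.mulVec, dotProduct, lift]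

/-- Multiplying by the unipotent `T` replaces the last column of `A` by `(num A z, den A z)` without
changing the determinant. The Schur complement of the corner `den A z` is `den A z` times the
derivative matrix. -/
lemma det_fracDeriv (A : SU n) (z : E n) (hz : den A z ≠ 0) :
    (fracDeriv A z).det = (den A z)⁻¹ ^ (n + 1) := by
  let T : Matrix (Fin n ⊕ Unit) (Fin n ⊕ Unit) ℂ :=
    Matrix.fromBlocks 1 (Matrix.replicateCol Unit fun i => z i) 0 1
  have hT : T.det = 1 := by simp [T]
  have hA : (mat A).det = 1 := A.1.2
  have hprod : mat A * T = Matrix.fromBlocks (mat A).toBlocks₁₁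
      (Matrix.replicateCol Unit fun i => num A z i) (mat A).toBlocks₂₁
      (Matrix.diagonal fun _ => den A z) := by
    rw [← Matrix.fromBlocks_toBlocks (mat A), Matrix.fromBlocks_multiply]
    ext (i | i) (l | l)
    · simp
    · simp [Matrix.mul_apply, num_apply, Matrix.toBlocks₁₁, Matrix.toBlocks₁₂,
        Matrix.replicateCol]
    · simp
    · simp [Matrix.mul_apply, den_apply, Matrix.toBlocks₂₁, Matrix.toBlocks₂₂,
        Matrix.replicateCol]
  let : Invertible (Matrix.diagonal fun _ : Unit => den A z) :=
    ⟨Matrix.diagonal fun _ => (den A z)⁻¹, by simp [hz], by simp [hz]⟩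
  have hinv : ⅟ (Matrix.diagonal fun _ : Unit => den A z) =
    Matrix.diagonal fun _ => (den A z)⁻¹ := rfl
  have hdet := congrArg Matrix.det hprod
  rw [Matrix.det_mul, hA, hT, Matrix.det_fromBlocks₂₂, hinv, Matrix.det_diagonal] at hdet
  simp only [Finset.univ_unique, Finset.prod_singleton, mul_one] at hdet
  have hF : fracDeriv A z = (den A z)⁻¹ • ((mat A).toBlocks₁₁ -
      (Matrix.replicateCol Unit fun i => num A z i : Matrix (Fin n) Unit ℂ) *
        (Matrix.diagonal fun _ => (den A z)⁻¹ : Matrix Unit Unit ℂ) * (mat A).toBlocks₂₁) := by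
    ext i l
    simp [fracDeriv, Matrix.mul_apply, Matrix.toBlocks₁₁, Matrix.toBlocks₂₁, Matrix.replicateCol]
    ring
  rw [hF, Matrix.det_smul, Fintype.card_fin, pow_succ]
  congr 1
  exact eq_inv_of_mul_eq_one_right hdet.symm

/-- The derivative of `frac A` at `z`, as a continuous linear map. -/
def fracDerivCLM (A : SU n) (z : E n) : E n →L[ℂ] E n :=
  LinearMap.toContinuousLinearMap (Matrix.toLin (EuclideanSpace.basisFun (Fin n) ℂ).toBasis
    (EuclideanSpace.basisFun (Fin n) ℂ).toBasis (fracDeriv A z))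

lemma det_fracDerivCLM (A : SU n) (z : E n) (hz : den A z ≠ 0) :
    (fracDerivCLM A z).det = (den A z)⁻¹ ^ (n + 1) := by
  rw [← det_fracDeriv A z hz, fracDerivCLM, LinearMap.det_toContinuousLinearMap,
    LinearMap.det_toLin]

lemma fracDerivCLM_apply (A : SU n) (z v : E n) (i : Fin n) :
    fracDerivCLM A z v i = ∑ l, fracDeriv A z i l * v l := by
  rw [fracDerivCLM, LinearMap.coe_toContinuousLinearMap',
    ← Matrix.toEuclideanLin_eq_toLin_orthonormal]
  simp [Matrix.mulVec, dotProduct]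

lemma hasFDerivAt_frac (A : SU n) (z : E n) (hz : den A z ≠ 0) :
    HasFDerivAt (frac A) (fracDerivCLM A z) z := by
  rw [← hasFDerivWithinAt_univ, hasFDerivWithinAt_piLp]
  intro i
  rw [hasFDerivWithinAt_univ]
  have hl : ∀ r : Fin n ⊕ Unit, HasFDerivAt
      (fun w : E n => ∑ l, mat A r (Sum.inl l) * w l + mat A r (Sum.inr ()))
      (∑ l, mat A r (Sum.inl l) • (EuclideanSpace.proj l : E n →L[ℂ] ℂ)) z := by
    intro r
    refine HasFDerivAt.add_const _ (HasFDerivAt.fun_sum fun l _ => ?_)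
    exact ((EuclideanSpace.proj l : E n →L[ℂ] ℂ).hasFDerivAt).const_mul _
  have hn := hl (Sum.inl i)
  have hd := hl (Sum.inr ())
  simp only [← num_apply, ← den_apply] at hn hd
  have := ((hasDerivAt_inv hz).comp_hasFDerivAt z hd).mul hn
  refine this.congr_fderiv ?_
  ext v
  have h1 : (PiLp.proj 2 (fun _ => ℂ) i ∘SL fracDerivCLM A z) v =
    ∑ l, fracDeriv A z i l * v l := fracDerivCLM_apply A z v i
  rw [h1]
  have hv : ∀ l, (EuclideanSpace.proj l : E n →L[ℂ] ℂ) v = v l := fun _ => rfl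
  simp only [add_apply, smul_apply, sum_apply, smul_eq_mul, hv, fracDeriv, sub_mul,
    Finset.sum_sub_distrib, Finset.mul_sum, Function.comp_apply]
  rw [← Finset.sum_add_distrib, ← Finset.sum_sub_distrib]
  exact Finset.sum_congr rfl fun l _ => by ring

lemma continuous_den (A : SU n) : Continuous (den A) := by
  have : den A = fun z : E n =>
    ∑ l, mat A (Sum.inr ()) (Sum.inl l) * z l + mat A (Sum.inr ()) (Sum.inr ()) :=
    funext (den_apply A)
  rw [this]
  fun_prop

instance instContinuousConstSMulBall : ContinuousConstSMul (SU n) (Ball n) where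
  continuous_const_smul A := by
    refine Continuous.subtype_mk ?_ _
    rw [continuous_iff_continuousAt]
    intro z
    exact ((hasFDerivAt_frac A z.1 (den_ne_zero A z)).continuousAt).comp
      continuous_subtype_val.continuousAt

lemma jac_toPerm (A : SU n) (z : Ball n) :
    jac (MulAction.toPermHom (SU n) (Ball n) A) z = (den A z)⁻¹ ^ (n + 1) := by
  rw [jac, ← det_fracDerivCLM A z (den_ne_zero A z)]
  congr 1
  refine HasFDerivAt.fderiv ((hasFDerivAt_frac A z (den_ne_zero A z)).congr_of_eventuallyEq ?_)
  filter_upwards [Metric.isOpen_ball.mem_nhds z.2] with w hw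
  rw [dif_pos hw]
  rfl

/-! ### The Bergman kernel under automorphisms -/

/-- The constant `n!/πⁿ`. -/
def bergmanConst (n : ℕ) : ℝ := (n.factorial : ℝ) / Real.pi ^ n

lemma bergmanConst_pos (n : ℕ) : 0 < bergmanConst n := by
  have := Real.pi_pos
  have := n.factorial_pos
  unfold bergmanConst
  positivity

lemma bergman_eq (z w : Ball n) :
    bergman z w = (bergmanConst n : ℂ) / (1 - inner ℂ (w : E n) (z : E n)) ^ (n + 1) := rfl

lemma bergman_self (z : Ball n) :
    bergman z z = ((bergmanConst n / (1 - ‖(z : E n)‖ ^ 2) ^ (n + 1) : ℝ) : ℂ) := by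
  rw [bergman_eq, inner_self_eq_norm_sq_to_K]
  push_cast
  rfl

lemma bergmanDiag_eq (z : Ball n) :
    bergmanDiag z = bergmanConst n / (1 - ‖(z : E n)‖ ^ 2) ^ (n + 1) := by
  rw [bergmanDiag, bergman_self, Complex.ofReal_re]

lemma bergman_self_eq (z : Ball n) : bergman z z = (bergmanDiag z : ℂ) := by
  rw [bergman_self, bergmanDiag_eq]

lemma bergmanDiag_pos (z : Ball n) : 0 < bergmanDiag z := by
  rw [bergmanDiag_eq]
  exact div_pos (bergmanConst_pos n) (pow_pos (one_sub_sq_pos z) _)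

lemma bergman_conj (z w : Ball n) : (starRingEnd ℂ) (bergman z w) = bergman w z := by
  rw [bergman_eq, bergman_eq, map_div₀, map_pow, map_sub, map_one, inner_conj_symm,
    Complex.conj_ofReal]

lemma bergman_smul_smul (A : SU n) (z w : Ball n) :
    bergman (A • z) (A • w) = (den A z * (starRingEnd ℂ) (den A w)) ^ (n + 1) * bergman z w := by
  have h1 := den_ne_zero A z
  have h2 := den_ne_zero A w
  have h2' : (starRingEnd ℂ) (den A w) ≠ 0 := by simpa using h2
  have h3 := one_sub_inner_ne_zero (A • z) (A • w)
  rw [bergman_eq, bergman_eq, ← one_sub_inner_smul A z w, mul_pow _ (1 - _)]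
  field_simp

lemma bergmanDiag_smul (A : SU n) (z : Ball n) :
    bergmanDiag (A • z) = ‖den A z‖ ^ (2 * (n + 1)) * bergmanDiag z := by
  have h1 := norm_pos_iff.2 (den_ne_zero A z)
  have h3 := one_sub_sq_pos (A • z)
  rw [bergmanDiag_eq, bergmanDiag_eq, ← one_sub_sq_smul A z, mul_pow, ← pow_mul]
  field_simp

/-- Explains the normalization used later: dividing by the diagonal values turns the kernel into a
power of the invariant `overlap`. -/
lemma norm_bergman_sq (z w : Ball n) :
    ‖bergman z w‖ ^ 2 = overlap z w ^ (n + 1) * (bergmanDiag z * bergmanDiag w) := by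
  have h1 := one_sub_sq_pos z
  have h2 := one_sub_sq_pos w
  have h3 := norm_one_sub_inner_pos z w
  rw [bergmanDiag_eq, bergmanDiag_eq, bergman_eq, overlap, norm_div, norm_pow, Complex.norm_real,
    Real.norm_of_nonneg (bergmanConst_pos n).le]
  simp only [div_pow, mul_pow]
  field_simp
  ring

/-! ### Invariance of the volume -/

lemma measurable_bergmanDiag : Measurable (bergmanDiag : Ball n → ℝ) := by
  have : (bergmanDiag : Ball n → ℝ) =
    fun z : Ball n => bergmanConst n / (1 - ‖(z : E n)‖ ^ 2) ^ (n + 1) :=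
      funext fun z => bergmanDiag_eq z
  rw [this]
  fun_prop

lemma lintegral_invVol_coe (g : E n → ℝ≥0∞) (hg : Measurable g) :
    ∫⁻ z : Ball n, g z ∂(invVol n) = ∫⁻ x in Metric.ball (0 : E n) 1,
      ENNReal.ofReal (bergmanConst n / (1 - ‖x‖ ^ 2) ^ (n + 1)) * g x := by
  have hg' : Measurable fun z : Ball n => g z := hg.comp measurable_subtype_coe
  rw [invVol, lintegral_withDensity_eq_lintegral_mul _ measurable_bergmanDiag.ennreal_ofReal
    hg', ← lintegral_subtype_comap measurableSet_ball]
  simp only [Pi.mul_apply, bergmanDiag_eq]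

lemma abs_det_restrictScalars (L : E n →L[ℂ] E n) :
    |(L.restrictScalars ℝ).det| = ‖L.det‖ ^ 2 := by
  have : (L.restrictScalars ℝ).det = ‖L.det‖ ^ 2 := by
    have h := LinearMap.det_restrictScalars (R := ℝ) (f := (L : E n →ₗ[ℂ] E n))
    rw [Algebra.norm_complex_apply, Complex.normSq_eq_norm_sq] at h
    exact h
  rw [this, abs_of_nonneg (by positivity)]

lemma frac_image_ball (A : SU n) :
    frac A '' Metric.ball (0 : E n) 1 = Metric.ball (0 : E n) 1 := by
  ext x
  constructor
  · rintro ⟨y, hy, rfl⟩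
    exact frac_mem A ⟨y, hy⟩
  · intro hx
    refine ⟨(A⁻¹ • (⟨x, hx⟩ : Ball n) : Ball n), (A⁻¹ • (⟨x, hx⟩ : Ball n) : Ball n).2, ?_⟩
    rw [← coe_smul, smul_inv_smul]

lemma frac_injOn (A : SU n) : Set.InjOn (frac A) (Metric.ball (0 : E n) 1) := by
  intro x hx y hy h
  have : A • (⟨x, hx⟩ : Ball n) = A • (⟨y, hy⟩ : Ball n) := Subtype.ext h
  exact congrArg Subtype.val (MulAction.injective A this)

/-- The real Jacobian is the squared modulus of the complex one, that is `‖den A z‖` to the power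
`-2(n+1)`, which cancels the factor acquired by `K(z,z)`. -/
lemma measurePreserving_smul_invVol (A : SU n) :
    MeasurePreserving (fun z : Ball n => A • z) (invVol n) (invVol n) := by
  have hm : Measurable (fun z : Ball n => A • z) := (continuous_const_smul A).measurable
  refine ⟨hm, ?_⟩
  ext S hS
  have hS' : MeasurableSet (Subtype.val '' S : Set (E n)) :=
    (MeasurableEmbedding.subtype_coe measurableSet_ball).measurableSet_image.2 hS
  let g : E n → ℝ≥0∞ := (Subtype.val '' S).indicator 1
  have hg : Measurable g := measurable_one.indicator hS'
  have hgz : ∀ z : Ball n, g z = S.indicator 1 z := fun z => by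
    by_cases hz : z ∈ S
    · rw [Set.indicator_of_mem hz]
      exact Set.indicator_of_mem (Set.mem_image_of_mem _ hz) _
    · rw [Set.indicator_of_notMem hz]
      exact Set.indicator_of_notMem (fun h => hz (Subtype.val_injective.mem_set_image.1 h)) _
  rw [Measure.map_apply hm hS, ← lintegral_indicator_one hS, ← lintegral_indicator_one (hm hS)]
  have e1 : ∫⁻ z, S.indicator 1 z ∂(invVol n) = ∫⁻ z : Ball n, g z ∂(invVol n) := by
    simp only [hgz]
  have e2 : ∫⁻ z, ((fun z : Ball n => A • z) ⁻¹' S).indicator 1 z ∂(invVol n) =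
      ∫⁻ x in Metric.ball (0 : E n) 1,
        ENNReal.ofReal (bergmanConst n / (1 - ‖x‖ ^ 2) ^ (n + 1)) * g (frac A x) := by
    rw [← lintegral_subtype_comap measurableSet_ball, invVol,
      lintegral_withDensity_eq_lintegral_mul _ measurable_bergmanDiag.ennreal_ofReal
        (measurable_one.indicator (hm hS))]
    refine lintegral_congr fun z => ?_
    simp only [Pi.mul_apply, bergmanDiag_eq, ← coe_smul, hgz]
    rfl
  rw [e1, e2, lintegral_invVol_coe g hg]
  conv_rhs => rw [← frac_image_ball A]
  rw [lintegral_image_eq_lintegral_abs_det_fderiv_mul volume measurableSet_ball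
    (f' := fun x => (fracDerivCLM A x).restrictScalars ℝ)
    (fun x hx => ((hasFDerivAt_frac A x
      (den_ne_zero A ⟨x, hx⟩)).restrictScalars ℝ).hasFDerivWithinAt) (frac_injOn A)]
  refine setLIntegral_congr_fun measurableSet_ball fun x hx => ?_
  have hd := den_ne_zero A ⟨x, hx⟩
  have h1 := norm_pos_iff.2 hd
  have h := bergmanDiag_smul A ⟨x, hx⟩
  rw [bergmanDiag_eq, bergmanDiag_eq, coe_smul] at h
  simp only
  rw [abs_det_restrictScalars, det_fracDerivCLM A x hd, h, ← mul_assoc,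
    ← ENNReal.ofReal_mul (by positivity)]
  congr 2
  rw [norm_pow, norm_inv, ← pow_mul, mul_comm (n + 1) 2, inv_pow, ← mul_assoc,
    inv_mul_cancel₀ (by positivity), one_mul]

end BallQuotient

end

/-! ### Integrability and the reproducing property. -/

noncomputable section

namespace BallQuotient

variable {n : ℕ}

/-! ### Integrability of powers of the overlap -/

lemma integral_comp_smul (A : SU n) {F : Type*} [NormedAddCommGroup F] [NormedSpace ℝ F]
    (f : Ball n → F) : ∫ w, f (A • w) ∂(invVol n) = ∫ w, f w ∂(invVol n) :=
  (measurePreserving_smul_invVol A).integral_comp (Homeomorph.smul A).measurableEmbedding f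

lemma lintegral_comp_smul (A : SU n) (f : Ball n → ℝ≥0∞) :
    ∫⁻ w, f (A • w) ∂(invVol n) = ∫⁻ w, f w ∂(invVol n) :=
  (measurePreserving_smul_invVol A).lintegral_comp_emb (Homeomorph.smul A).measurableEmbedding f

lemma continuous_overlap : Continuous fun x : Ball n × Ball n => overlap x.1 x.2 := by
  unfold overlap
  refine Continuous.div (by fun_prop) (by fun_prop) fun x => ?_
  exact pow_ne_zero _ (norm_one_sub_inner_pos x.1 x.2).ne'

lemma continuous_overlap_left (p : Ball n) : Continuous fun w : Ball n => overlap w p := by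
  unfold overlap
  refine Continuous.div (by fun_prop) (by fun_prop) fun w => ?_
  exact pow_ne_zero _ (norm_one_sub_inner_pos w p).ne'

/-- Move `p` to the centre: the density `K(w,w)` cancels `(1 - ‖w‖²)^(n+1)` and only Euclidean
volume remains. The finite value, independent of `p`, underlies all later convergence statements. -/
lemma lintegral_overlap_pow (p : Ball n) :
    ∫⁻ w, ENNReal.ofReal (overlap w p ^ (n + 1)) ∂(invVol n) =
      ENNReal.ofReal (bergmanConst n) * volume (Metric.ball (0 : E n) 1) := by
  obtain ⟨A, hA⟩ := exists_smul_origin p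
  rw [← lintegral_comp_smul A]
  simp only [← hA, overlap_smul_smul, overlap_origin]
  rw [lintegral_invVol_coe (fun x => ENNReal.ofReal ((1 - ‖x‖ ^ 2) ^ (n + 1))) (by fun_prop),
    ← setLIntegral_const]
  refine setLIntegral_congr_fun measurableSet_ball fun x hx => ?_
  have h := one_sub_sq_pos ⟨x, hx⟩
  have hb := bergmanConst_pos n
  simp only at h ⊢
  rw [← ENNReal.ofReal_mul (by positivity), div_mul_cancel₀ _ (by positivity)]

lemma integrable_overlap_pow (p : Ball n) :
    Integrable (fun w => overlap w p ^ (n + 1)) (invVol n) := by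
  refine ⟨((continuous_overlap_left p).pow _).aestronglyMeasurable, ?_⟩
  rw [hasFiniteIntegral_iff_ofReal (ae_of_all _ fun w => (pow_pos (overlap_pos w p) _).le),
    lintegral_overlap_pow]
  exact ENNReal.mul_lt_top ENNReal.ofReal_lt_top measure_ball_lt_top

lemma bergmanDiag_origin : bergmanDiag (origin n) = bergmanConst n := by
  simp [bergmanDiag_eq, origin]

lemma inv_bergmanDiag (w : Ball n) :
    (bergmanDiag w)⁻¹ = (bergmanConst n)⁻¹ * overlap w (origin n) ^ (n + 1) := by
  rw [bergmanDiag_eq, overlap_origin, inv_div, div_eq_inv_mul]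

lemma integrable_inv_bergmanDiag_pow {k : ℕ} (hk : 1 ≤ k) :
    Integrable (fun w : Ball n => (bergmanDiag w ^ k)⁻¹) (invVol n) := by
  refine ((integrable_overlap_pow (origin n)).const_mul ((bergmanConst n)⁻¹ ^ k)).mono'
    (measurable_bergmanDiag.pow_const k).inv.aestronglyMeasurable (ae_of_all _ fun w => ?_)
  have h := overlap_pos w (origin n)
  have hb := bergmanConst_pos n
  have hd := bergmanDiag_pos w
  rw [Real.norm_of_nonneg (by positivity), ← inv_pow, inv_bergmanDiag, mul_pow]
  gcongr
  exact pow_le_of_le_one (by positivity) (pow_le_one₀ h.le (overlap_le_one _ _)) (by omega)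

lemma invVol_univ_ne_zero : invVol n Set.univ ≠ 0 := by
  intro h
  have h1 := lintegral_overlap_pow (origin n)
  rw [Measure.measure_univ_eq_zero.1 h, lintegral_zero_measure] at h1
  exact mul_ne_zero (by simpa using bergmanConst_pos n)
    (Metric.measure_ball_pos _ _ one_pos).ne' h1.symm

lemma integral_inv_bergmanDiag_pow_pos {k : ℕ} (hk : 1 ≤ k) :
    0 < ∫ w : Ball n, (bergmanDiag w ^ k)⁻¹ ∂(invVol n) := by
  have h : ∀ w : Ball n, 0 < (bergmanDiag w ^ k)⁻¹ := fun w =>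
    inv_pos.2 (pow_pos (bergmanDiag_pos w) k)
  rw [integral_pos_iff_support_of_nonneg (fun w => (h w).le) (integrable_inv_bergmanDiag_pow hk)]
  have : Function.support (fun w : Ball n => (bergmanDiag w ^ k)⁻¹) = Set.univ :=
    Set.eq_univ_of_forall fun w => (h w).ne'
  rw [this]
  exact pos_iff_ne_zero.2 invVol_univ_ne_zero

/-! ### The mean value property -/

/-- The rotation `w ↦ ζ^{n+1} w` as an element of `SU(n,1)`. -/
def rotation (n : ℕ) (ζ : Circle) : SU n :=
  ⟨⟨Matrix.diagonal (Sum.elim (fun _ => (ζ : ℂ)) fun _ => ((ζ⁻¹ : Circle) : ℂ) ^ n), by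
    simp [Matrix.det_diagonal]⟩, by
    change _ = _
    have h1 : (ζ : ℂ) * (starRingEnd ℂ) (ζ : ℂ) = 1 := by simp [Complex.mul_conj]
    rw [sig, Matrix.diagonal_transpose, Matrix.diagonal_map (map_zero _),
      Matrix.diagonal_mul_diagonal, Matrix.diagonal_mul_diagonal]
    congr 1
    funext i
    rcases i with i | i
    · simp [Complex.mul_conj]
    · simp [← mul_inv, ← mul_pow, h1]⟩

lemma coe_rotation_smul (ζ : Circle) (w : Ball n) :
    ((rotation n ζ • w : Ball n) : E n) = (ζ : ℂ) ^ (n + 1) • (w : E n) := by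
  rw [coe_smul]
  ext i
  simp [frac, num, den, mat, rotation, Matrix.mulVec_diagonal, lift]
  ring

lemma overlap_rotation_smul (ζ : Circle) (w : Ball n) :
    overlap (rotation n ζ • w) (origin n) = overlap w (origin n) := by
  rw [overlap_origin, overlap_origin, coe_rotation_smul, norm_smul, norm_pow, Circle.norm_coe,
    one_pow, one_mul]

/-- Mean value property: for `‖a‖ < 1` the function has no pole in the closed unit disc, and its
value at `ζ = 0` is `c ^ k`. -/
lemma circleAverage_bergman (a : ℂ) (ha : ‖a‖ < 1) (c : ℂ) (k : ℕ) :
    Real.circleAverage (fun ζ => (c / (1 - ζ ^ (n + 1) * a) ^ (n + 1)) ^ k) 0 1 = c ^ k := by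
  rw [DiffContOnCl.circleAverage]
  · simp
  · refine DifferentiableOn.diffContOnCl fun ζ hζ => ?_
    have hne : (1 - ζ ^ (n + 1) * a) ^ (n + 1) ≠ 0 := by
      rw [abs_one, closure_ball _ one_ne_zero, mem_closedBall_zero_iff] at hζ
      refine pow_ne_zero _ fun h => ?_
      have h1 : ‖ζ ^ (n + 1) * a‖ < 1 := by
        rw [norm_mul, norm_pow]
        calc _ ≤ 1 * ‖a‖ := by gcongr; exact pow_le_one₀ (norm_nonneg _) hζ
          _ < 1 := by rwa [one_mul]
      rw [← sub_eq_zero.1 h] at h1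
      simp at h1
    exact DifferentiableAt.differentiableWithinAt (by fun_prop (disch := exact hne))

lemma bergman_rotation_smul (θ : ℝ) (w p : Ball n) :
    bergman (rotation n (Circle.exp θ) • w) p = (bergmanConst n : ℂ) /
      (1 - circleMap 0 1 θ ^ (n + 1) * inner ℂ (p : E n) (w : E n)) ^ (n + 1) := by
  rw [bergman_eq, coe_rotation_smul, inner_smul_right]
  simp [circleMap]

instance instSFiniteInvVol : SFinite (invVol n) := by
  have : IsFiniteMeasure ((volume : Measure (E n)).comap (Subtype.val : Ball n → E n)) := by
    constructor
    rw [(MeasurableEmbedding.subtype_coe measurableSet_ball).comap_apply, Set.image_univ,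
      Subtype.range_coe]
    exact measure_ball_lt_top
  unfold invVol
  infer_instance

/-- A rotation of the ball leaves the integral unchanged, so the kernel may be averaged over the
circle first. By holomorphy in `w` the average is its value at the centre, a constant. -/
lemma integral_mul_bergman_pow (r : Ball n → ℝ) (hr : Integrable r (invVol n))
    (hinv : ∀ ζ w, r (rotation n ζ • w) = r w) (p : Ball n) (k : ℕ) :
    ∫ w, (r w : ℂ) * bergman w p ^ k ∂(invVol n) =
      (bergmanConst n : ℂ) ^ k * ∫ w, (r w : ℂ) ∂(invVol n) := by
  have hp : ‖(p : E n)‖ < 1 := mem_ball_zero_iff.1 p.2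
  set f : ℝ → Ball n → ℂ := fun θ w => (r w : ℂ) * ((bergmanConst n : ℂ) /
      (1 - circleMap 0 1 θ ^ (n + 1) * inner ℂ (p : E n) (w : E n)) ^ (n + 1)) ^ k with hf
  have h1 : ∀ θ, ∫ w, f θ w ∂(invVol n) = ∫ w, (r w : ℂ) * bergman w p ^ k ∂(invVol n) := by
    intro θ
    rw [← integral_comp_smul (rotation n (Circle.exp θ)) fun w => (r w : ℂ) * bergman w p ^ k]
    simp only [hinv, bergman_rotation_smul, hf]
  have h2 : ∀ w, ∫ θ in (0 : ℝ)..(2 * Real.pi), f θ w =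
      (2 * Real.pi : ℝ) • ((r w : ℂ) * (bergmanConst n : ℂ) ^ k) := by
    intro w
    simp only [hf]
    rw [intervalIntegral.integral_const_mul,
      ← circleAverage_bergman (n := n) _ (norm_inner_lt_one w p) (bergmanConst n) k,
      Real.circleAverage, mul_smul_comm, smul_smul, mul_inv_cancel₀ (by positivity), one_smul]
  -- Fubini is justified because the denominator stays at least `1 - ‖p‖` away from zero.
  have hInt : Integrable (Function.uncurry f)
      ((volume.restrict (Set.uIoc 0 (2 * Real.pi))).prod (invVol n)) := by
    have hfin : IsFiniteMeasure ((volume : Measure ℝ).restrict (Set.uIoc 0 (2 * Real.pi))) := by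
      constructor
      rw [Measure.restrict_apply_univ, Set.uIoc]
      exact measure_Ioc_lt_top
    have hr' : Integrable (fun x : ℝ × Ball n => (r x.2 : ℂ))
        ((volume.restrict (Set.uIoc 0 (2 * Real.pi))).prod (invVol n)) :=
      Integrable.comp_snd (f := fun w => (r w : ℂ)) hr.ofReal _
    refine hr'.mul_bdd (c := (bergmanConst n / (1 - ‖(p : E n)‖) ^ (n + 1)) ^ k)
      (Measurable.aestronglyMeasurable ?_) (ae_of_all _ fun x => ?_)
    · have := (continuous_circleMap 0 1).measurable
      fun_prop
    · have hb := bergmanConst_pos n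
      have hw : ‖((x.2 : Ball n) : E n)‖ < 1 := mem_ball_zero_iff.1 x.2.2
      have hp' : 0 < 1 - ‖(p : E n)‖ := by linarith
      rw [norm_pow, norm_div, norm_pow, Complex.norm_real, Real.norm_of_nonneg hb.le]
      gcongr
      have h3 := norm_sub_norm_le (1 : ℂ)
        (circleMap 0 1 x.1 ^ (n + 1) * inner ℂ (p : E n) (x.2 : E n))
      have h4 := norm_inner_le_norm (𝕜 := ℂ) (p : E n) (x.2 : E n)
      rw [norm_mul, norm_pow, norm_circleMap_zero, norm_one, abs_one, one_pow, one_mul] at h3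
      nlinarith [norm_nonneg (p : E n)]
  have h3 := intervalIntegral_integral_swap (f := f) hInt
  simp only [h1, h2] at h3
  rw [intervalIntegral.integral_const, integral_smul, sub_zero] at h3
  have := smul_right_injective ℂ (by positivity : (2 * Real.pi) ≠ 0) h3
  rw [this, integral_mul_const, mul_comm]

/-! ### The reproducing property -/

lemma bergman_origin_left (w : Ball n) : bergman (origin n) w = bergmanConst n := by
  simp [bergman_eq, origin]

lemma bergman_origin_right (w : Ball n) : bergman w (origin n) = bergmanConst n := by
  simp [bergman_eq, origin]

lemma kernelConst_eq (k : ℕ) : kernelConst n k =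
    ((bergmanConst n ^ k * ∫ w : Ball n, (bergmanDiag w ^ k)⁻¹ ∂(invVol n))⁻¹ : ℝ) := by
  have hb : (bergmanConst n : ℂ) ^ k ≠ 0 :=
    pow_ne_zero _ (by exact_mod_cast (bergmanConst_pos n).ne')
  rw [kernelConst]
  simp only [bergman_origin_left, bergman_origin_right, bergman_self_eq, bergmanDiag_origin,
    div_eq_mul_inv]
  rw [integral_const_mul]
  have : ∫ w : Ball n, ((bergmanDiag w : ℂ) ^ k)⁻¹ ∂(invVol n) =
      ((∫ w : Ball n, (bergmanDiag w ^ k)⁻¹ ∂(invVol n) : ℝ) : ℂ) := by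
    rw [← integral_complex_ofReal]
    push_cast
    rfl
  rw [this]
  push_cast
  rw [mul_inv, mul_inv, mul_inv, ← mul_assoc, ← mul_assoc, mul_inv_cancel₀ hb, one_mul]

lemma reproducing_origin {k : ℕ} (hk : 1 ≤ k) (p : Ball n) :
    kernelConst n k * ∫ w, bergman (origin n) w ^ k * bergman w p ^ k /
      bergman w w ^ k ∂(invVol n) = bergman (origin n) p ^ k := by
  have hI := integral_inv_bergmanDiag_pow_pos (n := n) hk
  have h := integral_mul_bergman_pow (n := n) _ (integrable_inv_bergmanDiag_pow hk)
    (fun ζ w => by rw [← inv_pow, ← inv_pow, inv_bergmanDiag, inv_bergmanDiag,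
      overlap_rotation_smul]) p k
  have e : ∀ w : Ball n, bergman (origin n) w ^ k * bergman w p ^ k / bergman w w ^ k =
      (bergmanConst n : ℂ) ^ k * ((((bergmanDiag w ^ k)⁻¹ : ℝ) : ℂ) * bergman w p ^ k) := by
    intro w
    rw [bergman_origin_left, bergman_self_eq, div_eq_mul_inv]
    push_cast
    ring
  simp only [e]
  rw [integral_const_mul, h, integral_complex_ofReal, kernelConst_eq, bergman_origin_left]
  generalize ∫ w : Ball n, (bergmanDiag w ^ k)⁻¹ ∂(invVol n) = I at hI
  have hb : (bergmanConst n : ℂ) ≠ 0 := by exact_mod_cast (bergmanConst_pos n).ne'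
  have hI' : (I : ℂ) ≠ 0 := by exact_mod_cast hI.ne'
  push_cast
  field_simp

/-- Transport `q` to the centre. The factors `den A w` cancel between numerator and denominator;
those at `q` and `p` leave the integral and are the ones required by the right side. -/
theorem reproducing {k : ℕ} (hk : 1 ≤ k) (q p : Ball n) :
    kernelConst n k * ∫ w, bergman q w ^ k * bergman w p ^ k / bergman w w ^ k ∂(invVol n) =
      bergman q p ^ k := by
  obtain ⟨A, rfl⟩ := exists_smul_origin q
  obtain ⟨p, rfl⟩ : ∃ p', p = A • p' := ⟨A⁻¹ • p, by simp⟩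
  rw [← integral_comp_smul A]
  simp only [bergman_smul_smul]
  have hc : ∀ w : Ball n, (starRingEnd ℂ) (den A w) ≠ 0 := fun w => by
    simpa using den_ne_zero A w
  have e : ∀ w : Ball n,
      ((den A (origin n) * (starRingEnd ℂ) (den A w)) ^ (n + 1) * bergman (origin n) w) ^ k *
      ((den A w * (starRingEnd ℂ) (den A p)) ^ (n + 1) * bergman w p) ^ k /
      ((den A w * (starRingEnd ℂ) (den A w)) ^ (n + 1) * bergman w w) ^ k =
      ((den A (origin n) * (starRingEnd ℂ) (den A p)) ^ (n + 1)) ^ k *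
        (bergman (origin n) w ^ k * bergman w p ^ k / bergman w w ^ k) := by
    intro w
    have h1 := hc w
    have h2 := den_ne_zero A w
    have h3 : bergman w w ≠ 0 := by
      rw [bergman_self_eq]; exact_mod_cast (bergmanDiag_pos w).ne'
    simp only [mul_pow]
    field_simp
  simp only [e]
  rw [integral_const_mul, mul_left_comm, reproducing_origin hk, ← mul_pow]

end BallQuotient

end

/-! ### Discrete groups, Dirichlet domains and convergence of the series. -/

noncomputable section

namespace BallQuotient

variable {n : ℕ}

/-! ### Local finiteness of discrete groups -/

/-- One-sided inverses of square matrices are two-sided, so `Aᵀ σ Ā = σ` also yields `Ā σ Aᵀ = σ`;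
its diagonal entries are these signed row sums. -/
lemma sum_norm_sq_row (A : SU n) (r : Fin n ⊕ Unit) :
    ∑ l, ‖mat A r (Sum.inl l)‖ ^ 2 - ‖mat A r (Sum.inr ())‖ ^ 2 ≤ 1 := by
  have h : (mat A)ᵀ * sig n * (mat A).map (starRingEnd ℂ) = sig n := A.2
  have hs : sig n * sig n = 1 := by
    rw [sig, Matrix.diagonal_mul_diagonal, ← Matrix.diagonal_one]
    congr 1
    funext i
    rcases i with i | i <;> simp
  have h1 : (sig n * (mat A)ᵀ * sig n) * (mat A).map (starRingEnd ℂ) = 1 := by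
    rw [Matrix.mul_assoc, Matrix.mul_assoc, ← Matrix.mul_assoc (mat A)ᵀ, h, hs]
  have h2 := mul_eq_one_comm.1 h1
  have h3 : (mat A).map (starRingEnd ℂ) * sig n * (mat A)ᵀ = sig n := by
    calc _ = (mat A).map (starRingEnd ℂ) * (sig n * (mat A)ᵀ * sig n) * sig n := by
          simp only [Matrix.mul_assoc, hs, Matrix.mul_one]
      _ = _ := by rw [h2, Matrix.one_mul]
  have h4 := congrFun (congrFun h3 r) r
  have h5 : ((∑ l, ‖mat A r (Sum.inl l)‖ ^ 2 - ‖mat A r (Sum.inr ())‖ ^ 2 : ℝ) : ℂ) =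
      sig n r r := by
    rw [← h4, sig, Matrix.mul_apply]
    simp [Matrix.mul_diagonal, Complex.conj_mul', sub_eq_add_neg]
  rcases r with r | r
  · have : sig n (Sum.inl r) (Sum.inl r) = ((1 : ℝ) : ℂ) := by simp [sig]
    rw [this] at h5
    exact (Complex.ofReal_injective h5).le
  · have : sig n (Sum.inr r) (Sum.inr r) = ((-1 : ℝ) : ℂ) := by simp [sig]
    rw [this] at h5
    linarith [Complex.ofReal_injective h5]

/-- The corner entry `den A 0` controls the last column through `norm_num_sub`, and then every row
through `sum_norm_sq_row`. A bound on it thus confines `A` to a compact set. -/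
lemma norm_mat_sq_le (A : SU n) (r l : Fin n ⊕ Unit) :
    ‖mat A r l‖ ^ 2 ≤ 1 + ‖den A (origin n)‖ ^ 2 := by
  have hnum : ∀ i, num A (origin n) i = mat A (Sum.inl i) (Sum.inr ()) := fun i => by
    simp [num_apply, origin]
  have hden : den A (origin n) = mat A (Sum.inr ()) (Sum.inr ()) := by
    simp [den_apply, origin]
  have hlast : ‖mat A r (Sum.inr ())‖ ^ 2 ≤ ‖den A (origin n)‖ ^ 2 := by
    rcases r with i | i
    · have h := norm_num_sub A (origin n)
      have h1 : ‖num A (origin n) i‖ ≤ ‖num A (origin n)‖ := PiLp.norm_apply_le _ i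
      rw [hnum] at h1
      have h2 : ‖((origin n : Ball n) : E n)‖ = 0 := by simp [origin]
      rw [h2] at h
      nlinarith [norm_nonneg (mat A (Sum.inl i) (Sum.inr ()))]
    · rw [hden]
  rcases l with l | l
  · have h := sum_norm_sq_row A r
    have h1 : ‖mat A r (Sum.inl l)‖ ^ 2 ≤ ∑ l, ‖mat A r (Sum.inl l)‖ ^ 2 :=
      Finset.single_le_sum (f := fun l => ‖mat A r (Sum.inl l)‖ ^ 2)
        (fun _ _ => sq_nonneg _) (Finset.mem_univ l)
    linarith
  · linarith

lemma isClosedEmbedding_mat : IsClosedEmbedding (mat : SU n → _) := by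
  have h1 : IsClosedEmbedding
      (Subtype.val : Matrix.SpecialLinearGroup (Fin n ⊕ Unit) ℂ → Matrix _ _ ℂ) := by
    refine IsClosed.isClosedEmbedding_subtypeVal ?_
    exact isClosed_eq (by fun_prop) continuous_const
  have h2 : IsClosedEmbedding
      (Subtype.val : SU n → Matrix.SpecialLinearGroup (Fin n ⊕ Unit) ℂ) := by
    refine IsClosed.isClosedEmbedding_subtypeVal ?_
    change IsClosed {A : Matrix.SpecialLinearGroup (Fin n ⊕ Unit) ℂ |
      A.1ᵀ * sig n * A.1.map (starRingEnd ℂ) = sig n}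
    have hc : Continuous fun A : Matrix.SpecialLinearGroup (Fin n ⊕ Unit) ℂ => A.1 :=
      continuous_subtype_val
    refine isClosed_eq ?_ continuous_const
    exact (hc.matrix_transpose.matrix_mul continuous_const).matrix_mul
      (hc.matrix_map Complex.continuous_conj)
  exact h1.comp h2

/-- A discrete subgroup is closed, and a closed discrete set meets a compact set in finitely many
points. -/
lemma finite_den_le (Γ : Subgroup (SU n)) (hΓ : DiscreteTopology Γ) (R : ℝ) :
    {A : SU n | A ∈ Γ ∧ ‖den A (origin n)‖ ^ 2 ≤ R}.Finite := by
  have hclosed : IsClosed (Γ : Set (SU n)) := Subgroup.isClosed_of_discrete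
  have hK : IsCompact {M : Matrix (Fin n ⊕ Unit) (Fin n ⊕ Unit) ℂ |
      ∀ r l, M r l ∈ Metric.closedBall (0 : ℂ) (Real.sqrt (1 + R))} := by
    have h : IsCompact (Set.univ.pi fun _ : Fin n ⊕ Unit => Set.univ.pi fun _ : Fin n ⊕ Unit =>
        Metric.closedBall (0 : ℂ) (Real.sqrt (1 + R))) :=
      isCompact_univ_pi fun _ => isCompact_univ_pi fun _ => isCompact_closedBall _ _
    have e : {M : Matrix (Fin n ⊕ Unit) (Fin n ⊕ Unit) ℂ |
        ∀ r l, M r l ∈ Metric.closedBall (0 : ℂ) (Real.sqrt (1 + R))} =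
        (Set.univ.pi fun _ : Fin n ⊕ Unit => Set.univ.pi fun _ : Fin n ⊕ Unit =>
        Metric.closedBall (0 : ℂ) (Real.sqrt (1 + R))) := by
      apply Set.ext
      intro M
      exact ⟨fun h r _ l _ => h r l, fun h r l => h r trivial l trivial⟩
    rw [e]
    exact h
  have hK' := (isClosedEmbedding_mat (n := n)).isCompact_preimage hK
  have hfin : (mat ⁻¹' {M : Matrix (Fin n ⊕ Unit) (Fin n ⊕ Unit) ℂ |
      ∀ r l, M r l ∈ Metric.closedBall (0 : ℂ) (Real.sqrt (1 + R))} ∩ (Γ : Set (SU n))).Finite := by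
    refine (hK'.inter_right hclosed).finite ?_
    exact IsDiscrete.mono ⟨hΓ⟩ Set.inter_subset_right
  refine hfin.subset ?_
  rintro A ⟨hA, hR⟩
  refine ⟨fun r l => ?_, hA⟩
  rw [mem_closedBall_zero_iff]
  apply Real.le_sqrt_of_sq_le
  exact (norm_mat_sq_le A r l).trans (by linarith)

/-! ### The action of the group of automorphisms -/

variable {Γ : Subgroup (SU n)}

lemma aut_smul_def (g : autGroup Γ) (z : Ball n) : g • z = g.1 z := rfl

lemma exists_rep (g : autGroup Γ) :
    ∃ A ∈ Γ, MulAction.toPermHom (SU n) (Ball n) A = g.1 ∧ ∀ z : Ball n, g • z = A • z := by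
  obtain ⟨A, hA, h⟩ := Subgroup.mem_map.1 g.2
  exact ⟨A, hA, h, fun z => by rw [aut_smul_def, ← h]; rfl⟩

lemma overlap_aut_smul (g : autGroup Γ) (z w : Ball n) :
    overlap (g • z) (g • w) = overlap z w := by
  obtain ⟨A, -, -, h⟩ := exists_rep g
  rw [h, h, overlap_smul_smul]

lemma overlap_aut_smul_left (g : autGroup Γ) (z w : Ball n) :
    overlap (g • z) w = overlap z (g⁻¹ • w) := by
  rw [← overlap_aut_smul g z, smul_inv_smul]

instance instContinuousConstSMulAut : ContinuousConstSMul (autGroup Γ) (Ball n) where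
  continuous_const_smul g := by
    obtain ⟨A, -, -, h⟩ := exists_rep g
    simp only [h]
    exact continuous_const_smul A

instance instMeasurableConstSMulAut : MeasurableConstSMul (autGroup Γ) (Ball n) where
  measurable_const_smul g := (continuous_const_smul g).measurable

instance instSMulInvariantMeasureAut : SMulInvariantMeasure (autGroup Γ) (Ball n) (invVol n) where
  measure_preimage_smul g S hS := by
    obtain ⟨A, -, -, h⟩ := exists_rep g
    simp only [h]
    exact (measurePreserving_smul_invVol A).measure_preimage hS.nullMeasurableSet

lemma overlap_smul_origin_eq (A : SU n) :
    overlap (A • origin n) (origin n) = (‖den A (origin n)‖ ^ 2)⁻¹ := by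
  have h := one_sub_sq_smul A (origin n)
  have h2 : ‖((origin n : Ball n) : E n)‖ = 0 := by simp [origin]
  rw [h2] at h
  rw [overlap_origin]
  apply eq_inv_of_mul_eq_one_right
  rw [h]; norm_num

lemma finite_overlap_ge (hΓ : DiscreteTopology Γ) {ε : ℝ} (hε : 0 < ε) (z w : Ball n) :
    {g : autGroup Γ | ε ≤ overlap (g • z) w}.Finite := by
  set o := origin n
  -- The bound for `overlap (g • o) o` obtained by passing from `(g • z, w)` to `(g • z, o)` and
  -- then to `(g • o, o)`; each use of the quasi-triangle inequality costs a factor `4`.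
  set η : ℝ := overlap o z * (ε * overlap o w / 4) / 4 with hη
  have hη0 : 0 < η := by
    have := overlap_pos o z
    have := overlap_pos o w
    positivity
  have hfin := (finite_den_le Γ hΓ η⁻¹).image fun A => MulAction.toPermHom (SU n) (Ball n) A
  refine Set.Finite.of_finite_image (f := Subtype.val) (hfin.subset ?_)
    Subtype.val_injective.injOn
  rintro _ ⟨g, hg, rfl⟩
  obtain ⟨A, hA, hAg, h⟩ := exists_rep g
  refine ⟨A, ⟨hA, ?_⟩, hAg⟩
  rw [Set.mem_ofPred_eq] at hg
  have h1 := overlap_mul_overlap_le (g • z) w o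
  have h2 := overlap_mul_overlap_le (g • o) (g • z) o
  rw [overlap_aut_smul, overlap_comm o (g • z)] at h2
  have h3 : η ≤ overlap (g • o) o := by
    have ho := overlap_pos o z
    have hw := overlap_pos o w
    have h4 : ε * overlap o w / 4 ≤ overlap (g • z) o := by nlinarith
    have : overlap o z * (ε * overlap o w / 4) ≤ overlap o z * overlap (g • z) o := by gcongr
    rw [hη]
    linarith
  rw [h, overlap_smul_origin_eq] at h3
  have hd := norm_pos_iff.2 (den_ne_zero A (origin n))
  exact (le_inv_comm₀ hη0 (by positivity)).1 h3

lemma countable_autGroup (hΓ : DiscreteTopology Γ) : Countable (autGroup Γ) := by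
  rw [← Set.countable_univ_iff]
  have : (Set.univ : Set (autGroup Γ)) =
      ⋃ k : ℕ, {g | 1 / ((k : ℝ) + 1) ≤ overlap (g • origin n) (origin n)} := by
    symm
    refine Set.eq_univ_of_forall fun g => Set.mem_iUnion.2 ?_
    obtain ⟨k, hk⟩ := exists_nat_one_div_lt (overlap_pos (g • origin n) (origin n))
    exact ⟨k, hk.le⟩
  rw [this]
  exact Set.countable_iUnion fun k => (finite_overlap_ge hΓ (by positivity) _ _).countable

/-! ### Dirichlet domains are fundamental domains -/

/-- With `p` at the centre the bisector is `‖1 - ⟨q,z⟩‖² = 1 - ‖q‖²`, contained in the preimage of a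
circle under a surjective linear map to `ℂ`. -/
lemma invVol_bisector {p q : Ball n} (h : p ≠ q) :
    invVol n {z | overlap z p = overlap z q} = 0 := by
  obtain ⟨A, rfl⟩ := exists_smul_origin p
  obtain ⟨q, rfl⟩ : ∃ q', q = A • q' := ⟨A⁻¹ • q, by simp⟩
  have hq : q ≠ origin n := fun hq => h (by rw [hq])
  have hcl : IsClosed {z : Ball n | overlap z (A • origin n) = overlap z (A • q)} :=
    isClosed_eq (continuous_overlap_left _) (continuous_overlap_left _)
  rw [← (measurePreserving_smul_invVol A).measure_preimage hcl.measurableSet.nullMeasurableSet]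
  simp only [Set.preimage_ofPred_eq, overlap_smul_smul]
  refine withDensity_absolutelyContinuous _ _ ?_
  rw [(MeasurableEmbedding.subtype_coe measurableSet_ball).comap_apply]
  have hq0 : (q : E n) ≠ 0 := fun h0 => hq (Subtype.ext h0)
  let L : E n →ₗ[ℝ] ℂ := ((innerSL ℂ (q : E n) : E n →L[ℂ] ℂ) : E n →ₗ[ℂ] ℂ).restrictScalars ℝ
  have hL : Function.Surjective L := by
    intro u
    have hqq : inner ℂ (q : E n) (q : E n) ≠ 0 := inner_self_ne_zero.2 hq0
    refine ⟨(u / inner ℂ (q : E n) (q : E n)) • (q : E n), ?_⟩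
    change inner ℂ (q : E n) ((u / inner ℂ (q : E n) (q : E n)) • (q : E n)) = u
    rw [inner_smul_right, div_mul_cancel₀ _ hqq]
  set R := Real.sqrt (1 - ‖(q : E n)‖ ^ 2)
  have hs : MeasurableSet ((Metric.sphere (1 : ℂ) R)ᶜ) := Metric.isClosed_sphere.measurableSet.compl
  have hae : ∀ᵐ u : ℂ, u ∈ (Metric.sphere (1 : ℂ) R)ᶜ := by
    rw [ae_iff]
    simp only [Set.mem_compl_iff, not_not]
    exact Measure.addHaar_sphere volume (1 : ℂ) R
  have h1 := (ae_comp_linearMap_mem_iff L (volume : Measure (E n)) (volume : Measure ℂ) hL hs).2 hae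
  rw [ae_iff] at h1
  refine measure_mono_null ?_ h1
  rintro _ ⟨z, hz, rfl⟩
  simp only [Set.mem_ofPred_eq, Set.mem_compl_iff, not_not]
  rw [Set.mem_ofPred_eq, overlap_origin, overlap] at hz
  have hz1 := one_sub_sq_pos z
  have hz2 := norm_one_sub_inner_pos z q
  rw [eq_div_iff (by positivity)] at hz
  have hz3 := mul_left_cancel₀ hz1.ne' hz
  change L z.1 ∈ Metric.sphere (1 : ℂ) R
  rw [mem_sphere_iff_norm, norm_sub_rev]
  change ‖1 - inner ℂ (q : E n) (z : E n)‖ = R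
  rw [← Real.sqrt_sq (norm_nonneg _), hz3]

lemma mem_dirichlet_iff {z₀ z : Ball n} : z ∈ dirichlet Γ z₀ ↔
    ∀ g : autGroup Γ, g ≠ 1 → overlap z (g • z₀) < overlap z z₀ := by
  constructor
  · intro h g hg
    exact (tau_lt_tau_iff _ _ _ _).1 (h g.1 g.2 fun h1 => hg (Subtype.ext h1))
  · intro h g hg h1
    exact (tau_lt_tau_iff _ _ _ _).2 (h ⟨g, hg⟩ fun h2 => h1 (congrArg Subtype.val h2))

lemma measurableSet_dirichlet (hΓ : DiscreteTopology Γ) (z₀ : Ball n) :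
    MeasurableSet (dirichlet Γ z₀) := by
  have := countable_autGroup hΓ
  have h : dirichlet Γ z₀ = ⋂ g : autGroup Γ, ⋂ _ : g ≠ 1,
      {z | overlap z (g • z₀) < overlap z z₀} := by
    ext z
    simp [mem_dirichlet_iff]
  rw [h]
  exact MeasurableSet.iInter fun g => MeasurableSet.iInter fun _ =>
    (isOpen_lt (continuous_overlap_left _) (continuous_overlap_left _)).measurableSet

lemma smul_notMem_dirichlet {z₀ z : Ball n} (hz : z ∈ dirichlet Γ z₀) {g : autGroup Γ}
    (hg : g ≠ 1) : g • z ∉ dirichlet Γ z₀ := by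
  intro h
  have h1 := mem_dirichlet_iff.1 h g hg
  rw [overlap_aut_smul, overlap_aut_smul_left] at h1
  exact lt_asymm h1 (mem_dirichlet_iff.1 hz g⁻¹ (by simpa using hg))

/-- Freeness makes the points of the orbit of `z₀` distinct, so outside countably many null
bisectors the distances from `z` to them are distinct. Local finiteness provides a nearest one, `g •
z₀`, and then `g⁻¹` moves `z` into the domain. -/
theorem isFundamentalDomain_dirichlet (hΓ : IsSmoothCocompact Γ) (z₀ : Ball n) :
    IsFundamentalDomain (autGroup Γ) (dirichlet Γ z₀) (invVol n) := by
  have := countable_autGroup hΓ.discrete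
  refine ⟨(measurableSet_dirichlet hΓ.discrete z₀).nullMeasurableSet, ?_, ?_⟩
  · have hne : ∀ g h : autGroup Γ, g ≠ h → g • z₀ ≠ h • z₀ := by
      intro g h hgh e
      refine hΓ.free (h⁻¹ * g).1 (h⁻¹ * g).2 (fun h1 => hgh ?_) z₀ ?_
      · exact (inv_mul_eq_one.1 (Subtype.ext h1)).symm
      · change (h⁻¹ * g) • z₀ = z₀
        rw [mul_smul, e, inv_smul_smul]
    have hae : ∀ᵐ z ∂(invVol n), ∀ g h : autGroup Γ, g ≠ h →
        overlap z (g • z₀) ≠ overlap z (h • z₀) := by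
      simp only [ae_all_iff]
      intro g h hgh
      rw [ae_iff]
      simpa using invVol_bisector (hne g h hgh)
    filter_upwards [hae] with z hz
    have hfin := finite_overlap_ge hΓ.discrete (overlap_pos z z₀) z₀ z
    obtain ⟨g, hg, hmax⟩ := Set.exists_max_image _ (fun g => overlap (g • z₀) z) hfin
      ⟨1, by simp [overlap_comm z₀ z]⟩
    have hlt : ∀ h : autGroup Γ, h ≠ g → overlap z (h • z₀) < overlap z (g • z₀) := by
      intro h hh
      refine lt_of_le_of_ne ?_ (hz h g hh)
      rw [overlap_comm z, overlap_comm z]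
      by_cases hm : h ∈ {g : autGroup Γ | overlap z z₀ ≤ overlap (g • z₀) z}
      · exact hmax h hm
      · exact (not_le.1 hm).le.trans hg
    refine ⟨g⁻¹, mem_dirichlet_iff.2 fun h hh => ?_⟩
    rw [overlap_aut_smul_left, overlap_aut_smul_left, inv_inv, smul_smul]
    exact hlt _ (by simpa using hh)
  · intro g h hgh
    refine Disjoint.aedisjoint (Set.disjoint_left.2 ?_)
    rintro _ ⟨x, hx, rfl⟩ ⟨y, hy, e⟩
    refine smul_notMem_dirichlet hx (g := h⁻¹ * g) (fun h1 => hgh (inv_mul_eq_one.1 h1).symm) ?_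
    have e' : h • y = g • x := e
    rwa [mul_smul, ← e', inv_smul_smul]

/-- By compactness of the quotient one ball about `z₀` meets every orbit. A point of the domain is
at least as close to `z₀` as the rest of its orbit, so the domain lies in a slightly larger ball,
whose volume is finite by Markov's inequality. -/
lemma invVol_dirichlet_lt_top (hΓ : IsSmoothCocompact Γ) (z₀ : Ball n) :
    invVol n (dirichlet Γ z₀) < ⊤ := by
  have := hΓ.compact
  let U : ℕ → Set (Ball n) := fun k => {z | 1 / ((k : ℝ) + 1) < overlap z z₀}
  have hU : ∀ k, IsOpen (U k) := fun k => isOpen_lt continuous_const (continuous_overlap_left z₀)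
  let π : Ball n → Quotient (MulAction.orbitRel (autGroup Γ) (Ball n)) := Quotient.mk _
  have hπ : IsOpenMap π := isOpenMap_quotient_mk'_mul
  have hmono : Monotone U := by
    intro i l hil z hz
    have hz' : 1 / ((i : ℝ) + 1) < overlap z z₀ := hz
    refine lt_of_le_of_lt ?_ hz'
    gcongr
  obtain ⟨k, hk⟩ := isCompact_univ.elim_directed_cover (fun k => π '' U k)
    (fun k => hπ _ (hU k)) (fun x _ => by
      obtain ⟨z, rfl⟩ := Quotient.exists_rep x
      obtain ⟨k, hk⟩ := exists_nat_one_div_lt (overlap_pos z z₀)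
      exact Set.mem_iUnion.2 ⟨k, z, hk, rfl⟩)
    (fun i l => ⟨max i l, Set.image_mono (hmono (le_max_left _ _)),
      Set.image_mono (hmono (le_max_right _ _))⟩)
  have hsub : dirichlet Γ z₀ ⊆
      {z | ENNReal.ofReal ((1 / ((k : ℝ) + 1)) ^ (n + 1)) ≤
        ENNReal.ofReal (overlap z z₀ ^ (n + 1))} := by
    intro z hz
    obtain ⟨w, hw, hwz⟩ := hk (Set.mem_univ (π z))
    obtain ⟨g, hg⟩ := (Quotient.exact hwz : MulAction.orbitRel (autGroup Γ) (Ball n) w z)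
    have hg' : g • z = w := hg
    have h1 : overlap w z₀ ≤ overlap z z₀ := by
      rw [← hg', overlap_aut_smul_left]
      by_cases h1 : g = 1
      · simp [h1]
      · exact (mem_dirichlet_iff.1 hz g⁻¹ (by simpa using h1)).le
    have hw' : 1 / ((k : ℝ) + 1) < overlap w z₀ := hw
    refine ENNReal.ofReal_le_ofReal ?_
    gcongr
    linarith
  refine (measure_mono hsub).trans_lt ?_
  have hM := mul_meas_ge_le_lintegral (μ := invVol n)
    (f := fun z => ENNReal.ofReal (overlap z z₀ ^ (n + 1)))
    ((continuous_overlap_left z₀).pow _).measurable.ennreal_ofReal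
    (ENNReal.ofReal ((1 / ((k : ℝ) + 1)) ^ (n + 1)))
  rw [lintegral_overlap_pow] at hM
  have hfin : ENNReal.ofReal (bergmanConst n) * volume (Metric.ball (0 : E n) 1) < ⊤ :=
    ENNReal.mul_lt_top ENNReal.ofReal_lt_top measure_ball_lt_top
  refine lt_of_not_ge fun htop => ?_
  rw [top_le_iff.1 htop, ENNReal.mul_top] at hM
  · exact (hM.trans_lt hfin).ne rfl
  · simp only [ne_eq, ENNReal.ofReal_eq_zero, not_le]
    positivity

/-! ### Separation from the boundary -/

/-- Hyperbolic balls about the centre are Euclidean balls, hence convex, and the group acts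
transitively. -/
lemma isPreconnected_overlap_gt (a : ℝ) (p : Ball n) :
    IsPreconnected {w : Ball n | a < overlap w p} := by
  obtain ⟨A, rfl⟩ := exists_smul_origin p
  have h : {w : Ball n | a < overlap w (A • origin n)} =
      (fun w : Ball n => A • w) '' {w | a < overlap w (origin n)} := by
    ext w
    constructor
    · intro hw
      refine ⟨A⁻¹ • w, ?_, smul_inv_smul A w⟩
      rw [Set.mem_ofPred_eq, ← overlap_smul_smul A, smul_inv_smul]
      exact hw
    · rintro ⟨v, hv, rfl⟩
      rw [Set.mem_ofPred_eq, overlap_smul_smul]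
      exact hv
  rw [h]
  refine IsPreconnected.image ?_ _ (continuous_const_smul A).continuousOn
  rw [← Topology.IsInducing.subtypeVal.isPreconnected_image]
  have h2 : (Subtype.val '' {w : Ball n | a < overlap w (origin n)} : Set (E n)) =
      Metric.ball 0 1 ∩ {x | ‖x‖ ^ 2 < 1 - a} := by
    ext x
    constructor
    · rintro ⟨w, hw, rfl⟩
      rw [Set.mem_ofPred_eq, overlap_origin] at hw
      exact ⟨w.2, by rw [Set.mem_ofPred_eq]; linarith⟩
    · rintro ⟨hx, hx'⟩
      refine ⟨⟨x, hx⟩, ?_, rfl⟩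
      rw [Set.mem_ofPred_eq] at hx'
      rw [Set.mem_ofPred_eq, overlap_origin]
      simp only
      linarith
  rw [h2]
  refine Convex.isPreconnected (s := _) ((convex_ball (0 : E n) 1).inter ?_)
  have hc : ConvexOn ℝ Set.univ fun x : E n => ‖x‖ ^ 2 :=
    (convexOn_norm convex_univ).pow (fun _ _ => norm_nonneg _) 2
  simpa using hc.convex_lt (1 - a)

lemma _root_.IsPreconnected.inter_frontier_nonempty_of_inter {α : Type*} [TopologicalSpace α]
    {t u : Set α} (ht : IsPreconnected t) (h1 : (t ∩ u).Nonempty) (h2 : (t ∩ uᶜ).Nonempty) :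
    (t ∩ frontier u).Nonempty := by
  by_contra hne
  have hf : ∀ x ∈ t, x ∉ frontier u := fun x hx hxf => hne ⟨x, hx, hxf⟩
  have hu : ∀ x ∈ t, x ∈ u → x ∈ interior u := fun x hx hxu => by
    by_contra hi
    exact hf x hx ⟨subset_closure hxu, hi⟩
  have huc : ∀ x ∈ t, x ∉ u → x ∈ (closure u)ᶜ := fun x hx hxu hc =>
    hf x hx ⟨hc, fun hi => hxu (interior_subset hi)⟩
  obtain ⟨x, hx, hxu⟩ := h1
  obtain ⟨y, hy, hyu⟩ := h2
  obtain ⟨w, -, hw1, hw2⟩ := ht _ _ isOpen_interior isClosed_closure.isOpen_compl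
    (fun z hz => (em (z ∈ u)).imp (hu z hz) (huc z hz)) ⟨x, hx, hu x hx hxu⟩ ⟨y, hy, huc y hy hyu⟩
  exact hw2 (subset_closure (interior_subset hw1))

/-- A connected ball about `p ∈ X` that left the domain would meet its frontier. With `δ` below the
distance from `X` to the frontier, `a = cosh⁻²(δ/2)` excludes this for all `p` at once. -/
lemma exists_overlap_gt_mem_dirichlet {X : Set (Ball n)} {z₀ : Ball n}
    (hX : X ⊆ dirichlet Γ z₀) (hd : 0 < setDist X (frontier (dirichlet Γ z₀))) :
    ∃ a : ℝ, 0 < a ∧ a < 1 ∧ ∀ p ∈ X, ∀ w, a < overlap w p → w ∈ dirichlet Γ z₀ := by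
  obtain ⟨δ, hδ0, hδ⟩ := ENNReal.lt_iff_exists_real_btwn.1 hd
  have hδ1 : 0 < δ := by simpa using hδ.1
  have hcosh : 1 < Real.cosh (δ / 2) := Real.one_lt_cosh.2 (by positivity)
  refine ⟨(Real.cosh (δ / 2) ^ 2)⁻¹, by positivity, inv_lt_one_of_one_lt₀ (by nlinarith), ?_⟩
  intro p hp w hw
  by_contra hwF
  obtain ⟨v, hv, hvF⟩ :=
    (isPreconnected_overlap_gt (Real.cosh (δ / 2) ^ 2)⁻¹ p).inter_frontier_nonempty_of_inter
    (u := dirichlet Γ z₀) ⟨p, by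
      rw [Set.mem_ofPred_eq]
      have : overlap p p = 1 := by
        have := inv_overlap p p
        simpa using this
      rw [this]
      exact inv_lt_one_of_one_lt₀ (by nlinarith), hX hp⟩ ⟨w, hw, hwF⟩
  have h1 : setDist X (frontier (dirichlet Γ z₀)) ≤ ENNReal.ofReal (tau p v) :=
    (iInf₂_le p hp).trans (iInf₂_le v hvF)
  have h2 : δ < tau p v := by
    have := hδ.2.trans_le h1
    exact ((ENNReal.ofReal_lt_ofReal_iff_of_nonneg hδ0).1 this)
  rw [Set.mem_ofPred_eq, overlap_comm] at hv
  have ho := overlap_pos p v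
  have h3 : (Real.sqrt (overlap p v))⁻¹ < Real.cosh (δ / 2) := by
    rw [inv_lt_comm₀ (by positivity) (by positivity)]
    apply Real.lt_sqrt_of_sq_lt
    rwa [inv_pow]
  have h4 := (Real.arcosh_lt_arcosh (by positivity) (by positivity)).2 h3
  rw [Real.arcosh_cosh (by positivity)] at h4
  rw [tau_eq] at h2
  linarith

/-- The Poincaré series converges, uniformly. -/
lemma exists_tsum_overlap_le (hΓ : IsSmoothCocompact Γ) {z₀ : Ball n} {X : Set (Ball n)} {a : ℝ}
    (ha : 0 < a) (ha1 : a < 1) (hX : ∀ p ∈ X, ∀ w, a < overlap w p → w ∈ dirichlet Γ z₀) :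
    ∃ C : ℝ, 0 ≤ C ∧ ∀ p ∈ X, ∀ z, Summable (fun g : autGroup Γ => overlap (g • z) p ^ (n + 1)) ∧
      ∑' g : autGroup Γ, overlap (g • z) p ^ (n + 1) ≤ C := by
  have := countable_autGroup hΓ.discrete
  -- By invariance, the volume of the ball `{a < overlap w p}` about any `p`.
  set v := invVol n {w | a < overlap w (origin n)} with hv
  have hv0 : v ≠ 0 := by
    have hopen : IsOpen {w : Ball n | a < overlap w (origin n)} :=
      isOpen_lt continuous_const (continuous_overlap_left _)
    rw [hv, invVol, Ne, withDensity_apply_eq_zero measurable_bergmanDiag.ennreal_ofReal]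
    have hu : {w : Ball n | ENNReal.ofReal (bergmanDiag w) ≠ 0} = Set.univ :=
      Set.eq_univ_of_forall fun w => by simpa using bergmanDiag_pos w
    rw [hu, Set.univ_inter, (MeasurableEmbedding.subtype_coe measurableSet_ball).comap_apply]
    refine ((Metric.isOpen_ball.isOpenEmbedding_subtypeVal.isOpenMap _ hopen).measure_pos _
      ⟨_, origin n, ?_, rfl⟩).ne'
    rw [Set.mem_ofPred_eq, overlap_origin]
    simpa [origin] using ha1
  set T : ℝ≥0∞ := ENNReal.ofReal ((4 / a) ^ (n + 1)) *
    (ENNReal.ofReal (bergmanConst n) * volume (Metric.ball (0 : E n) 1)) with hT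
  have hTtop : T / v ≠ ⊤ := by
    refine ENNReal.div_ne_top (ENNReal.mul_ne_top ENNReal.ofReal_ne_top
      (ENNReal.mul_ne_top ENNReal.ofReal_ne_top measure_ball_lt_top.ne)) hv0
  have key : ∀ p ∈ X, ∀ z, ∑' g : autGroup Γ, ENNReal.ofReal (overlap (g • z) p ^ (n + 1)) ≤
      T / v := by
    intro p hp z
    have hvp : invVol n {w | a < overlap w p} = v := by
      obtain ⟨A, rfl⟩ := exists_smul_origin p
      rw [← (measurePreserving_smul_invVol A).measure_preimage (isOpen_lt continuous_const
        (continuous_overlap_left _)).measurableSet.nullMeasurableSet]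
      simp only [Set.preimage_ofPred_eq, overlap_smul_smul, hv]
    have hvt : v ≠ ⊤ := by
      rw [← hvp]
      exact ((measure_mono (hX p hp)).trans_lt (invVol_dirichlet_lt_top hΓ z₀)).ne
    rw [ENNReal.le_div_iff_mul_le (Or.inl hv0) (Or.inl hvt), ← ENNReal.tsum_mul_right]
    -- Average over the ball about `p`, which lies in the domain: for `w` in it, `overlap (g • z) p
    -- ≤ (4 / a) * overlap (g • z) w`. Summing over the group unfolds the domain to the whole ball,
    -- where the integral is independent of `z`.
    have h1 : ∀ g : autGroup Γ, ENNReal.ofReal (overlap (g • z) p ^ (n + 1)) * v ≤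
        ∫⁻ w in dirichlet Γ z₀, ENNReal.ofReal ((4 / a) ^ (n + 1)) *
          ENNReal.ofReal (overlap (g⁻¹ • w) z ^ (n + 1)) ∂(invVol n) := by
      intro g
      rw [← hvp, ← setLIntegral_const]
      refine (setLIntegral_mono' (isOpen_lt continuous_const
        (continuous_overlap_left _)).measurableSet fun w hw => ?_).trans
        (lintegral_mono_set (hX p hp))
      rw [Set.mem_ofPred_eq] at hw
      rw [← ENNReal.ofReal_mul (by positivity), ← mul_pow, overlap_aut_smul_left g⁻¹, inv_inv]
      refine ENNReal.ofReal_le_ofReal (pow_le_pow_left₀ (overlap_pos _ _).le ?_ _)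
      have h2 := overlap_mul_overlap_le (g • z) p w
      have h3 := overlap_pos (g • z) p
      rw [overlap_comm w, div_mul_eq_mul_div, le_div_iff₀ ha]
      nlinarith
    refine (ENNReal.tsum_le_tsum h1).trans ?_
    rw [← (isFundamentalDomain_dirichlet hΓ z₀).lintegral_eq_tsum' (fun w =>
      ENNReal.ofReal ((4 / a) ^ (n + 1)) * ENNReal.ofReal (overlap w z ^ (n + 1))),
      lintegral_const_mul' _ _ ENNReal.ofReal_ne_top, lintegral_overlap_pow]
  refine ⟨(T / v).toReal, ENNReal.toReal_nonneg, fun p hp z => ?_⟩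
  have hnn : ∀ g : autGroup Γ, 0 ≤ overlap (g • z) p ^ (n + 1) := fun g =>
    (pow_pos (overlap_pos _ _) _).le
  have hne := ne_top_of_le_ne_top hTtop (key p hp z)
  have hs : Summable (fun g : autGroup Γ => overlap (g • z) p ^ (n + 1)) := by
    have := ENNReal.summable_toReal hne
    simpa only [ENNReal.toReal_ofReal (hnn _)] using this
  refine ⟨hs, ?_⟩
  rw [← ENNReal.ofReal_le_iff_le_toReal hTtop, ENNReal.ofReal_tsum_of_nonneg hnn hs]
  exact key p hp z

end BallQuotient

end

/-! ### Unfolding the inner product of theta series. -/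

noncomputable section

namespace BallQuotient

variable {n : ℕ} {Γ : Subgroup (SU n)}

/-! ### Jacobians of group elements -/

lemma exists_den (g : autGroup Γ) : ∃ A : SU n, (∀ z : Ball n, g • z = A • z) ∧
    ∀ z, jac g.1 z = (den A z)⁻¹ ^ (n + 1) := by
  obtain ⟨A, -, h1, h2⟩ := exists_rep g
  exact ⟨A, h2, fun z => by rw [← h1, jac_toPerm]⟩

lemma jac_ne_zero (g : autGroup Γ) (z : Ball n) : jac g.1 z ≠ 0 := by
  obtain ⟨A, -, h⟩ := exists_den g
  rw [h]
  exact pow_ne_zero _ (inv_ne_zero (den_ne_zero A z))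

lemma jac_one (z : Ball n) : jac (1 : autGroup Γ).1 z = 1 := by
  have h : ((1 : autGroup Γ).1 : Equiv.Perm (Ball n)) =
    MulAction.toPermHom (SU n) (Ball n) 1 := by rw [map_one]; rfl
  rw [h, jac_toPerm]
  simp [den, mat, lift]

lemma den_mul (A B : SU n) (z : Ball n) :
    den (A * B) z = den B z * den A (B • z : Ball n) := by
  have key : (mat (A * B)) *ᵥ lift z.1 = den B z.1 • ((mat A) *ᵥ lift (frac B z.1)) := by
    rw [← Matrix.mulVec_smul, ← mulVec_lift, Matrix.mulVec_mulVec]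
    rfl
  exact congrFun key (Sum.inr ())

lemma jac_mul (g h : autGroup Γ) (z : Ball n) :
    jac (g * h).1 z = jac g.1 (h • z) * jac h.1 z := by
  obtain ⟨A, -, hA, -⟩ := exists_rep g
  obtain ⟨B, -, hB, hB'⟩ := exists_rep h
  have e : (g * h).1 = MulAction.toPermHom (SU n) (Ball n) (A * B) := by
    rw [map_mul, hA, hB]; rfl
  rw [e, ← hA, ← hB, jac_toPerm, jac_toPerm, jac_toPerm, den_mul, hB', ← mul_pow, mul_inv, mul_comm]

lemma bergman_aut_smul (g : autGroup Γ) (z w : Ball n) :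
    bergman (g • z) (g • w) * jac g.1 z * (starRingEnd ℂ) (jac g.1 w) = bergman z w := by
  obtain ⟨A, hA, hj⟩ := exists_den g
  have h1 := den_ne_zero A z
  have h2 : (starRingEnd ℂ) (den A w) ≠ 0 := by simpa using den_ne_zero A w
  rw [hA, hA, bergman_smul_smul, hj, hj, map_pow, map_inv₀, mul_pow, inv_pow,
    inv_pow]
  field_simp

lemma bergmanDiag_aut_smul (g : autGroup Γ) (z : Ball n) :
    bergmanDiag (g • z) * ‖jac g.1 z‖ ^ 2 = bergmanDiag z := by
  obtain ⟨A, hA, hj⟩ := exists_den g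
  have h1 := norm_pos_iff.2 (den_ne_zero A z)
  rw [hA, bergmanDiag_smul, hj, norm_pow, norm_inv, ← pow_mul, mul_comm (n + 1) 2, inv_pow]
  field_simp

lemma continuous_jac (g : autGroup Γ) : Continuous (jac g.1) := by
  obtain ⟨A, -, hj⟩ := exists_den g
  have : jac g.1 = fun z : Ball n => (den A z)⁻¹ ^ (n + 1) := funext hj
  rw [this]
  exact (((continuous_den A).comp continuous_subtype_val).inv₀ fun z => den_ne_zero A z).pow _

/-! ### Normalized terms of the Poincaré series -/

/-- The weight `K(z,z)^{-k/2}`. -/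
def weight (k : ℕ) (z : Ball n) : ℝ := bergmanDiag z ^ (-(k : ℝ) / 2)

lemma weight_pos (k : ℕ) (z : Ball n) : 0 < weight k z := Real.rpow_pos_of_pos (bergmanDiag_pos z) _

lemma weight_sq (k : ℕ) (z : Ball n) : weight k z ^ 2 = (bergmanDiag z ^ k)⁻¹ := by
  rw [weight, ← Real.rpow_natCast, ← Real.rpow_mul (bergmanDiag_pos z).le, ← Real.rpow_natCast,
    ← Real.rpow_neg (bergmanDiag_pos z).le]
  congr 1
  push_cast
  ring

lemma weight_aut_smul (k : ℕ) (g : autGroup Γ) (z : Ball n) :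
    weight k (g • z) = weight k z * ‖jac g.1 z‖ ^ k := by
  have h1 := weight_pos k z
  have h2 := weight_pos k (g • z)
  have hj := norm_pos_iff.2 (jac_ne_zero g z)
  have hb := bergmanDiag_pos (g • z)
  refine (sq_eq_sq₀ h2.le (by positivity)).1 ?_
  rw [mul_pow, weight_sq, weight_sq, ← bergmanDiag_aut_smul g z, mul_pow, ← pow_mul, ← pow_mul,
    mul_comm k 2]
  field_simp

lemma measurable_weight (k : ℕ) : Measurable (weight k : Ball n → ℝ) :=
  measurable_bergmanDiag.pow_const _

/-- The normalized term `J(γ,z)^k K(γz,p)^k K(z,z)^{-k/2} K(p,p)^{-k/2}`. -/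
def poincareTerm (k : ℕ) (g : autGroup Γ) (z p : Ball n) : ℂ :=
  ((weight k z * weight k p : ℝ) : ℂ) * (jac g.1 z * bergman (g • z) p) ^ k

/-- The weights absorb the Jacobian and the diagonal kernels by `bergmanDiag_aut_smul` and
`norm_bergman_sq`, leaving only invariant distance. -/
lemma norm_poincareTerm (k : ℕ) (g : autGroup Γ) (z p : Ball n) :
    ‖poincareTerm k g z p‖ = Real.sqrt (overlap (g • z) p) ^ ((n + 1) * k) := by
  have h1 := weight_pos k z
  have h2 := weight_pos k p
  have ho := overlap_pos (g • z) p
  have hb := bergmanDiag_pos p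
  have hb' := bergmanDiag_pos (g • z)
  have hj := norm_pos_iff.2 (jac_ne_zero g z)
  refine (sq_eq_sq₀ (norm_nonneg _) (by positivity)).1 ?_
  rw [← pow_mul, mul_comm _ 2, pow_mul, Real.sq_sqrt ho.le, poincareTerm, norm_mul,
    Complex.norm_real, Real.norm_of_nonneg (by positivity), norm_pow, norm_mul, mul_pow, mul_pow,
    weight_sq, weight_sq, ← bergmanDiag_aut_smul g z, ← pow_mul, mul_comm k 2, pow_mul,
    mul_pow ‖jac g.1 z‖ ‖bergman (g • z) p‖ 2, norm_bergman_sq, pow_mul, mul_pow]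
  simp only [mul_pow]
  field_simp

/-- For `k ≥ 2` the exponent `(n+1)k/2` is at least `n+1`, the exponent whose series is controlled
by `PoincareBound`. -/
lemma norm_poincareTerm_le {k : ℕ} (hk : 2 ≤ k) (g : autGroup Γ) (z p : Ball n) :
    ‖poincareTerm k g z p‖ ≤ overlap (g • z) p ^ (n + 1) := by
  have ho := overlap_pos (g • z) p
  rw [norm_poincareTerm]
  calc _ ≤ Real.sqrt (overlap (g • z) p) ^ ((n + 1) * 2) := by
        apply pow_le_pow_of_le_one (by positivity) (Real.sqrt_le_one.2 (overlap_le_one _ _))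
        gcongr
    _ = _ := by rw [mul_comm, pow_mul, Real.sq_sqrt ho.le]

lemma measurable_poincareTerm (k : ℕ) (g : autGroup Γ) {α : Type*} [MeasurableSpace α]
    {a b : α → Ball n} (ha : Measurable a) (hb : Measurable b) :
    Measurable fun x => poincareTerm k g (a x) (b x) := by
  have h0 : Measurable fun x => g • a x := ha.const_smul g
  have h1 : Measurable fun x => bergman (g • a x) (b x) := by
    simp only [bergman_eq]
    fun_prop
  have h2 : Measurable fun x => jac g.1 (a x) := (continuous_jac g).measurable.comp ha
  have h3 : Measurable fun x => weight k (a x) := (measurable_weight k).comp ha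
  have h4 : Measurable fun x => weight k (b x) := (measurable_weight k).comp hb
  exact (Complex.measurable_ofReal.comp (h3.mul h4)).mul ((h2.mul h1).pow_const k)

/-- The cocycle rule divides by `J(g,z)` and the weight multiplies by `‖J(g,z)‖`. Only a phase
independent of `h` survives, and it cancels in Hermitian products. -/
lemma poincareTerm_smul (k : ℕ) (g h : autGroup Γ) (z p : Ball n) :
    poincareTerm k h (g • z) p =
      ((‖jac g.1 z‖ : ℂ) / jac g.1 z) ^ k * poincareTerm k (h * g) z p := by
  have hj := jac_ne_zero g z
  rw [poincareTerm, poincareTerm, weight_aut_smul, jac_mul, mul_smul]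
  push_cast
  simp only [div_pow, mul_pow]
  field_simp

lemma conj_unit_mul (k : ℕ) (g : autGroup Γ) (z : Ball n) :
    (starRingEnd ℂ) (((‖jac g.1 z‖ : ℂ) / jac g.1 z) ^ k) *
      ((‖jac g.1 z‖ : ℂ) / jac g.1 z) ^ k = 1 := by
  have hj := norm_pos_iff.2 (jac_ne_zero g z)
  rw [Complex.conj_mul', norm_pow, norm_div, Complex.norm_real, norm_norm, div_self hj.ne']
  simp

/-- The real number `c(𝔹ⁿ, k)`. -/
def kernelReal (n k : ℕ) : ℝ :=
  (bergmanConst n ^ k * ∫ w : Ball n, (bergmanDiag w ^ k)⁻¹ ∂(invVol n))⁻¹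

lemma kernelReal_pos {k : ℕ} (hk : 1 ≤ k) : 0 < kernelReal n k :=
  inv_pos.2 (mul_pos (pow_pos (bergmanConst_pos n) k) (integral_inv_bergmanDiag_pow_pos hk))

lemma integral_poincareTerm {k : ℕ} (hk : 1 ≤ k) (g : autGroup Γ) (q p : Ball n) :
    (kernelReal n k : ℂ) * ∫ z, poincareTerm k g z p *
      (starRingEnd ℂ) (poincareTerm k (1 : autGroup Γ) z q) ∂(invVol n) =
      poincareTerm k g q p := by
  -- In terms of `p' = g⁻¹ p`, the factor `J(g,z) K(gz,p)` is `K(z,p')` up to a constant in `z`, so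
  -- every term reduces to the reproducing property.
  obtain ⟨p, rfl⟩ : ∃ p', p = g • p' := ⟨g⁻¹ • p, by simp⟩
  have hjp : (starRingEnd ℂ) (jac g.1 p) ≠ 0 := by simpa using jac_ne_zero g p
  have hB : ∀ z, jac g.1 z * bergman (g • z) (g • p) =
      bergman z p / (starRingEnd ℂ) (jac g.1 p) := fun z => by
    rw [← bergman_aut_smul g z p]
    field_simp
  have e : ∀ z, poincareTerm k g z (g • p) *
      (starRingEnd ℂ) (poincareTerm k (1 : autGroup Γ) z q) =
      ((weight k (g • p) * weight k q : ℝ) : ℂ) * ((starRingEnd ℂ) (jac g.1 p) ^ k)⁻¹ *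
        (bergman q z ^ k * bergman z p ^ k / bergman z z ^ k) := fun z => by
    have hw : ((weight k z : ℝ) : ℂ) ^ 2 = (bergman z z ^ k)⁻¹ := by
      rw [bergman_self_eq]; exact_mod_cast weight_sq k z
    rw [poincareTerm, poincareTerm, hB, jac_one, one_smul, one_mul, map_mul, map_pow, bergman_conj,
      Complex.conj_ofReal, div_eq_mul_inv (bergman q z ^ k * _), ← hw]
    push_cast
    rw [div_pow]
    ring
  simp only [e]
  rw [integral_const_mul, mul_left_comm, kernelReal, ← kernelConst_eq, reproducing hk,
    poincareTerm, hB, div_pow]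
  push_cast
  ring

/-! ### The normalized theta series -/

variable {m : ℕ} (ρ : autGroup Γ →* Matrix.unitaryGroup (Fin m) ℂ) (j : Fin m)

/-- The components of `K(z,z)^{-k/2} K(p,p)^{-k/2} Θ_p(z)`. -/
def normTheta (k : ℕ) (i : Fin m) (z p : Ball n) : ℂ :=
  (kernelReal n k : ℂ) * ∑' g : autGroup Γ,
    (ρ g⁻¹ : Matrix (Fin m) (Fin m) ℂ) i j * poincareTerm k g z p

lemma norm_rho_le (g : autGroup Γ) (i l : Fin m) :
    ‖(ρ g : Matrix (Fin m) (Fin m) ℂ) i l‖ ≤ 1 :=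
  entry_norm_bound_of_unitary (ρ g).2 i l

lemma norm_rho_mul_le {k : ℕ} (hk : 2 ≤ k) (g h : autGroup Γ) (i l : Fin m) (z p : Ball n) :
    ‖(ρ h : Matrix (Fin m) (Fin m) ℂ) i l * poincareTerm k g z p‖ ≤
      overlap (g • z) p ^ (n + 1) := by
  rw [norm_mul]
  exact (mul_le_of_le_one_left (norm_nonneg _) (norm_rho_le ρ _ _ _)).trans
    (norm_poincareTerm_le hk g z p)

/-- The Poincaré series `∑ cosh^{-2(n+1)} (τ(γz,p)/2)` is bounded by `C` for `p ∈ X`. -/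
def PoincareBound (Γ : Subgroup (SU n)) (X : Set (Ball n)) (C : ℝ) : Prop :=
  ∀ p ∈ X, ∀ z, Summable (fun g : autGroup Γ => overlap (g • z) p ^ (n + 1)) ∧
    ∑' g : autGroup Γ, overlap (g • z) p ^ (n + 1) ≤ C

variable {X : Set (Ball n)} {C : ℝ}

lemma summable_rho_mul (hC : PoincareBound Γ X C) {k : ℕ} (hk : 2 ≤ k) (i : Fin m) (z : Ball n)
    {p : Ball n} (hp : p ∈ X) :
    Summable fun g : autGroup Γ =>
      (ρ g⁻¹ : Matrix (Fin m) (Fin m) ℂ) i j * poincareTerm k g z p :=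
  (hC p hp z).1.of_norm_bounded fun g => norm_rho_mul_le ρ hk g g⁻¹ i j z p

lemma norm_normTheta_le (hC : PoincareBound Γ X C) {k : ℕ} (hk : 2 ≤ k) (i : Fin m) (z : Ball n)
    {p : Ball n} (hp : p ∈ X) :
    ‖normTheta ρ j k i z p‖ ≤ kernelReal n k * C := by
  have hc := kernelReal_pos (n := n) (by omega : 1 ≤ k)
  rw [normTheta, norm_mul, Complex.norm_real, Real.norm_of_nonneg hc.le]
  gcongr
  exact (tsum_of_norm_bounded (hC p hp z).1.hasSum
    fun g => norm_rho_mul_le ρ hk g g⁻¹ i j z p).trans (hC p hp z).2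

lemma weight_mul_thetaPoint (hC : PoincareBound Γ X C) {k : ℕ} (hk : 2 ≤ k) (i : Fin m) (z : Ball n)
    {p : Ball n}
    (hp : p ∈ X) :
    ((weight k z * weight k p : ℝ) : ℂ) * thetaPoint Γ ρ j k z p i = normTheta ρ j k i z p := by
  have hw : ((weight k z * weight k p : ℝ) : ℂ) ≠ 0 := by
    exact_mod_cast (mul_pos (weight_pos k z) (weight_pos k p)).ne'
  have hcomp : ∀ (g : autGroup Γ) (i : Fin m), (jac g.1 z ^ k •
      ((ρ g⁻¹ : Matrix (Fin m) (Fin m) ℂ) *ᵥ Pi.single j (bergman (g.1 z) p ^ k))) i =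
      ((weight k z * weight k p : ℝ) : ℂ)⁻¹ *
        ((ρ g⁻¹ : Matrix (Fin m) (Fin m) ℂ) i j * poincareTerm k g z p) := by
    intro g i
    rw [poincareTerm, mul_left_comm _ ((weight k z * weight k p : ℝ) : ℂ), inv_mul_cancel_left₀ hw,
      Pi.smul_apply, Matrix.mulVec_single, Pi.smul_apply, Matrix.col_apply,
      MulOpposite.smul_eq_mul_unop,
      MulOpposite.unop_op, smul_eq_mul, mul_pow]
    change _ * (_ * bergman (g.1 z) p ^ k) = _ * (_ * bergman (g.1 z) p ^ k)
    ring
  have hs : Summable fun g : autGroup Γ => jac g.1 z ^ k •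
      ((ρ g⁻¹ : Matrix (Fin m) (Fin m) ℂ) *ᵥ Pi.single j (bergman (g.1 z) p ^ k)) := by
    rw [Pi.summable]
    intro i
    simp only [hcomp]
    exact (summable_rho_mul ρ j hC hk i z hp).mul_left _
  rw [thetaPoint, Pi.smul_apply, tsum_apply hs]
  simp only [hcomp]
  rw [tsum_mul_left, normTheta, smul_eq_mul, kernelConst_eq, ← kernelReal]
  field_simp

lemma aestronglyMeasurable_normTheta (hC : PoincareBound Γ X C) [Countable (autGroup Γ)] {k : ℕ}
    (hk : 2 ≤ k) (i : Fin m)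
    {α : Type*} [MeasurableSpace α] {μ : Measure α} {a b : α → Ball n} (ha : Measurable a)
    (hb : Measurable b) (hX : ∀ᵐ x ∂μ, b x ∈ X) :
    AEStronglyMeasurable (fun x => normTheta ρ j k i (a x) (b x)) μ := by
  unfold normTheta
  refine AEStronglyMeasurable.const_mul ?_ _
  refine aestronglyMeasurable_of_tendsto_ae (atTop : Filter (Finset (autGroup Γ)))
    (f := fun s x => ∑ g ∈ s, (ρ g⁻¹ : Matrix (Fin m) (Fin m) ℂ) i j *
      poincareTerm k g (a x) (b x)) (fun s => ?_) ?_
  · refine (Finset.measurable_fun_sum _ fun g _ => ?_).aestronglyMeasurable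
    exact (measurable_poincareTerm k g ha hb).const_mul _
  · filter_upwards [hX] with x hx
    exact (summable_rho_mul ρ j hC hk i (a x) hx).hasSum

/-- Automorphy, by reindexing the series with `h ↦ h g` and writing `h⁻¹ = g (h g)⁻¹`. -/
lemma normTheta_smul (hC : PoincareBound Γ X C) {k : ℕ} (hk : 2 ≤ k) (g : autGroup Γ) (i : Fin m)
    (z : Ball n) {p : Ball n}
    (hp : p ∈ X) :
    normTheta ρ j k i (g • z) p = ((‖jac g.1 z‖ : ℂ) / jac g.1 z) ^ k *
      ∑ l, (ρ g : Matrix (Fin m) (Fin m) ℂ) i l * normTheta ρ j k l z p := by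
  have hs := fun l => summable_rho_mul ρ j hC hk l z hp
  have h1 : ∑ l, (ρ g : Matrix (Fin m) (Fin m) ℂ) i l * normTheta ρ j k l z p =
      (kernelReal n k : ℂ) * ∑' h : autGroup Γ,
        (ρ (g * h⁻¹) : Matrix (Fin m) (Fin m) ℂ) i j * poincareTerm k h z p := by
    have h2 : ∀ l, (ρ g : Matrix (Fin m) (Fin m) ℂ) i l * normTheta ρ j k l z p =
        (kernelReal n k : ℂ) * ∑' h : autGroup Γ, (ρ g : Matrix (Fin m) (Fin m) ℂ) i l *
          ((ρ h⁻¹ : Matrix (Fin m) (Fin m) ℂ) l j * poincareTerm k h z p) := fun l => by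
      rw [normTheta, tsum_mul_left, mul_left_comm]
    simp only [h2]
    rw [← Finset.mul_sum, ← Summable.tsum_finsetSum fun l _ => (hs l).mul_left _]
    congr 1
    refine tsum_congr fun h => ?_
    rw [map_mul, Matrix.UnitaryGroup.mul_val, Matrix.mul_apply, Finset.sum_mul]
    exact Finset.sum_congr rfl fun l _ => by ring
  rw [h1, normTheta, mul_left_comm]
  congr 1
  rw [← tsum_mul_left, ← (Equiv.mulRight g).tsum_eq (fun h : autGroup Γ =>
    ((‖jac g.1 z‖ : ℂ) / jac g.1 z) ^ k *
      ((ρ (g * h⁻¹) : Matrix (Fin m) (Fin m) ℂ) i j * poincareTerm k h z p))]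
  refine tsum_congr fun h => ?_
  rw [poincareTerm_smul, Equiv.coe_mulRight, mul_inv_rev, mul_inv_cancel_left]
  ring

/-- Expand only the second factor. Unitarity turns the conjugate of `ρ(g⁻¹)ᵢⱼ` into `ρ(g)ⱼᵢ`, and
the sum over `i` then assembles the `j`-th component of the first factor at `g • z`, up to a phase
that cancels. -/
lemma sum_normTheta_mul_conj (hC : PoincareBound Γ X C) {k : ℕ} (hk : 2 ≤ k) (z : Ball n)
    {p q : Ball n} (hp : p ∈ X)
    (hq : q ∈ X) :
    ∑ i, normTheta ρ j k i z p * (starRingEnd ℂ) (normTheta ρ j k i z q) =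
      ∑' g : autGroup Γ, (kernelReal n k : ℂ) * normTheta ρ j k j (g • z) p *
        (starRingEnd ℂ) (poincareTerm k (1 : autGroup Γ) (g • z) q) := by
  have hs := fun l => summable_rho_mul ρ j hC hk l z hq
  have hconj : ∀ i, (starRingEnd ℂ) (normTheta ρ j k i z q) = (kernelReal n k : ℂ) *
      ∑' g : autGroup Γ, (ρ g : Matrix (Fin m) (Fin m) ℂ) j i *
        (starRingEnd ℂ) (poincareTerm k g z q) := by
    intro i
    rw [normTheta, map_mul, Complex.conj_ofReal, Complex.conj_tsum]
    congr 1
    refine tsum_congr fun g => ?_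
    rw [map_mul, map_inv, Matrix.UnitaryGroup.inv_val, Matrix.star_apply]
    simp
  have hs' : ∀ i, Summable fun g : autGroup Γ => (ρ g : Matrix (Fin m) (Fin m) ℂ) j i *
        (starRingEnd ℂ) (poincareTerm k g z q) := fun i =>
    (hC q hq z).1.of_norm_bounded fun g => by
      have := norm_rho_mul_le ρ hk g g j i z q
      rwa [norm_mul, RCLike.norm_conj, ← norm_mul]
  simp only [hconj, ← tsum_mul_left]
  rw [← Summable.tsum_finsetSum fun i _ => ((hs' i).mul_left _).mul_left _]
  refine tsum_congr fun g => ?_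
  rw [normTheta_smul ρ j hC hk g j z hp, poincareTerm_smul, one_mul, map_mul, Finset.mul_sum,
    Finset.mul_sum, Finset.sum_mul]
  refine Finset.sum_congr rfl fun i _ => ?_
  linear_combination (-(kernelReal n k : ℂ) * normTheta ρ j k i z p *
    (ρ g : Matrix (Fin m) (Fin m) ℂ) j i * (starRingEnd ℂ) (poincareTerm k g z q)) *
    conj_unit_mul k g z

/-- Integrate the series term by term with `integral_poincareTerm`. Absolute convergence holds
because the sum over the group is bounded by `C` and `overlap z q ^ (n+1)` is integrable. -/
lemma integral_normTheta_mul_conj (hC : PoincareBound Γ X C) [Countable (autGroup Γ)] {k : ℕ}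
    (hk : 2 ≤ k) {p : Ball n}
    (q : Ball n) (hp : p ∈ X) :
    Integrable (fun z => (kernelReal n k : ℂ) * normTheta ρ j k j z p *
        (starRingEnd ℂ) (poincareTerm k (1 : autGroup Γ) z q)) (invVol n) ∧
    ∫ z, (kernelReal n k : ℂ) * normTheta ρ j k j z p *
        (starRingEnd ℂ) (poincareTerm k (1 : autGroup Γ) z q) ∂(invVol n) =
      normTheta ρ j k j q p := by
  have hc := kernelReal_pos (n := n) (by omega : 1 ≤ k)
  have hmeas1 : Measurable fun z => poincareTerm k (1 : autGroup Γ) z q :=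
    measurable_poincareTerm k (1 : autGroup Γ) measurable_id measurable_const
  have hmeasc : Measurable fun z => (starRingEnd ℂ) (poincareTerm k (1 : autGroup Γ) z q) :=
    Complex.continuous_conj.measurable.comp hmeas1
  have hle1 : ∀ z, ‖poincareTerm k (1 : autGroup Γ) z q‖ ≤ overlap z q ^ (n + 1) := fun z => by
    simpa using norm_poincareTerm_le hk (1 : autGroup Γ) z q
  constructor
  · refine ((integrable_overlap_pow q).const_mul (kernelReal n k * (kernelReal n k * C))).mono'
      ?_ (ae_of_all _ fun z => ?_)
    · refine AEStronglyMeasurable.mul (AEStronglyMeasurable.const_mul ?_ _)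
        hmeasc.aestronglyMeasurable
      exact aestronglyMeasurable_normTheta ρ j hC hk j measurable_id measurable_const
        (ae_of_all _ fun _ => hp)
    · rw [norm_mul, norm_mul, RCLike.norm_conj, Complex.norm_real, Real.norm_of_nonneg hc.le]
      have h1 := norm_normTheta_le ρ j hC hk j z hp
      have h2 := hle1 z
      have h3 := (norm_nonneg _).trans h1
      gcongr
  · have e : ∀ z, (kernelReal n k : ℂ) * normTheta ρ j k j z p *
        (starRingEnd ℂ) (poincareTerm k (1 : autGroup Γ) z q) = (kernelReal n k : ℂ) *
        ∑' g : autGroup Γ, (kernelReal n k : ℂ) * ((ρ g⁻¹ : Matrix (Fin m) (Fin m) ℂ) j j *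
          (poincareTerm k g z p * (starRingEnd ℂ) (poincareTerm k (1 : autGroup Γ) z q))) := by
      intro z
      rw [normTheta, mul_assoc, mul_assoc, ← tsum_mul_right, ← tsum_mul_left]
      congr 1
      exact tsum_congr fun g => by ring
    simp only [e]
    rw [integral_const_mul, integral_tsum]
    · simp only [integral_const_mul]
      rw [normTheta]
      congr 1
      refine tsum_congr fun g => ?_
      rw [mul_left_comm, integral_poincareTerm (by omega)]
    · intro g
      refine Measurable.aestronglyMeasurable ?_
      have : Measurable fun z => poincareTerm k g z p :=
        measurable_poincareTerm k g measurable_id measurable_const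
      exact ((this.mul hmeasc).const_mul _).const_mul _
    · have hb : ∀ (g : autGroup Γ) (z : Ball n), ‖(kernelReal n k : ℂ) *
          ((ρ g⁻¹ : Matrix (Fin m) (Fin m) ℂ) j j *
          (poincareTerm k g z p * (starRingEnd ℂ) (poincareTerm k (1 : autGroup Γ) z q)))‖ₑ ≤
          ENNReal.ofReal (overlap (g • z) p ^ (n + 1)) *
            ENNReal.ofReal (kernelReal n k * overlap z q ^ (n + 1)) := by
        intro g z
        have ho := overlap_pos (g • z) p
        rw [← ENNReal.ofReal_mul (by positivity), ← ofReal_norm]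
        refine ENNReal.ofReal_le_ofReal ?_
        rw [← mul_assoc ((ρ g⁻¹ : Matrix (Fin m) (Fin m) ℂ) j j), norm_mul, norm_mul,
          RCLike.norm_conj, Complex.norm_real, Real.norm_of_nonneg hc.le]
        have h1 := norm_rho_mul_le ρ hk g g⁻¹ j j z p
        calc _ ≤ kernelReal n k * (overlap (g • z) p ^ (n + 1) * overlap z q ^ (n + 1)) := by
              gcongr
              exact hle1 z
          _ = _ := by ring
      refine ne_top_of_le_ne_top ?_ (ENNReal.tsum_le_tsum fun g => lintegral_mono (hb g))
      rw [← lintegral_tsum]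
      · have hb2 : ∀ z, ∑' g : autGroup Γ, ENNReal.ofReal (overlap (g • z) p ^ (n + 1)) *
            ENNReal.ofReal (kernelReal n k * overlap z q ^ (n + 1)) ≤
            ENNReal.ofReal (C * kernelReal n k) * ENNReal.ofReal (overlap z q ^ (n + 1)) := by
          intro z
          have hC0 : 0 ≤ C := (tsum_nonneg fun g => (pow_pos (overlap_pos _ _) _).le).trans
            (hC p hp z).2
          rw [ENNReal.tsum_mul_right, ← ENNReal.ofReal_tsum_of_nonneg
            (fun g => (pow_pos (overlap_pos _ _) _).le) (hC p hp z).1,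
            ENNReal.ofReal_mul hc.le, ENNReal.ofReal_mul hC0, mul_assoc]
          gcongr
          exact (hC p hp z).2
        refine ne_top_of_le_ne_top ?_ (lintegral_mono hb2)
        rw [lintegral_const_mul' _ _ ENNReal.ofReal_ne_top, lintegral_overlap_pow]
        exact ENNReal.mul_ne_top ENNReal.ofReal_ne_top
          (ENNReal.mul_ne_top ENNReal.ofReal_ne_top measure_ball_lt_top.ne)
      · intro g
        have h1 : Measurable fun z : Ball n => overlap (g • z) p :=
          (continuous_overlap_left p).measurable.comp (measurable_const_smul g)
        have h2 := (continuous_overlap_left q).measurable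
        exact ((h1.pow_const _).ennreal_ofReal.mul
          ((h2.pow_const _).const_mul _).ennreal_ofReal).aemeasurable

/-- Unfolding. -/
lemma setIntegral_normTheta (hC : PoincareBound Γ X C) (hΓ : IsSmoothCocompact Γ) (z₀ : Ball n)
    {k : ℕ} (hk : 2 ≤ k)
    {p q : Ball n} (hp : p ∈ X) (hq : q ∈ X) :
    ∫ z in dirichlet Γ z₀, ∑ i, normTheta ρ j k i z p *
      (starRingEnd ℂ) (normTheta ρ j k i z q) ∂(invVol n) = normTheta ρ j k j q p := by
  have := countable_autGroup hΓ.discrete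
  obtain ⟨hInt, hval⟩ := integral_normTheta_mul_conj ρ j hC hk q hp
  have hF := isFundamentalDomain_dirichlet hΓ z₀
  -- The integral over the ball is the sum of the integrals of the translates over the domain, and
  -- `sum_normTheta_mul_conj` identifies the sum of those translates.
  rw [← hval, hF.integral_eq_tsum'' _ hInt]
  simp only [sum_normTheta_mul_conj ρ j hC hk _ hp hq]
  rw [integral_tsum]
  · intro g
    have hmp := measurePreserving_smul g (invVol n)
    exact (hInt.1.comp_measurePreserving hmp).restrict
  · have := hF.lintegral_eq_tsum'' (fun z => ‖(kernelReal n k : ℂ) * normTheta ρ j k j z p *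
        (starRingEnd ℂ) (poincareTerm k (1 : autGroup Γ) z q)‖ₑ)
    rw [← this]
    exact hInt.2.ne

/-- Fubini: the normalized series is bounded by `c(k) C` for parameters in `X`, and the domain, `νX`
and `νY` all have finite measure. -/
lemma innerProd_theta (hC : PoincareBound Γ X C) (hΓ : IsSmoothCocompact Γ) (z₀ : Ball n) {k : ℕ}
    (hk : 2 ≤ k)
    {νX νY : Measure (Ball n)} [IsFiniteMeasure νX] [IsFiniteMeasure νY]
    (hX : ∀ᵐ p ∂νX, p ∈ X) (hY : ∀ᵐ q ∂νY, q ∈ X) :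
    innerProd (dirichlet Γ z₀) k (theta Γ ρ νX j k) (theta Γ ρ νY j k) =
      ∫ x, normTheta ρ j k j x.2 x.1 ∂(νX.prod νY) := by
  have := countable_autGroup hΓ.discrete
  have hfinF : IsFiniteMeasure ((invVol n).restrict (dirichlet Γ z₀)) :=
    ⟨by rw [Measure.restrict_apply_univ]; exact invVol_dirichlet_lt_top hΓ z₀⟩
  have hInt : ∀ (ν : Measure (Ball n)) [IsFiniteMeasure ν], (∀ᵐ p ∂ν, p ∈ X) → ∀ i z,
      Integrable (fun p => normTheta ρ j k i z p) ν := by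
    intro ν _ hν i z
    refine Integrable.of_bound (aestronglyMeasurable_normTheta ρ j hC hk i measurable_const
      measurable_id hν) (kernelReal n k * C) ?_
    filter_upwards [hν] with p hp
    exact norm_normTheta_le ρ j hC hk i z hp
  have htheta : ∀ (ν : Measure (Ball n)) [IsFiniteMeasure ν], (∀ᵐ p ∂ν, p ∈ X) → ∀ i z,
      (weight k z : ℂ) * theta Γ ρ ν j k z i = ∫ p, normTheta ρ j k i z p ∂ν := by
    intro ν _ hν i z
    have hwz : (weight k z : ℂ) ≠ 0 := by exact_mod_cast (weight_pos k z).ne'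
    have hcomp : ∀ i, (fun p => (bergmanDiag p ^ (-(k : ℝ) / 2) • thetaPoint Γ ρ j k z p) i) =ᵐ[ν]
        fun p => (weight k z : ℂ)⁻¹ * normTheta ρ j k i z p := by
      intro i
      filter_upwards [hν] with p hp
      rw [← weight_mul_thetaPoint ρ j hC hk i z hp, Pi.smul_apply, ← weight]
      push_cast
      rw [mul_assoc, inv_mul_cancel_left₀ hwz, Complex.real_smul]
    rw [theta, eval_integral fun i =>
      (((hInt ν hν i z).const_mul (weight k z : ℂ)⁻¹).congr (hcomp i).symm),
      integral_congr_ae (hcomp i), integral_const_mul, mul_inv_cancel_left₀ hwz]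
  have h1 : ∀ z, (theta Γ ρ νX j k z ⬝ᵥ star (theta Γ ρ νY j k z)) *
      ((bergmanDiag z ^ k)⁻¹ : ℝ) = ∫ x, ∑ i, normTheta ρ j k i z x.1 *
        (starRingEnd ℂ) (normTheta ρ j k i z x.2) ∂(νX.prod νY) := by
    intro z
    rw [integral_finsetSum]
    · rw [dotProduct, Finset.sum_mul]
      refine Finset.sum_congr rfl fun i _ => ?_
      rw [integral_prod_mul (fun p => normTheta ρ j k i z p)
        (fun q => (starRingEnd ℂ) (normTheta ρ j k i z q)), integral_conj, ← htheta νX hX,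
        ← htheta νY hY, ← weight_sq, map_mul, Complex.conj_ofReal, Pi.star_apply]
      push_cast
      simp only [RCLike.star_def]
      ring
    · intro i _
      exact (hInt νX hX i z).mul_prod
        (Complex.conjCLE.toContinuousLinearMap.integrable_comp (hInt νY hY i z))
  rw [innerProd]
  simp only [h1]
  have hX' : ∀ᵐ x ∂(νX.prod νY), x.1 ∈ X := Measure.quasiMeasurePreserving_fst.ae hX
  have hY' : ∀ᵐ x ∂(νX.prod νY), x.2 ∈ X := Measure.quasiMeasurePreserving_snd.ae hY
  rw [integral_integral_swap]
  · refine integral_congr_ae ?_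
    filter_upwards [hX', hY'] with x hx1 hx2
    exact setIntegral_normTheta ρ j hC hΓ z₀ hk hx1 hx2
  · have hX'' : ∀ᵐ y ∂(((invVol n).restrict (dirichlet Γ z₀)).prod (νX.prod νY)), y.2.1 ∈ X :=
      Measure.quasiMeasurePreserving_snd.ae hX'
    have hY'' : ∀ᵐ y ∂(((invVol n).restrict (dirichlet Γ z₀)).prod (νX.prod νY)), y.2.2 ∈ X :=
      Measure.quasiMeasurePreserving_snd.ae hY'
    refine integrable_finsetSum _ fun i _ => ?_
    refine Integrable.of_bound (C := (kernelReal n k * C) * (kernelReal n k * C)) ?_ ?_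
    · exact (aestronglyMeasurable_normTheta ρ j hC hk i measurable_fst
        measurable_snd.fst hX'').mul
        (Complex.continuous_conj.comp_aestronglyMeasurable
          (aestronglyMeasurable_normTheta ρ j hC hk i measurable_fst measurable_snd.snd hY''))
    · filter_upwards [hX'', hY''] with y hy1 hy2
      have h2 := norm_normTheta_le ρ j hC hk i y.1 hy1
      have h3 := norm_normTheta_le ρ j hC hk i y.1 hy2
      have h4 := (norm_nonneg _).trans h2
      rw [norm_mul, RCLike.norm_conj]
      gcongr

/-- The terms of the Poincaré series other than that of the identity are negligible. -/
lemma norm_normTheta_sub_le (hC : PoincareBound Γ X C) {a : ℝ} (ha : 0 < a) {k : ℕ} (hk : 2 ≤ k)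
    {p q : Ball n} (hp : p ∈ X)
    (hq : ∀ g : autGroup Γ, g ≠ 1 → overlap (g • q) p ≤ a) :
    ‖normTheta ρ j k j q p - (kernelReal n k : ℂ) * poincareTerm k (1 : autGroup Γ) q p‖ ≤
      kernelReal n k * (Real.sqrt a ^ (k - 2) * C) := by
  classical
  have hc := kernelReal_pos (n := n) (by omega : 1 ≤ k)
  have hs := summable_rho_mul ρ j hC hk j q hp
  have hle : ∀ g : autGroup Γ, ‖(if g = 1 then 0 else
      (ρ g⁻¹ : Matrix (Fin m) (Fin m) ℂ) j j * poincareTerm k g q p)‖ ≤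
      Real.sqrt a ^ (k - 2) * overlap (g • q) p ^ (n + 1) := by
    intro g
    have ho := overlap_pos (g • q) p
    split_ifs with hg
    · rw [norm_zero]
      positivity
    · rw [norm_mul]
      refine (mul_le_of_le_one_left (norm_nonneg _) (norm_rho_le ρ _ _ _)).trans ?_
      -- The part `k - 2` provides the decay `√a ^ (k-2)`, the part `2(n+1)` keeps the convergent
      -- series, and `n(k-2)` is discarded.
      have hk2 : (n + 1) * k = (k - 2) + n * (k - 2) + 2 * (n + 1) := by
        obtain ⟨l, rfl⟩ := Nat.exists_eq_add_of_le hk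
        rw [Nat.add_sub_cancel_left]
        ring
      have h1 : Real.sqrt (overlap (g • q) p) ≤ 1 := Real.sqrt_le_one.2 (overlap_le_one _ _)
      rw [norm_poincareTerm, hk2, pow_add, pow_add, pow_mul _ 2, Real.sq_sqrt ho.le]
      gcongr
      calc _ ≤ Real.sqrt (overlap (g • q) p) ^ (k - 2) * 1 := by
            gcongr
            exact pow_le_one₀ (Real.sqrt_nonneg _) h1
        _ ≤ _ := by
            rw [mul_one]
            gcongr
            exact hq g hg
  rw [normTheta, ← mul_sub, norm_mul, Complex.norm_real, Real.norm_of_nonneg hc.le]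
  gcongr
  have h1 : (ρ (1 : autGroup Γ)⁻¹ : Matrix (Fin m) (Fin m) ℂ) j j = 1 := by simp
  rw [hs.tsum_eq_add_tsum_ite 1, h1, one_mul, add_sub_cancel_left]
  refine (tsum_of_norm_bounded ((hC p hp q).1.mul_left _).hasSum hle).trans ?_
  rw [tsum_mul_left]
  gcongr
  exact (hC p hp q).2

end BallQuotient

end

/-! ### Laplace's method and the growth of the kernel constant. -/

noncomputable section

namespace BallQuotient

variable {n : ℕ}

/-! ### Laplace's method -/

section Laplace

variable {V : Type*} [NormedAddCommGroup V] [InnerProductSpace ℝ V] [FiniteDimensional ℝ V]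
  [MeasurableSpace V] [BorelSpace V]

lemma integrable_exp_neg_mul_sq_norm {c : ℝ} (hc : 0 < c) :
    Integrable fun v : V => Real.exp (-c * ‖v‖ ^ 2) := by
  have h := GaussianFourier.integrable_cexp_neg_mul_sq_norm_add (b := (c : ℂ)) (V := V)
    (by simpa using hc) 0 0
  refine h.re.congr (ae_of_all _ fun v => ?_)
  simp only [inner_zero_left, zero_mul, add_zero]
  have : (-(c : ℂ) * (‖v‖ : ℂ) ^ 2) = ((-c * ‖v‖ ^ 2 : ℝ) : ℂ) := by push_cast; ring
  rw [this, ← Complex.ofReal_exp]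
  rfl

/-- Laplace's method: rescaling by `√k` and dominated convergence. -/
lemma tendsto_rpow_mul_integral {g : ℕ → V → ℝ} {G : V → ℝ} {M c : ℝ} (hc : 0 < c)
    (hm : ∀ k, Measurable (g k))
    (hb : ∀ᶠ k : ℕ in atTop, ∀ x, |g k x| ≤ M * Real.exp (-(c * k) * ‖x‖ ^ 2))
    (hlim : ∀ s, Tendsto (fun k : ℕ => g k ((Real.sqrt k)⁻¹ • s)) atTop (𝓝 (G s))) :
    Integrable G ∧ Tendsto (fun k : ℕ => (k : ℝ) ^ ((Module.finrank ℝ V : ℝ) / 2) * ∫ x, g k x)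
      atTop (𝓝 (∫ s, G s)) := by
  have hInt : Integrable fun v : V => M * Real.exp (-c * ‖v‖ ^ 2) :=
    (integrable_exp_neg_mul_sq_norm hc).const_mul M
  have hm' : ∀ k : ℕ, Measurable fun s => g k ((Real.sqrt k)⁻¹ • s) := fun k =>
    (hm k).comp (measurable_const_smul _)
  have hb' : ∀ᶠ k : ℕ in atTop, ∀ s,
      |g k ((Real.sqrt k)⁻¹ • s)| ≤ M * Real.exp (-c * ‖s‖ ^ 2) := by
    filter_upwards [hb, eventually_gt_atTop 0] with k hk hk0 s
    refine (hk _).trans_eq ?_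
    have hk1 : (0 : ℝ) < k := by exact_mod_cast hk0
    rw [norm_smul, norm_inv, Real.norm_of_nonneg (Real.sqrt_nonneg _), mul_pow, inv_pow,
      Real.sq_sqrt hk1.le]
    congr 2
    field_simp
  have hGm : AEStronglyMeasurable G volume :=
    aestronglyMeasurable_of_tendsto_ae atTop (fun k => (hm' k).aestronglyMeasurable)
      (ae_of_all _ hlim)
  refine ⟨hInt.mono' hGm (ae_of_all _ fun s => ?_), ?_⟩
  · refine le_of_tendsto (hlim s).norm ?_
    filter_upwards [hb'] with k hk
    exact hk s
  · have h := tendsto_integral_filter_of_dominated_convergence (μ := (volume : Measure V))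
      (fun v : V => M * Real.exp (-c * ‖v‖ ^ 2))
      (Eventually.of_forall fun k => (hm' k).aestronglyMeasurable)
      (hb'.mono fun k hk => ae_of_all _ hk) hInt (ae_of_all _ hlim)
    refine h.congr' ?_
    filter_upwards [eventually_gt_atTop 0] with k hk0
    have hk1 : (0 : ℝ) < k := by exact_mod_cast hk0
    rw [Measure.integral_comp_smul volume (g k), smul_eq_mul]
    congr 1
    rw [inv_pow, inv_inv, abs_of_nonneg (by positivity), Real.sqrt_eq_rpow, ← Real.rpow_natCast,
      ← Real.rpow_mul hk1.le]
    congr 1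
    ring

end Laplace

/-! ### Asymptotics of the constant `c(𝔹ⁿ, k)` -/

/-- The density of the invariant volume uses up one of the `k` factors, hence the exponent `k - 1`.
-/
lemma integral_inv_bergmanDiag_pow {k : ℕ} (hk : 1 ≤ k) :
    bergmanConst n ^ k * ∫ w : Ball n, (bergmanDiag w ^ k)⁻¹ ∂(invVol n) =
      bergmanConst n * ∫ x : E n, (Metric.ball (0 : E n) 1).indicator
        (fun x => (1 - ‖x‖ ^ 2) ^ ((n + 1) * (k - 1))) x := by
  have hb := bergmanConst_pos n
  rw [invVol, integral_withDensity_eq_integral_toReal_smul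
    measurable_bergmanDiag.ennreal_ofReal (ae_of_all _ fun _ => ENNReal.ofReal_lt_top),
    integral_indicator measurableSet_ball, ← integral_subtype_comap measurableSet_ball,
    ← integral_const_mul, ← integral_const_mul]
  refine integral_congr_ae (ae_of_all _ fun w => ?_)
  have hd := bergmanDiag_pos w
  have hw := one_sub_sq_pos w
  simp only [smul_eq_mul]
  rw [ENNReal.toReal_ofReal hd.le, bergmanDiag_eq]
  obtain ⟨l, rfl⟩ := Nat.exists_eq_add_of_le hk
  rw [Nat.add_sub_cancel_left, div_pow, pow_mul]
  field_simp
  ring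

lemma tendsto_one_sub_div_pow (x : ℝ) :
    Tendsto (fun k : ℕ => (1 - x / k) ^ ((n + 1) * (k - 1))) atTop
      (𝓝 (Real.exp (-x) ^ (n + 1))) := by
  have h1 : Tendsto (fun k : ℕ => (1 + -(x / k)) ^ k) atTop (𝓝 (Real.exp (-x))) := by
    refine Real.tendsto_one_add_pow_exp_of_tendsto (tendsto_const_nhds.congr' ?_)
    filter_upwards [eventually_gt_atTop 0] with k hk
    have : (k : ℝ) ≠ 0 := by exact_mod_cast hk.ne'
    field_simp
  have h2 : Tendsto (fun k : ℕ => 1 + -(x / k)) atTop (𝓝 1) := by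
    have := (tendsto_const_div_atTop_nhds_zero_nat x).neg.const_add 1
    simpa using this
  have h3 := (h1.div h2 one_ne_zero).pow (n + 1)
  rw [div_one] at h3
  refine h3.congr' ?_
  filter_upwards [h2.eventually_ne one_ne_zero, eventually_gt_atTop 0] with k hk hk0
  simp only [Pi.div_apply]
  rw [mul_comm, pow_mul, ← sub_eq_add_neg] 
  rw [← sub_eq_add_neg] at hk
  congr 1
  obtain ⟨l, rfl⟩ := Nat.exists_eq_succ_of_ne_zero hk0.ne'
  rw [Nat.succ_sub_one, Nat.succ_eq_add_one, pow_succ, mul_div_cancel_right₀ _ hk]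

lemma finrank_real_E : Module.finrank ℝ (E n) = 2 * n := by
  rw [← Module.finrank_mul_finrank ℝ ℂ (E n), Complex.finrank_real_complex]
  simp

/-- `1 / c(k)` is a constant times the integral of `(1 - ‖x‖²)^((n+1)(k-1))` over a ball of real
dimension `2n`, which concentrates at scale `1/√k` and so decays like `k^(-n)`. -/
lemma exists_tendsto_kernelReal (n : ℕ) :
    ∃ c : ℝ, 0 < c ∧ Tendsto (fun k : ℕ => kernelReal n k / (k : ℝ) ^ (n : ℝ)) atTop (𝓝 c) := by
  have hb := bergmanConst_pos n
  have hbound : ∀ᶠ k : ℕ in atTop, ∀ x : E n, |(Metric.ball (0 : E n) 1).indicator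
      (fun x => (1 - ‖x‖ ^ 2) ^ ((n + 1) * (k - 1))) x| ≤
      1 * Real.exp (-(1 / 2 * k) * ‖x‖ ^ 2) := by
    filter_upwards [eventually_ge_atTop 2] with k hk x
    by_cases hx : x ∈ Metric.ball (0 : E n) 1
    · rw [Set.indicator_of_mem hx]
      have h0 := one_sub_sq_pos ⟨x, hx⟩
      simp only at h0
      rw [abs_of_nonneg (by positivity), one_mul]
      calc (1 - ‖x‖ ^ 2) ^ ((n + 1) * (k - 1))
          ≤ Real.exp (-‖x‖ ^ 2) ^ ((n + 1) * (k - 1)) := by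
            gcongr
            exact Real.one_sub_le_exp_neg _
        _ = Real.exp (-(((n + 1) * (k - 1) : ℕ) : ℝ) * ‖x‖ ^ 2) := by
            rw [← Real.exp_nat_mul]; congr 1; ring
        _ ≤ _ := by
            -- The Gaussian rate `1/2` comes from `(n+1)(k-1) ≥ k/2` for `k ≥ 2`.
            have hk2 : (k : ℝ) ≤ 2 * (((n + 1) * (k - 1) : ℕ) : ℝ) := by
              have : k ≤ 2 * ((n + 1) * (k - 1)) := by
                have h3 : k ≤ 2 * (k - 1) := by omega
                nlinarith [Nat.zero_le (n * (k - 1))]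
              exact_mod_cast this
            gcongr
            linarith
    · rw [Set.indicator_of_notMem hx, abs_zero]
      positivity
  have hlim : ∀ s : E n, Tendsto (fun k : ℕ => (Metric.ball (0 : E n) 1).indicator
      (fun x => (1 - ‖x‖ ^ 2) ^ ((n + 1) * (k - 1))) ((Real.sqrt k)⁻¹ • s)) atTop
      (𝓝 (Real.exp (-‖s‖ ^ 2) ^ (n + 1))) := by
    intro s
    refine (tendsto_one_sub_div_pow (n := n) (‖s‖ ^ 2)).congr' ?_
    have hev : ∀ᶠ k : ℕ in atTop, ‖s‖ ^ 2 < k :=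
      (tendsto_natCast_atTop_atTop (R := ℝ)).eventually_gt_atTop _
    filter_upwards [hev, eventually_gt_atTop 0] with k hk hk0
    have hk1 : (0 : ℝ) < k := by exact_mod_cast hk0
    have hns : ‖(Real.sqrt k)⁻¹ • s‖ ^ 2 = ‖s‖ ^ 2 / k := by
      rw [norm_smul, norm_inv, Real.norm_of_nonneg (Real.sqrt_nonneg _), mul_pow, inv_pow,
        Real.sq_sqrt hk1.le, div_eq_inv_mul]
    rw [Set.indicator_of_mem, hns]
    rw [mem_ball_zero_iff, ← sq_lt_one_iff₀ (norm_nonneg _), hns, div_lt_one hk1]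
    exact hk
  obtain ⟨hi, hL⟩ := tendsto_rpow_mul_integral (V := E n) (by norm_num)
    (fun k => Measurable.indicator (by fun_prop) measurableSet_ball) hbound hlim
  have hpos : 0 < ∫ s : E n, Real.exp (-‖s‖ ^ 2) ^ (n + 1) := by
    rw [integral_pos_iff_support_of_nonneg (fun s => by positivity) hi]
    have : Function.support (fun s : E n => Real.exp (-‖s‖ ^ 2) ^ (n + 1)) = Set.univ :=
      Set.eq_univ_of_forall fun s => by
        simp only [Function.mem_support]
        positivity
    rw [this]
    exact Measure.measure_univ_pos.2 (NeZero.ne _)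
  refine ⟨(bergmanConst n * ∫ s : E n, Real.exp (-‖s‖ ^ 2) ^ (n + 1))⁻¹, by positivity, ?_⟩
  refine ((hL.const_mul (bergmanConst n)).inv₀ (by positivity)).congr' ?_
  filter_upwards [eventually_ge_atTop 1] with k hk
  rw [kernelReal, integral_inv_bergmanDiag_pow hk, finrank_real_E,
    div_eq_mul_inv _ ((k : ℝ) ^ (n : ℝ)),
    ← mul_inv]
  congr 1
  push_cast
  rw [mul_div_cancel_left₀ _ two_ne_zero]
  ring

end BallQuotient

end

/-! ### Charts of submanifolds and uniform Gaussian bounds. -/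

noncomputable section

namespace BallQuotient

variable {n q : ℕ}

/-! ### Charts adapted to a volume form -/

/-- A measurable parametrization of a neighbourhood of `x` in a submanifold, centred at `x`, in
which the measure `ν` has density `f`, supported in a small ball. -/
structure AdaptedChart (q : ℕ) (ν : Measure (Ball n)) (x : Ball n) where
  /-- the neighbourhood of `x` -/
  nhd : Set (Ball n)
  /-- the parametrization -/
  param : EuclideanSpace ℝ (Fin q) → Ball n
  /-- the density -/
  dens : EuclideanSpace ℝ (Fin q) → ℝ
  /-- the parameter of `x` -/
  centre : EuclideanSpace ℝ (Fin q)
  /-- the radius of the domain -/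
  radius : ℝ
  /-- the constant in the lower Lipschitz bound -/
  low : ℝ
  /-- a bound of the density -/
  bound : ℝ
  /-- the derivative at the centre -/
  deriv : EuclideanSpace ℝ (Fin q) →L[ℝ] E n
  isOpen_nhd : IsOpen nhd
  mem_nhd : x ∈ nhd
  measurable_param : Measurable param
  measurable_dens : Measurable dens
  param_centre : param centre = x
  radius_pos : 0 < radius
  low_pos : 0 < low
  restrict_eq : ν.restrict nhd = (volume.withDensity fun t => ENNReal.ofReal (dens t)).map param
  dens_nonneg : ∀ t, 0 ≤ dens t
  dens_le : ∀ t, dens t ≤ bound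
  dens_eq_zero : ∀ t ∉ Metric.ball centre radius, dens t = 0
  continuousAt_dens : ContinuousAt dens centre
  dens_centre_pos : 0 < dens centre
  continuousOn_param : ContinuousOn param (Metric.closedBall centre radius)
  low_mul_le : ∀ s ∈ Metric.closedBall centre radius, ∀ t ∈ Metric.closedBall centre radius,
    low * ‖s - t‖ ≤ ‖(param s : E n) - param t‖
  hasFDerivAt_param : HasFDerivAt (fun t => (param t : E n)) deriv centre

/-- An injective linear map in finite dimension expands by at least `K⁻¹`; strict differentiability
perturbs this by at most half. -/
lemma exists_low_mul_le {V W : Type*} [NormedAddCommGroup V] [NormedSpace ℝ V]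
    [FiniteDimensional ℝ V] [NormedAddCommGroup W] [NormedSpace ℝ W] {φ : V → W} {L : V →L[ℝ] W}
    {t₀ : V} (h : HasStrictFDerivAt φ L t₀) (hL : Function.Injective L) :
    ∃ c : ℝ, 0 < c ∧ ∀ᶠ x : V × V in 𝓝 (t₀, t₀), c * ‖x.1 - x.2‖ ≤ ‖φ x.1 - φ x.2‖ := by
  obtain ⟨K, hK, hKL⟩ := LinearMap.exists_antilipschitzWith (L : V →ₗ[ℝ] W)
    (LinearMap.ker_eq_bot.2 hL)
  have hK' : (0 : ℝ) < K := by exact_mod_cast hK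
  refine ⟨(2 * (K : ℝ))⁻¹, by positivity, ?_⟩
  filter_upwards [h.isLittleO.def (by positivity : 0 < (2 * (K : ℝ))⁻¹)] with x hx
  have h1 : ‖x.1 - x.2‖ ≤ K * ‖L (x.1 - x.2)‖ := by
    have := hKL.le_mul_dist (x.1 - x.2) 0
    simpa [dist_eq_norm] using this
  have h2 : ‖L (x.1 - x.2)‖ ≤ ‖φ x.1 - φ x.2‖ + ‖φ x.1 - φ x.2 - L (x.1 - x.2)‖ := by
    have := norm_sub_le (φ x.1 - φ x.2) (φ x.1 - φ x.2 - L (x.1 - x.2))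
    rwa [sub_sub_cancel] at this
  have h3 : (K : ℝ)⁻¹ * ‖x.1 - x.2‖ ≤ ‖L (x.1 - x.2)‖ := by
    rwa [inv_mul_le_iff₀ hK']
  have h4 : (2 * (K : ℝ))⁻¹ * ‖x.1 - x.2‖ + (2 * (K : ℝ))⁻¹ * ‖x.1 - x.2‖ =
      (K : ℝ)⁻¹ * ‖x.1 - x.2‖ := by
    rw [mul_inv]; ring
  linarith

lemma nonempty_adaptedChart {Z : Set (Ball n)} {ν : Measure (Ball n)} (hν : IsVolumeForm q Z ν)
    {x : Ball n} (hx : x ∈ Z) : Nonempty (AdaptedChart q ν x) := by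
  classical
  obtain ⟨hnull, hloc⟩ := hν
  obtain ⟨U, φ, hφ, ⟨t₀, ht₀, rfl⟩, f, hf, hfpos, hmeas⟩ := hloc x hx
  have hU := hφ.isOpen
  have hUt : U ∈ 𝓝 t₀ := hU.mem_nhds ht₀
  have hφc : ContinuousOn φ U := continuousOn_iff_continuous_domRestrict.2 hφ.embedding.continuous
  have hcd : ContDiffAt ℝ ∞ (fun t => (φ t : E n)) t₀ := hφ.smooth.contDiffAt hUt
  have hstrict : HasStrictFDerivAt (fun t => (φ t : E n))
      (fderiv ℝ (fun t => (φ t : E n)) t₀) t₀ := hcd.hasStrictFDerivAt (by simp)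
  obtain ⟨c, hc, hlow⟩ := exists_low_mul_le hstrict (hφ.immersion t₀ ht₀)
  have hfc : ContinuousAt f t₀ := hf.continuousOn.continuousAt hUt
  have hfb : ∀ᶠ t in 𝓝 t₀, t ∈ U ∧ f t < f t₀ + 1 :=
    (hU.eventually_mem ht₀).and (hfc.eventually_lt_const (by linarith))
  obtain ⟨r, hr, hrb⟩ := Metric.nhds_basis_closedBall.eventually_iff.1 hfb
  obtain ⟨r', hr', hrb'⟩ := Metric.nhds_basis_closedBall.eventually_iff.1 hlow
  set R := min r r' with hR
  have hR0 : 0 < R := lt_min hr hr'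
  have hball1 : ∀ t ∈ Metric.closedBall t₀ R, t ∈ U ∧ f t < f t₀ + 1 := fun t ht =>
    hrb (Metric.closedBall_subset_closedBall (min_le_left _ _) ht)
  have hballU : Metric.closedBall t₀ R ⊆ U := fun t ht => (hball1 t ht).1
  have hball2 : ∀ s ∈ Metric.closedBall t₀ R, ∀ t ∈ Metric.closedBall t₀ R,
      c * ‖s - t‖ ≤ ‖(φ s : E n) - φ t‖ := by
    intro s hs t ht
    refine hrb' (x := (s, t)) ?_
    rw [← closedBall_prod_same]
    exact ⟨Metric.closedBall_subset_closedBall (min_le_right _ _) hs,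
      Metric.closedBall_subset_closedBall (min_le_right _ _) ht⟩
  let ψ : EuclideanSpace ℝ (Fin q) → Ball n := U.piecewise φ fun _ => origin n
  -- Outside `U` the parametrization takes an arbitrary value to be globally measurable; the
  -- truncated density vanishes there.
  have hψφ : ∀ t ∈ U, ψ t = φ t := fun t ht => Set.piecewise_eq_of_mem _ _ _ ht
  have hψm : Measurable ψ := hφc.measurable_piecewise continuousOn_const hU.measurableSet
  let B := Metric.ball t₀ R
  have hBU : B ⊆ U := Metric.ball_subset_closedBall.trans hballU
  have hfm : Measurable (B.indicator f) := by
    have := (hf.continuousOn.mono hBU).measurable_piecewise (g := 0)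
      continuous_zero.continuousOn Metric.isOpen_ball.measurableSet
    rwa [Set.piecewise_eq_indicator] at this
  obtain ⟨V, hV, hVeq⟩ := hφ.image
  -- Because `φ` is an embedding, the image of the small ball is cut out of `φ '' U` by an open set,
  -- so the chart describes `ν` on a genuine neighbourhood of the point.
  obtain ⟨W, hW, hWeq⟩ := hφ.embedding.isInducing.isOpen_iff.1
    (Metric.isOpen_ball.preimage continuous_subtype_val : IsOpen ((Subtype.val : U → _) ⁻¹' B))
  have hWt : ∀ t ∈ U, (φ t ∈ W ↔ t ∈ B) := by
    intro t ht
    have : (⟨t, ht⟩ : U) ∈ U.domRestrict φ ⁻¹' W ↔ (⟨t, ht⟩ : U) ∈ (Subtype.val : U → _) ⁻¹' B := by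
      rw [hWeq]
    exact this
  have hVt : ∀ t ∈ U, φ t ∈ V := fun t ht => by
    have : φ t ∈ Z ∩ V := hVeq ▸ Set.mem_image_of_mem φ ht
    exact this.2
  have hψt : ψ t₀ = φ t₀ := hψφ t₀ ht₀
  have ht₀B : t₀ ∈ B := Metric.mem_ball_self hR0
  have hev : ψ =ᶠ[𝓝 t₀] φ := by
    filter_upwards [hUt] with t ht using hψφ t ht
  refine ⟨⟨V ∩ W, ψ, B.indicator f, t₀, R, c, f t₀ + 1, fderiv ℝ (fun t => (φ t : E n)) t₀,
    hV.inter hW, ⟨hVt t₀ ht₀, (hWt t₀ ht₀).2 ht₀B⟩, hψm, hfm, hψt, hR0, hc, ?_, ?_, ?_, ?_, ?_, ?_,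
    ?_, ?_, ?_⟩⟩
  · ext S hS
    have hSO : MeasurableSet (S ∩ (V ∩ W)) := hS.inter (hV.inter hW).measurableSet
    have h1 : ν (S ∩ (V ∩ W)) = ν (S ∩ (V ∩ W) ∩ φ '' U) := by
      refine (measure_inter_conull' ?_).symm
      refine measure_mono_null ?_ hnull
      rintro y ⟨hy, hyU⟩ hyZ
      exact hyU (hVeq ▸ ⟨hyZ, hy.2.1⟩)
    have hcongr : φ =ᵐ[(volume.restrict U).withDensity fun t => ENNReal.ofReal (f t)] ψ := by
      refine (withDensity_absolutelyContinuous _ _).ae_eq ?_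
      filter_upwards [ae_restrict_mem hU.measurableSet] with t ht using (hψφ t ht).symm
    rw [Measure.restrict_apply hS, h1, ← Measure.restrict_apply hSO, hmeas,
      Measure.map_congr hcongr, Measure.map_apply hψm hSO, Measure.map_apply hψm hS,
      withDensity_apply _ (hψm hSO), withDensity_apply _ (hψm hS),
      Measure.restrict_restrict (hψm hSO)]
    have hset : ψ ⁻¹' (S ∩ (V ∩ W)) ∩ U = B ∩ ψ ⁻¹' S := by
      ext t
      constructor
      · rintro ⟨⟨h1, -, h3⟩, htU⟩
        rw [hψφ t htU] at h3
        exact ⟨(hWt t htU).1 h3, h1⟩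
      · rintro ⟨htB, h1⟩
        have htU := hBU htB
        refine ⟨⟨h1, ?_, ?_⟩, htU⟩
        · rw [hψφ t htU]; exact hVt t htU
        · rw [hψφ t htU]; exact (hWt t htU).2 htB
    have hind : (fun t => ENNReal.ofReal (B.indicator f t)) =
        B.indicator fun t => ENNReal.ofReal (f t) := by
      funext t
      by_cases ht : t ∈ B
      · rw [Set.indicator_of_mem ht, Set.indicator_of_mem ht]
      · rw [Set.indicator_of_notMem ht, Set.indicator_of_notMem ht, ENNReal.ofReal_zero]
    rw [hset, hind, setLIntegral_indicator Metric.isOpen_ball.measurableSet]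
  · intro t
    exact Set.indicator_nonneg (fun t ht => (hfpos t (hBU ht)).le) t
  · intro t
    by_cases ht : t ∈ B
    · rw [Set.indicator_of_mem ht]
      exact (hball1 t (Metric.ball_subset_closedBall ht)).2.le
    · rw [Set.indicator_of_notMem ht]
      linarith [hfpos t₀ ht₀]
  · intro t ht
    exact Set.indicator_of_notMem ht _
  · refine hfc.congr ?_
    filter_upwards [Metric.isOpen_ball.mem_nhds ht₀B] with t ht
    rw [Set.indicator_of_mem ht]
  · rw [Set.indicator_of_mem ht₀B]
    exact hfpos t₀ ht₀
  · exact (hφc.mono hballU).congr fun t ht => hψφ t (hballU ht)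
  · intro s hs t ht
    rw [hψφ s (hballU hs), hψφ t (hballU ht)]
    exact hball2 s hs t ht
  · refine hstrict.hasFDerivAt.congr_of_eventuallyEq ?_
    filter_upwards [hev] with t ht
    rw [ht]

/-! ### The uniform Gaussian bound -/

/-- The point `y` need not lie on the submanifold. Let `t'` be a parameter whose image is nearest to
`y`; then the image of `t` is at most twice as far from that of `t'` as from `y`, which gives a
Gaussian centred at `t'` in parameter space. -/
lemma AdaptedChart.lintegral_gaussian_le {ν : Measure (Ball n)} {x : Ball n}
    (c : AdaptedChart q ν x) : ∃ C : ℝ, 0 ≤ C ∧ ∀ N : ℝ, 0 < N → ∀ y : Ball n,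
      ∫⁻ p in c.nhd, ENNReal.ofReal (Real.exp (-N * ‖(p : E n) - y‖ ^ 2)) ∂ν ≤
        ENNReal.ofReal (C * N ^ (-(q : ℝ) / 2)) := by
  have hbound : 0 ≤ c.bound := (c.dens_nonneg c.centre).trans (c.dens_le _)
  have hlow := c.low_pos
  refine ⟨c.bound * (Real.pi / (c.low ^ 2 / 4)) ^ ((q : ℝ) / 2), by positivity, ?_⟩
  intro N hN y
  obtain ⟨t', ht', hmin⟩ := (isCompact_closedBall c.centre c.radius).exists_isMinOn
    ⟨c.centre, Metric.mem_closedBall_self c.radius_pos.le⟩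
    (f := fun t => ‖(c.param t : E n) - y‖)
    ((continuous_subtype_val.comp_continuousOn c.continuousOn_param).sub continuousOn_const).norm
  have hb : 0 < N * (c.low ^ 2 / 4) := by positivity
  have hle : ∀ t, ENNReal.ofReal (c.dens t) *
      ENNReal.ofReal (Real.exp (-N * ‖(c.param t : E n) - y‖ ^ 2)) ≤
      ENNReal.ofReal (c.bound * Real.exp (-(N * (c.low ^ 2 / 4)) * ‖t - t'‖ ^ 2)) := by
    intro t
    rw [← ENNReal.ofReal_mul (c.dens_nonneg t)]
    refine ENNReal.ofReal_le_ofReal ?_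
    by_cases ht : t ∈ Metric.ball c.centre c.radius
    · have ht1 := Metric.ball_subset_closedBall ht
      have h1 := c.low_mul_le t ht1 t' ht'
      have h2 : ‖(c.param t' : E n) - y‖ ≤ ‖(c.param t : E n) - y‖ := hmin ht1
      have h3 : ‖(c.param t : E n) - c.param t'‖ ≤
          ‖(c.param t : E n) - y‖ + ‖(c.param t' : E n) - y‖ := by
        have := norm_sub_le ((c.param t : E n) - y) ((c.param t' : E n) - y)
        rwa [sub_sub_sub_cancel_right] at this
      have h4 : c.low * ‖t - t'‖ ≤ 2 * ‖(c.param t : E n) - y‖ := by linarith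
      have h5 : (c.low * ‖t - t'‖) ^ 2 ≤ (2 * ‖(c.param t : E n) - y‖) ^ 2 := by gcongr
      have h6 : N * (c.low * ‖t - t'‖) ^ 2 ≤ N * (2 * ‖(c.param t : E n) - y‖) ^ 2 := by gcongr
      refine mul_le_mul (c.dens_le t) (Real.exp_le_exp.2 ?_) (Real.exp_pos _).le hbound
      nlinarith
    · rw [c.dens_eq_zero t ht, zero_mul]
      positivity
  have hmg : Measurable fun p : Ball n =>
      ENNReal.ofReal (Real.exp (-N * ‖(p : E n) - y‖ ^ 2)) := by fun_prop
  have hmt : Measurable fun t => ENNReal.ofReal (Real.exp (-N * ‖(c.param t : E n) - y‖ ^ 2)) :=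
    hmg.comp c.measurable_param
  rw [c.restrict_eq, lintegral_map hmg c.measurable_param,
    lintegral_withDensity_eq_lintegral_mul _ c.measurable_dens.ennreal_ofReal hmt]
  refine (lintegral_mono hle).trans_eq ?_
  rw [lintegral_sub_right_eq_self
    (fun t => ENNReal.ofReal (c.bound * Real.exp (-(N * (c.low ^ 2 / 4)) * ‖t‖ ^ 2))) t',
    ← ofReal_integral_eq_lintegral_ofReal ((integrable_exp_neg_mul_sq_norm hb).const_mul _)
      (ae_of_all _ fun t => by positivity), integral_const_mul,
    GaussianFourier.integral_rexp_neg_mul_sq_norm hb, finrank_euclideanSpace_fin]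
  congr 1
  rw [mul_assoc]
  congr 1
  have : Real.pi / (N * (c.low ^ 2 / 4)) = Real.pi / (c.low ^ 2 / 4) * N⁻¹ := by
    field_simp
  rw [this, Real.mul_rpow (by positivity) (by positivity), Real.inv_rpow hN.le, neg_div,
    Real.rpow_neg hN.le]

/-- Finitely many charts cover the compact closure of `X` inside the larger submanifold; regularity
up to the ends makes the constant uniform in `y`. -/
lemma exists_lintegral_gaussian_le {X : Set (Ball n)} {ν : Measure (Ball n)}
    (h : IsRegularUpToEnds q X ν) : ∃ C : ℝ, 0 ≤ C ∧ ∀ N : ℝ, 0 < N → ∀ y : Ball n,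
      ∫⁻ p, ENNReal.ofReal (Real.exp (-N * ‖(p : E n) - y‖ ^ 2)) ∂ν ≤
        ENNReal.ofReal (C * N ^ (-(q : ℝ) / 2)) := by
  obtain ⟨Z, νZ, -, hνZ, hcomp, hXZ, rfl⟩ := h
  have key : ∃ C : ℝ, 0 ≤ C ∧ ∀ N : ℝ, 0 < N → ∀ y : Ball n,
      ∫⁻ p in closure X, ENNReal.ofReal (Real.exp (-N * ‖(p : E n) - y‖ ^ 2)) ∂νZ ≤
        ENNReal.ofReal (C * N ^ (-(q : ℝ) / 2)) := by
    refine hcomp.induction_on (p := fun s => ∃ C : ℝ, 0 ≤ C ∧ ∀ N : ℝ, 0 < N → ∀ y : Ball n,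
      ∫⁻ p in s, ENNReal.ofReal (Real.exp (-N * ‖(p : E n) - y‖ ^ 2)) ∂νZ ≤
        ENNReal.ofReal (C * N ^ (-(q : ℝ) / 2))) ⟨0, le_rfl, by simp⟩ ?_ ?_ ?_
    · rintro s t hst ⟨C, hC, h⟩
      exact ⟨C, hC, fun N hN y => (lintegral_mono_set hst).trans (h N hN y)⟩
    · rintro s t ⟨C, hC, h⟩ ⟨C', hC', h'⟩
      refine ⟨C + C', by positivity, fun N hN y => ?_⟩
      refine (lintegral_union_le _ _ _).trans ?_
      rw [add_mul, ENNReal.ofReal_add (by positivity) (by positivity)]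
      exact add_le_add (h N hN y) (h' N hN y)
    · intro x hx
      obtain ⟨c⟩ := nonempty_adaptedChart hνZ (hXZ hx)
      exact ⟨c.nhd, mem_nhdsWithin_of_mem_nhds (c.isOpen_nhd.mem_nhds c.mem_nhd),
        c.lintegral_gaussian_le⟩
  obtain ⟨C, hC, h⟩ := key
  exact ⟨C, hC, fun N hN y => (lintegral_mono_set subset_closure).trans (h N hN y)⟩

lemma isFiniteMeasure_of_isRegularUpToEnds {X : Set (Ball n)} {ν : Measure (Ball n)}
    (h : IsRegularUpToEnds q X ν) : IsFiniteMeasure ν := by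
  obtain ⟨C, -, hC⟩ := exists_lintegral_gaussian_le h
  have h1 := hC 1 one_pos (origin n)
  have h2 : ∫⁻ _ : Ball n, ENNReal.ofReal (Real.exp (-1)) ∂ν ≤
      ∫⁻ p, ENNReal.ofReal (Real.exp (-1 * ‖(p : E n) - origin n‖ ^ 2)) ∂ν := by
    refine lintegral_mono fun p => ENNReal.ofReal_le_ofReal (Real.exp_le_exp.2 ?_)
    have := one_sub_sq_pos p
    simp only [origin, sub_zero]
    linarith
  rw [lintegral_const] at h2
  refine ⟨lt_of_not_ge fun htop => ?_⟩
  rw [top_le_iff.1 htop, ENNReal.mul_top (by simpa using Real.exp_pos _)] at h2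
  exact ((h2.trans h1).trans_lt ENNReal.ofReal_lt_top).ne rfl

end BallQuotient

end

/-! ### Asymptotics of overlap integrals over a submanifold. -/

noncomputable section

namespace BallQuotient

variable {n q : ℕ}

/-! ### The overlap near the diagonal -/

lemma sqrt_overlap_pow_le (k : ℕ) (z w : Ball n) :
    Real.sqrt (overlap z w) ^ ((n + 1) * k) ≤
      Real.exp (-((k : ℝ) / 10) * ‖(z : E n) - w‖ ^ 2) := by
  have hz : ‖(z : E n)‖ < 1 := mem_ball_zero_iff.1 z.2
  have hw : ‖(w : E n)‖ < 1 := mem_ball_zero_iff.1 w.2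
  have hzw := norm_sub_le (z : E n) w
  have h := one_add_sq_le_inv_overlap z w
  have ho := overlap_pos z w
  have hx4 : ‖(z : E n) - w‖ ^ 2 ≤ 4 := by nlinarith [norm_nonneg ((z : E n) - w)]
  have hx0 := sq_nonneg ‖(z : E n) - w‖
  set x := ‖(z : E n) - w‖ ^ 2
  -- For `0 ≤ x ≤ 4`, the range of a squared distance in the ball, `1/(1+x) ≤ 1 - x/5`.
  have h1 : overlap z w ≤ 1 - x / 5 := by
    have h2 : overlap z w * (1 + x) ≤ 1 := by
      have := mul_le_mul_of_nonneg_left h ho.le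
      rwa [mul_inv_cancel₀ ho.ne'] at this
    nlinarith
  have h2 : Real.sqrt (overlap z w) ≤ Real.exp (-(x / 10)) := by
    rw [Real.sqrt_le_left (Real.exp_pos _).le, ← Real.exp_nat_mul]
    refine h1.trans ((Real.one_sub_le_exp_neg _).trans_eq ?_)
    congr 1
    push_cast
    ring
  calc _ ≤ Real.sqrt (overlap z w) ^ k :=
        pow_le_pow_of_le_one (Real.sqrt_nonneg _) (Real.sqrt_le_one.2 (overlap_le_one z w))
          (Nat.le_mul_of_pos_left k n.succ_pos)
    _ ≤ Real.exp (-(x / 10)) ^ k := by gcongr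
    _ = _ := by
        rw [← Real.exp_nat_mul]
        congr 1
        ring

lemma sqrt_pow_mul_eq {o : ℝ} (ho : 0 ≤ o) (k l : ℕ) :
    Real.sqrt o ^ (l * k) = Real.sqrt (o ^ k) ^ l := by
  rw [mul_comm, pow_mul]
  congr 1
  rw [← Real.sqrt_sq (pow_nonneg (Real.sqrt_nonneg o) k), ← pow_mul, mul_comm, pow_mul,
    Real.sq_sqrt ho]

/-- If `√k (z_k - w) → v`, then `cosh^{-k} (τ(z_k,w)/2)` converges to a Gaussian. -/
lemma exists_tendsto_sqrt_overlap_pow {z : ℕ → Ball n} {w : Ball n} {v : E n}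
    (hz : Tendsto (fun k => (z k : E n)) atTop (𝓝 w))
    (hv : Tendsto (fun k : ℕ => Real.sqrt k • ((z k : E n) - w)) atTop (𝓝 v)) :
    ∃ Q : ℝ, 0 < Q ∧
      Tendsto (fun k => Real.sqrt (overlap (z k) w) ^ ((n + 1) * k)) atTop (𝓝 Q) := by
  set b := 1 - ‖(w : E n)‖ ^ 2
  have hb : 0 < b := one_sub_sq_pos w
  set y : ℕ → ℝ := fun k => (‖(z k : E n) - w‖ ^ 2 * b +
    ‖inner ℂ (w : E n) ((z k : E n) - w)‖ ^ 2) / ((1 - ‖(z k : E n)‖ ^ 2) * b) with hy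
  have hyo : ∀ k, (overlap (z k) w)⁻¹ = 1 + y k := fun k => inv_overlap (z k) w
  have hlim : Tendsto (fun k : ℕ => (k : ℝ) * y k) atTop
      (𝓝 ((‖v‖ ^ 2 * b + ‖inner ℂ (w : E n) v‖ ^ 2) / (b * b))) := by
    have h1 : Tendsto (fun k : ℕ => (‖Real.sqrt k • ((z k : E n) - w)‖ ^ 2 * b +
        ‖inner ℂ (w : E n) (Real.sqrt k • ((z k : E n) - w))‖ ^ 2) /
          ((1 - ‖(z k : E n)‖ ^ 2) * b)) atTop
        (𝓝 ((‖v‖ ^ 2 * b + ‖inner ℂ (w : E n) v‖ ^ 2) / (b * b))) := by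
      refine Tendsto.div ?_ ?_ (by positivity)
      · exact ((hv.norm.pow 2).mul_const b).add ((tendsto_const_nhds.inner hv).norm.pow 2)
      · exact (tendsto_const_nhds.sub (hz.norm.pow 2)).mul_const b
    refine h1.congr fun k => ?_
    have hk : (0 : ℝ) ≤ k := Nat.cast_nonneg k
    have e : inner ℂ (w : E n) (Real.sqrt k • ((z k : E n) - w)) =
        ((Real.sqrt k : ℝ) : ℂ) * inner ℂ (w : E n) ((z k : E n) - w) := by
      rw [← inner_smul_right]
      rfl
    rw [e, norm_mul, norm_smul, Complex.norm_real, Real.norm_of_nonneg (Real.sqrt_nonneg _),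
      mul_pow, mul_pow, Real.sq_sqrt hk]
    simp only [hy]
    ring
  have h2 := Real.tendsto_one_add_pow_exp_of_tendsto hlim
  have h3 := ((h2.inv₀ (Real.exp_pos _).ne').sqrt).pow (n + 1)
  refine ⟨_, ?_, h3.congr fun k => ?_⟩
  · have := Real.exp_pos ((‖v‖ ^ 2 * b + ‖inner ℂ (w : E n) v‖ ^ 2) / (b * b))
    positivity
  · rw [sqrt_pow_mul_eq (overlap_pos _ _).le, ← hyo k, inv_pow, inv_inv]

lemma tendsto_rpow_mul_exp_neg (a : ℝ) {c : ℝ} (hc : 0 < c) :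
    Tendsto (fun k : ℕ => (k : ℝ) ^ a * Real.exp (-c * k)) atTop (𝓝 0) :=
  (tendsto_rpow_mul_exp_neg_mul_atTop_nhds_zero a c hc).comp tendsto_natCast_atTop_atTop

lemma measurable_overlap_left (p : Ball n) : Measurable fun w : Ball n => overlap w p :=
  (continuous_overlap_left p).measurable

lemma integrable_sqrt_overlap_pow (ν : Measure (Ball n)) [IsFiniteMeasure ν] (x : Ball n) (k : ℕ) :
    Integrable (fun p => Real.sqrt (overlap p x) ^ ((n + 1) * k)) ν := by
  refine Integrable.of_bound
    ((measurable_overlap_left x).sqrt.pow_const _).aestronglyMeasurable 1 (ae_of_all _ fun p => ?_)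
  rw [Real.norm_of_nonneg (by positivity)]
  exact pow_le_one₀ (Real.sqrt_nonneg _) (Real.sqrt_le_one.2 (overlap_le_one p x))

/-- Rescale by `√k` about the centre. Differentiability of the chart gives a positive pointwise
limit, the lower Lipschitz bound a Gaussian majorant. -/
lemma AdaptedChart.tendsto_integral_nhd {ν : Measure (Ball n)} {x : Ball n}
    (c : AdaptedChart q ν x) : ∃ G : ℝ, 0 < G ∧
      Tendsto (fun k : ℕ => (k : ℝ) ^ ((q : ℝ) / 2) *
        ∫ p in c.nhd, Real.sqrt (overlap p x) ^ ((n + 1) * k) ∂ν) atTop (𝓝 G) := by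
  have hlow := c.low_pos
  have hbound : 0 ≤ c.bound := (c.dens_nonneg c.centre).trans (c.dens_le _)
  set g : ℕ → EuclideanSpace ℝ (Fin q) → ℝ := fun k s => c.dens (c.centre + s) *
    Real.sqrt (overlap (c.param (c.centre + s)) x) ^ ((n + 1) * k) with hg
  have hInt : ∀ k, ∫ p in c.nhd, Real.sqrt (overlap p x) ^ ((n + 1) * k) ∂ν = ∫ s, g k s := by
    intro k
    have hm : Measurable fun p : Ball n => Real.sqrt (overlap p x) ^ ((n + 1) * k) :=
      (measurable_overlap_left x).sqrt.pow_const _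
    rw [c.restrict_eq, integral_map c.measurable_param.aemeasurable hm.aestronglyMeasurable,
      integral_withDensity_eq_integral_toReal_smul c.measurable_dens.ennreal_ofReal
        (ae_of_all _ fun _ => ENNReal.ofReal_lt_top),
      ← integral_add_left_eq_self _ c.centre]
    simp only [ENNReal.toReal_ofReal (c.dens_nonneg _), smul_eq_mul, hg]
  have hlim : ∀ s, ∃ Q : ℝ, 0 < Q ∧
      Tendsto (fun k : ℕ => g k ((Real.sqrt k)⁻¹ • s)) atTop (𝓝 Q) := by
    intro s
    have hsq : Tendsto (fun k : ℕ => Real.sqrt k) atTop atTop :=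
      Real.tendsto_sqrt_atTop.comp tendsto_natCast_atTop_atTop
    have ht : Tendsto (fun k : ℕ => c.centre + (Real.sqrt k)⁻¹ • s) atTop (𝓝 c.centre) := by
      have := ((tendsto_inv_atTop_zero.comp hsq).smul_const s).const_add c.centre
      simpa using this
    have hv := c.hasFDerivAt_param.lim s (c := fun k : ℕ => Real.sqrt k) (l := atTop)
      (tendsto_norm_atTop_atTop.comp hsq)
    have hz := c.hasFDerivAt_param.continuousAt.tendsto.comp ht
    simp only [c.param_centre] at hv hz
    obtain ⟨Q, hQ, hQlim⟩ := exists_tendsto_sqrt_overlap_pow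
      (z := fun k : ℕ => c.param (c.centre + (Real.sqrt k)⁻¹ • s)) hz hv
    exact ⟨c.dens c.centre * Q, mul_pos c.dens_centre_pos hQ,
      (c.continuousAt_dens.tendsto.comp ht).mul hQlim⟩
  choose Q hQ hQlim using hlim
  have hb : ∀ᶠ k : ℕ in atTop, ∀ s,
      |g k s| ≤ c.bound * Real.exp (-(c.low ^ 2 / 10 * k) * ‖s‖ ^ 2) := by
    refine Eventually.of_forall fun k s => ?_
    have h0 : 0 ≤ g k s := mul_nonneg (c.dens_nonneg _) (by positivity)
    rw [abs_of_nonneg h0]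
    by_cases hs : c.centre + s ∈ Metric.ball c.centre c.radius
    · refine mul_le_mul (c.dens_le _) ((sqrt_overlap_pow_le k _ _).trans (Real.exp_le_exp.2 ?_))
        (by positivity) hbound
      have h1 := c.low_mul_le _ (Metric.ball_subset_closedBall hs) _
        (Metric.mem_closedBall_self c.radius_pos.le)
      rw [add_sub_cancel_left, c.param_centre] at h1
      have h2 : (c.low * ‖s‖) ^ 2 ≤ ‖(c.param (c.centre + s) : E n) - x‖ ^ 2 := by gcongr
      have h3 : (k : ℝ) * (c.low * ‖s‖) ^ 2 ≤
        k * ‖(c.param (c.centre + s) : E n) - x‖ ^ 2 := by gcongr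
      nlinarith
    · simp only [hg]
      rw [c.dens_eq_zero _ hs, zero_mul]
      positivity
  have hgm : ∀ k, Measurable (g k) := fun k => by
    have h1 : Measurable fun s => c.centre + s := measurable_const_add _
    exact (c.measurable_dens.comp h1).mul
      (((measurable_overlap_left x).comp (c.measurable_param.comp h1)).sqrt.pow_const _)
  obtain ⟨hQi, hT⟩ := tendsto_rpow_mul_integral (by positivity) hgm hb hQlim
  refine ⟨∫ s, Q s, ?_, ?_⟩
  · rw [integral_pos_iff_support_of_nonneg (fun s => (hQ s).le) hQi]
    have : Function.support Q = Set.univ := Set.eq_univ_of_forall fun s => (hQ s).ne'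
    rw [this]
    exact Measure.measure_univ_pos.2 (NeZero.ne _)
  · simp only [hInt]
    simpa only [finrank_euclideanSpace_fin] using hT

/-- Outside a chart neighbourhood the points stay a fixed Euclidean distance from `x`, so that part
of the integral is exponentially small. -/
lemma exists_tendsto_integral_overlap {X : Set (Ball n)} {ν : Measure (Ball n)} [IsFiniteMeasure ν]
    (hν : IsVolumeForm q X ν) {x : Ball n} (hx : x ∈ X) : ∃ G : ℝ, 0 < G ∧
      Tendsto (fun k : ℕ => (k : ℝ) ^ ((q : ℝ) / 2) *
        ∫ p, Real.sqrt (overlap p x) ^ ((n + 1) * k) ∂ν) atTop (𝓝 G) := by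
  obtain ⟨c⟩ := nonempty_adaptedChart hν hx
  obtain ⟨G, hG, hlim⟩ := c.tendsto_integral_nhd
  refine ⟨G, hG, ?_⟩
  obtain ⟨ε, hε, hball⟩ := Metric.isOpen_iff.1 c.isOpen_nhd x c.mem_nhd
  have hfar : Tendsto (fun k : ℕ => (k : ℝ) ^ ((q : ℝ) / 2) *
      ∫ p in c.nhdᶜ, Real.sqrt (overlap p x) ^ ((n + 1) * k) ∂ν) atTop (𝓝 0) := by
    have hz := (tendsto_rpow_mul_exp_neg ((q : ℝ) / 2)
      (by positivity : 0 < ε ^ 2 / 10)).mul_const (ν.real c.nhdᶜ)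
    rw [zero_mul] at hz
    refine squeeze_zero (fun k => ?_) (fun k => ?_) hz
    · exact mul_nonneg (by positivity) (integral_nonneg fun p => by positivity)
    · rw [mul_assoc]
      gcongr
      have hb : ∀ p ∈ c.nhdᶜ, ‖Real.sqrt (overlap p x) ^ ((n + 1) * k)‖ ≤
          Real.exp (-(ε ^ 2 / 10) * k) := by
        intro p hp
        rw [Real.norm_of_nonneg (by positivity)]
        refine (sqrt_overlap_pow_le k p x).trans (Real.exp_le_exp.2 ?_)
        have h1 : ε ≤ ‖(p : E n) - x‖ := by
          by_contra hlt
          refine hp (hball ?_)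
          rw [Metric.mem_ball, Subtype.dist_eq, dist_eq_norm]
          exact not_le.1 hlt
        have h2 : ε ^ 2 ≤ ‖(p : E n) - x‖ ^ 2 := by gcongr
        have h3 : (k : ℝ) * ε ^ 2 ≤ k * ‖(p : E n) - x‖ ^ 2 := by gcongr
        nlinarith
      exact (Real.le_norm_self _).trans
        (norm_setIntegral_le_of_norm_le_const (measure_lt_top ν _) hb)
  have hsum := hlim.add hfar
  rw [add_zero] at hsum
  refine hsum.congr fun k => ?_
  rw [← mul_add, integral_add_compl c.isOpen_nhd.measurableSet
    (integrable_sqrt_overlap_pow ν x k)]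

/-- The uniform upper bound that goes with `exists_tendsto_integral_overlap`. -/
lemma exists_integral_overlap_le {X : Set (Ball n)} {ν : Measure (Ball n)}
    (h : IsRegularUpToEnds q X ν) : ∃ C : ℝ, 0 ≤ C ∧ ∀ k : ℕ, 0 < k → ∀ x : Ball n,
      (k : ℝ) ^ ((q : ℝ) / 2) * ∫ p, Real.sqrt (overlap p x) ^ ((n + 1) * k) ∂ν ≤ C := by
  have := isFiniteMeasure_of_isRegularUpToEnds h
  obtain ⟨C, hC, hle⟩ := exists_lintegral_gaussian_le h
  refine ⟨C * (10 : ℝ) ^ ((q : ℝ) / 2), by positivity, fun k hk x => ?_⟩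
  have hk0 : (0 : ℝ) < k := by exact_mod_cast hk
  have h1 : ∫ p, Real.sqrt (overlap p x) ^ ((n + 1) * k) ∂ν ≤
      C * ((k : ℝ) / 10) ^ (-(q : ℝ) / 2) := by
    rw [integral_eq_lintegral_of_nonneg_ae (ae_of_all _ fun p => by positivity)
      (integrable_sqrt_overlap_pow ν x k).1]
    refine ENNReal.toReal_le_of_le_ofReal (by positivity) ?_
    refine (lintegral_mono fun p => ?_).trans (hle (k / 10) (by positivity) x)
    exact ENNReal.ofReal_le_ofReal (sqrt_overlap_pow_le k p x)
  calc _ ≤ (k : ℝ) ^ ((q : ℝ) / 2) * (C * ((k : ℝ) / 10) ^ (-(q : ℝ) / 2)) := by gcongr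
    _ = _ := by
      rw [neg_div, Real.rpow_neg (by positivity), Real.div_rpow hk0.le (by norm_num)]
      have := Real.rpow_pos_of_pos hk0 ((q : ℝ) / 2)
      field_simp

/-! ### Real points -/

/-- The inner product of real points is real and less than `1`, so the kernel is positive and equals
its absolute value: there is no oscillation. -/
lemma poincareTerm_one_of_real {Γ : Subgroup (SU n)} (k : ℕ) {x p : Ball n}
    (hx : ∀ i, ((x : E n) i).im = 0) (hp : ∀ i, ((p : E n) i).im = 0) :
    poincareTerm k (1 : autGroup Γ) x p =
      ((Real.sqrt (overlap p x) ^ ((n + 1) * k) : ℝ) : ℂ) := by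
  have him : (inner ℂ (p : E n) (x : E n)).im = 0 := by
    simp [PiLp.inner_apply, Complex.mul_im, hx, hp]
  set u := (inner ℂ (p : E n) (x : E n)).re with hu
  have hre : inner ℂ (p : E n) (x : E n) = (u : ℂ) := Complex.ext rfl (by simpa using him)
  have hlt : u < 1 := by
    have h1 := norm_inner_lt_one x p
    rw [hre, Complex.norm_real] at h1
    exact (Real.le_norm_self _).trans_lt h1
  have hterm : poincareTerm k (1 : autGroup Γ) x p = ((weight k x * weight k p *
      (bergmanConst n / (1 - u) ^ (n + 1)) ^ k : ℝ) : ℂ) := by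
    rw [poincareTerm, jac_one, one_smul, one_mul, bergman_eq, hre]
    push_cast
    rfl
  have hn := norm_poincareTerm k (1 : autGroup Γ) x p
  rw [one_smul, hterm, Complex.norm_real, Real.norm_of_nonneg] at hn
  · rw [hterm, hn, overlap_comm]
  · have := weight_pos k x
    have := weight_pos k p
    have := bergmanConst_pos n
    have : 0 < 1 - u := by linarith
    positivity

end BallQuotient

end

/-! ### The leading term and its comparison with the inner product. -/

noncomputable section

namespace BallQuotient

variable {n q : ℕ}

/-! ### The leading term -/

/-- The integral `∫_Y ∫_X cosh^{-(n+1)k} (τ(p,y)/2) ν_X(p) ν_Y(y)`. -/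
def leadingTerm (νX νY : Measure (Ball n)) (k : ℕ) : ℝ :=
  ∫ y, ∫ p, Real.sqrt (overlap p y) ^ ((n + 1) * k) ∂νX ∂νY

lemma rpow_mul_leadingTerm_le {νX νY : Measure (Ball n)} [IsFiniteMeasure νY] {C : ℝ} {k : ℕ}
    (hC : ∀ x : Ball n, (k : ℝ) ^ ((q : ℝ) / 2) *
      ∫ p, Real.sqrt (overlap p x) ^ ((n + 1) * k) ∂νX ≤ C) :
    (k : ℝ) ^ ((q : ℝ) / 2) * leadingTerm νX νY k ≤ C * νY.real Set.univ := by
  rw [leadingTerm, ← integral_const_mul]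
  calc _ ≤ ∫ _, C ∂νY := by
        refine integral_mono_of_nonneg (ae_of_all _ fun y => ?_) (integrable_const C)
          (ae_of_all _ hC)
        exact mul_nonneg (by positivity) (integral_nonneg fun p => by positivity)
    _ = _ := by rw [integral_const, smul_eq_mul, mul_comm]

section

variable {νX νY : Measure (Ball n)} [IsFiniteMeasure νX] [IsFiniteMeasure νY]

lemma integrable_sqrt_overlap_pow_prod (k : ℕ) :
    Integrable (fun x : Ball n × Ball n => Real.sqrt (overlap x.1 x.2) ^ ((n + 1) * k))
      (νX.prod νY) := by
  have hm : Measurable fun x : Ball n × Ball n => overlap x.1 x.2 := continuous_overlap.measurable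
  refine Integrable.of_bound (hm.sqrt.pow_const _).aestronglyMeasurable 1 (ae_of_all _ fun x => ?_)
  rw [Real.norm_of_nonneg (by positivity)]
  exact pow_le_one₀ (Real.sqrt_nonneg _) (Real.sqrt_le_one.2 (overlap_le_one x.1 x.2))

lemma leadingTerm_eq (k : ℕ) : leadingTerm νX νY k =
    ∫ x : Ball n × Ball n, Real.sqrt (overlap x.1 x.2) ^ ((n + 1) * k) ∂(νX.prod νY) :=
  (integral_prod_symm _ (integrable_sqrt_overlap_pow_prod k)).symm

lemma norm_integral_poincareTerm_one_le {Γ : Subgroup (SU n)} (k : ℕ) :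
    ‖∫ x, poincareTerm k (1 : autGroup Γ) x.2 x.1 ∂(νX.prod νY)‖ ≤ leadingTerm νX νY k := by
  rw [leadingTerm_eq]
  refine (norm_integral_le_integral_norm _).trans_eq (integral_congr_ae (ae_of_all _ fun x => ?_))
  simp only
  rw [norm_poincareTerm, one_smul, overlap_comm]

lemma integral_poincareTerm_one_of_real {Γ : Subgroup (SU n)} {X : Set (Ball n)}
    (hreal : ∀ x ∈ X, ∀ i, ((x : E n) i).im = 0) (hX : ∀ᵐ p ∂νX, p ∈ X) (hY : ∀ᵐ y ∂νY, y ∈ X)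
    (k : ℕ) :
    ∫ x, poincareTerm k (1 : autGroup Γ) x.2 x.1 ∂(νX.prod νY) = (leadingTerm νX νY k : ℂ) := by
  rw [leadingTerm_eq, ← integral_complex_ofReal]
  refine integral_congr_ae ?_
  filter_upwards [Measure.quasiMeasurePreserving_fst.ae hX,
    Measure.quasiMeasurePreserving_snd.ae hY] with x hx1 hx2
  exact poincareTerm_one_of_real k (hreal _ hx2) (hreal _ hx1)

/-- Dominated convergence in `y`, with the uniform bound coming from regularity up to the ends. The
pointwise limits are positive almost everywhere, and hence so is their integral. -/
lemma exists_tendsto_leadingTerm {X : Set (Ball n)} (hνX : IsVolumeForm q X νX)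
    (hreg : IsRegularUpToEnds q X νX) (hY : ∀ᵐ y ∂νY, y ∈ X) (hY0 : 0 < νY Set.univ) :
    ∃ G : ℝ, 0 < G ∧
      Tendsto (fun k : ℕ => (k : ℝ) ^ ((q : ℝ) / 2) * leadingTerm νX νY k) atTop (𝓝 G) := by
  obtain ⟨C, -, hC⟩ := exists_integral_overlap_le hreg
  have hex : ∀ y : Ball n, ∃ G : ℝ, y ∈ X → 0 < G ∧
      Tendsto (fun k : ℕ => (k : ℝ) ^ ((q : ℝ) / 2) *
        ∫ p, Real.sqrt (overlap p y) ^ ((n + 1) * k) ∂νX) atTop (𝓝 G) := by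
    intro y
    by_cases hy : y ∈ X
    · obtain ⟨G, hG⟩ := exists_tendsto_integral_overlap hνX hy
      exact ⟨G, fun _ => hG⟩
    · exact ⟨0, fun h => absurd h hy⟩
  choose G hG using hex
  have hm : ∀ k : ℕ, AEStronglyMeasurable (fun y => (k : ℝ) ^ ((q : ℝ) / 2) *
      ∫ p, Real.sqrt (overlap p y) ^ ((n + 1) * k) ∂νX) νY := fun k =>
    (integrable_sqrt_overlap_pow_prod (νX := νX) (νY := νY) k).integral_prod_right.1.const_mul _
  have hlim : ∀ᵐ y ∂νY, Tendsto (fun k : ℕ => (k : ℝ) ^ ((q : ℝ) / 2) *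
        ∫ p, Real.sqrt (overlap p y) ^ ((n + 1) * k) ∂νX) atTop (𝓝 (G y)) := by
    filter_upwards [hY] with y hy using (hG y hy).2
  have hb : ∀ᶠ k : ℕ in atTop, ∀ y, ‖(k : ℝ) ^ ((q : ℝ) / 2) *
      ∫ p, Real.sqrt (overlap p y) ^ ((n + 1) * k) ∂νX‖ ≤ C := by
    filter_upwards [eventually_gt_atTop 0] with k hk y
    rw [Real.norm_of_nonneg (mul_nonneg (by positivity) (integral_nonneg fun p => by positivity))]
    exact hC k hk y
  have hGm := aestronglyMeasurable_of_tendsto_ae atTop hm hlim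
  have hGi : Integrable G νY := by
    refine Integrable.of_bound hGm C ?_
    filter_upwards [hlim] with y hy
    exact le_of_tendsto hy.norm (hb.mono fun k hk => hk y)
  have hdct := tendsto_integral_filter_of_dominated_convergence (fun _ => C)
    (Eventually.of_forall hm) (hb.mono fun k hk => ae_of_all _ hk) (integrable_const C) hlim
  refine ⟨∫ y, G y ∂νY, ?_, ?_⟩
  · have hpos : ∀ᵐ y ∂νY, 0 < G y := by
      filter_upwards [hY] with y hy using (hG y hy).1
    rw [integral_pos_iff_support_of_nonneg_ae (hpos.mono fun y hy => hy.le) hGi]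
    have : νY (Function.support G) = νY Set.univ := by
      refine measure_congr ?_
      filter_upwards [hpos] with y hy
      exact eq_true hy.ne'
    rwa [this]
  · simpa only [leadingTerm, integral_const_mul] using hdct

/-- The inner product is given by the leading term up to an exponentially small error. -/
lemma exists_norm_innerProd_sub_le {Γ : Subgroup (SU n)} (hΓ : IsSmoothCocompact Γ) {z₀ : Ball n}
    {X : Set (Ball n)} (hXF : X ⊆ dirichlet Γ z₀)
    (hd : 0 < setDist X (frontier (dirichlet Γ z₀))) (hX : ∀ᵐ p ∂νX, p ∈ X)
    (hY : ∀ᵐ y ∂νY, y ∈ X) {m : ℕ} (ρ : autGroup Γ →* Matrix.unitaryGroup (Fin m) ℂ) (j : Fin m) :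
    ∃ b D : ℝ, 0 < b ∧ b < 1 ∧ ∀ k : ℕ, 2 ≤ k →
      ‖innerProd (dirichlet Γ z₀) k (theta Γ ρ νX j k) (theta Γ ρ νY j k) -
        (kernelReal n k : ℂ) * ∫ x, poincareTerm k (1 : autGroup Γ) x.2 x.1 ∂(νX.prod νY)‖ ≤
        kernelReal n k * (b ^ (k - 2) * D) := by
  have := countable_autGroup hΓ.discrete
  obtain ⟨a, ha, ha1, haX⟩ := exists_overlap_gt_mem_dirichlet hXF hd
  obtain ⟨C, -, hC⟩ := exists_tsum_overlap_le hΓ ha ha1 haX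
  have hPB : PoincareBound Γ X C := hC
  refine ⟨Real.sqrt a, C * (νX.prod νY).real Set.univ, by positivity,
    (Real.sqrt_lt' one_pos).2 (by simpa using ha1), fun k hk => ?_⟩
  have hX' : ∀ᵐ x ∂(νX.prod νY), x.1 ∈ X := Measure.quasiMeasurePreserving_fst.ae hX
  have hY' : ∀ᵐ x ∂(νX.prod νY), x.2 ∈ X := Measure.quasiMeasurePreserving_snd.ae hY
  have hi1 : Integrable (fun x => normTheta ρ j k j x.2 x.1) (νX.prod νY) := by
    refine Integrable.of_bound (aestronglyMeasurable_normTheta ρ j hPB hk j measurable_snd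
      measurable_fst hX') (kernelReal n k * C) ?_
    filter_upwards [hX'] with x hx
    exact norm_normTheta_le ρ j hPB hk j x.2 hx
  have hi2 : Integrable (fun x => poincareTerm k (1 : autGroup Γ) x.2 x.1) (νX.prod νY) := by
    refine Integrable.of_bound (measurable_poincareTerm k _ measurable_snd
      measurable_fst).aestronglyMeasurable 1 (ae_of_all _ fun x => ?_)
    rw [norm_poincareTerm]
    exact pow_le_one₀ (Real.sqrt_nonneg _) (Real.sqrt_le_one.2 (overlap_le_one _ _))
  rw [innerProd_theta ρ j hPB hΓ z₀ hk hX hY, ← integral_const_mul,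
    ← integral_sub hi1 (hi2.const_mul _)]
  refine (norm_integral_le_of_norm_le_const
    (C := kernelReal n k * (Real.sqrt a ^ (k - 2) * C)) ?_).trans_eq (by ring)
  filter_upwards [hX', hY'] with x hx1 hx2
  refine norm_normTheta_sub_le ρ j hPB ha hk hx1 fun g hg => ?_
  by_contra hlt
  -- An overlap above `a` would put `g • q` in the domain together with `q`.
  exact smul_notMem_dirichlet (hXF hx2) hg (haX _ hx1 _ (not_le.1 hlt))

lemma tendsto_rpow_mul_pow_sub {b : ℝ} (hb : 0 < b) (hb1 : b < 1) (a D : ℝ) :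
    Tendsto (fun k : ℕ => (k : ℝ) ^ a * (b ^ (k - 2) * D)) atTop (𝓝 0) := by
  have h := (tendsto_rpow_mul_exp_neg a (neg_pos.2 (Real.log_neg hb hb1))).mul_const (D / b ^ 2)
  rw [zero_mul] at h
  refine h.congr' ?_
  filter_upwards [eventually_ge_atTop 2] with k hk
  obtain ⟨l, rfl⟩ := Nat.exists_eq_add_of_le hk
  have e : Real.exp (- -Real.log b * ((2 + l : ℕ) : ℝ)) = b ^ (2 + l) := by
    rw [neg_neg, mul_comm, Real.exp_nat_mul, Real.exp_log hb]
  rw [e, Nat.add_sub_cancel_left, pow_add]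
  field_simp

end

end BallQuotient

end

/-! ### The theorem. -/

open BallQuotient in
theorem theorem4p2 (n : ℕ) (hn : 0 < n) (qX qY : ℕ) (hqX : 0 < qX) (hqY : 0 < qY)
    (X Y : Set (Ball n)) (νX νY : MeasureTheory.Measure (Ball n))
    (hX : IsSubmanifold qX X) (hY : IsSubmanifold qY Y)
    (hνX : IsVolumeForm qX X νX) (hνY : IsVolumeForm qY Y νY)
    (hXpos : 0 < νX Set.univ) (hXreg : IsRegularUpToEnds qX X νX)
    (hYpos : 0 < νY Set.univ) (hYfin : νY Set.univ < ⊤)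
    (hYX : Y ⊆ X) :
    (qX ≤ n →
      ∃ C : ℝ, ∀ (Γ : Subgroup (SU n)), IsSmoothCocompact Γ → ∀ z₀ : Ball n,
        X ⊆ dirichlet Γ z₀ → 0 < setDist X (frontier (dirichlet Γ z₀)) →
        ∀ (m : ℕ) (ρ : autGroup Γ →* Matrix.unitaryGroup (Fin m) ℂ) (j : Fin m),
          ∀ᶠ k : ℕ in Filter.atTop,
            ‖innerProd (dirichlet Γ z₀) k (theta Γ ρ νX j k) (theta Γ ρ νY j k)‖ ≤
              C * (k : ℝ) ^ ((n : ℝ) - (qX : ℝ) / 2)) ∧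
    ((∀ x ∈ X, ∀ i, ((x : E n) i).im = 0) →
      ∃ C : ℝ, 0 < C ∧ ∀ (Γ : Subgroup (SU n)), IsSmoothCocompact Γ → ∀ z₀ : Ball n,
        X ⊆ dirichlet Γ z₀ → 0 < setDist X (frontier (dirichlet Γ z₀)) →
        ∀ (m : ℕ) (ρ : autGroup Γ →* Matrix.unitaryGroup (Fin m) ℂ) (j : Fin m),
          Filter.Tendsto (fun k : ℕ =>
            innerProd (dirichlet Γ z₀) k (theta Γ ρ νX j k) (theta Γ ρ νY j k) /
              ((C * (k : ℝ) ^ ((n : ℝ) - (qX : ℝ) / 2) : ℝ) : ℂ)) Filter.atTop (nhds 1)) := by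
  have hfX := isFiniteMeasure_of_isRegularUpToEnds hXreg
  have hfY : IsFiniteMeasure νY := ⟨hYfin⟩
  have haeX : ∀ᵐ p ∂νX, p ∈ X := hνX.1
  have haeY : ∀ᵐ y ∂νY, y ∈ X := measure_mono_null (Set.compl_subset_compl.2 hYX) hνY.1
  obtain ⟨c, hc, hclim⟩ := exists_tendsto_kernelReal n
  have hsplit : ∀ k : ℕ, 0 < k → (k : ℝ) ^ ((n : ℝ) - (qX : ℝ) / 2) =
      (k : ℝ) ^ (n : ℝ) / (k : ℝ) ^ ((qX : ℝ) / 2) := fun k hk =>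
    Real.rpow_sub (by exact_mod_cast hk) _ _
  constructor
  · intro _
    obtain ⟨C, hC0, hC⟩ := exists_integral_overlap_le hXreg
    -- `c + 1` eventually bounds `c(k) / k^n`; the second `+ 1` absorbs the exponentially small
    -- remainder. Both are chosen before `Γ`, which affects only how large `k` must be.
    refine ⟨(c + 1) * (C * νY.real Set.univ + 1), fun Γ hΓ z₀ hXF hd m ρ j => ?_⟩
    obtain ⟨b, D, hb, hb1, hest⟩ :=
      exists_norm_innerProd_sub_le (νX := νX) (νY := νY) hΓ hXF hd haeX haeY ρ j
    have hsmall := (tendsto_rpow_mul_pow_sub hb hb1 ((qX : ℝ) / 2) D).eventually_lt_const one_pos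
    filter_upwards [hsmall, hclim.eventually_lt_const (lt_add_one c), eventually_ge_atTop 2]
      with k hk1 hk2 hk
    have hk0 : (0 : ℝ) < k := by exact_mod_cast (by omega : 0 < k)
    have hkn := Real.rpow_pos_of_pos hk0 (n : ℝ)
    have hkq := Real.rpow_pos_of_pos hk0 ((qX : ℝ) / 2)
    have hker := kernelReal_pos (n := n) (by omega : 1 ≤ k)
    have h1 := rpow_mul_leadingTerm_le (νY := νY) (hC k (by omega))
    have h2 := hest k hk
    have h3 := norm_integral_poincareTerm_one_le (Γ := Γ) (νX := νX) (νY := νY) k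
    set J := ∫ x, poincareTerm k (1 : autGroup Γ) x.2 x.1 ∂(νX.prod νY)
    set I := innerProd (dirichlet Γ z₀) k (theta Γ ρ νX j k) (theta Γ ρ νY j k)
    have h4 : ‖I‖ ≤ kernelReal n k * (leadingTerm νX νY k + b ^ (k - 2) * D) := by
      have h5 : ‖I‖ ≤ ‖(kernelReal n k : ℂ) * J‖ + ‖I - (kernelReal n k : ℂ) * J‖ := by
        have := norm_add_le ((kernelReal n k : ℂ) * J) (I - (kernelReal n k : ℂ) * J)
        rwa [add_sub_cancel] at this
      rw [norm_mul, Complex.norm_real, Real.norm_of_nonneg hker.le] at h5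
      have h6 : kernelReal n k * ‖J‖ ≤ kernelReal n k * leadingTerm νX νY k := by gcongr
      rw [mul_add]
      linarith
    have h7 : leadingTerm νX νY k + b ^ (k - 2) * D ≤
        (C * νY.real Set.univ + 1) / (k : ℝ) ^ ((qX : ℝ) / 2) := by
      rw [le_div_iff₀ hkq]
      linarith
    have h8 : kernelReal n k ≤ (c + 1) * (k : ℝ) ^ (n : ℝ) := ((div_lt_iff₀ hkn).1 hk2).le
    have h9 : 0 ≤ C * νY.real Set.univ + 1 := by positivity
    calc ‖I‖ ≤ kernelReal n k * ((C * νY.real Set.univ + 1) / (k : ℝ) ^ ((qX : ℝ) / 2)) := by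
          refine h4.trans ?_
          gcongr
      _ ≤ (c + 1) * (k : ℝ) ^ (n : ℝ) *
          ((C * νY.real Set.univ + 1) / (k : ℝ) ^ ((qX : ℝ) / 2)) := by gcongr
      _ = _ := by
          rw [hsplit k (by omega)]
          ring
  · intro hreal
    obtain ⟨G, hG, hGlim⟩ := exists_tendsto_leadingTerm hνX hXreg haeY hYpos
    refine ⟨c * G, mul_pos hc hG, fun Γ hΓ z₀ hXF hd m ρ j => ?_⟩
    obtain ⟨b, D, hb, hb1, hest⟩ :=
      exists_norm_innerProd_sub_le (νX := νX) (νY := νY) hΓ hXF hd haeX haeY ρ j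
    simp only [integral_poincareTerm_one_of_real hreal haeX haeY] at hest
    have hmain : Tendsto (fun k : ℕ => kernelReal n k / (k : ℝ) ^ (n : ℝ) *
        ((k : ℝ) ^ ((qX : ℝ) / 2) * leadingTerm νX νY k) / (c * G)) atTop (𝓝 1) := by
      have h := (hclim.mul hGlim).div_const (c * G)
      rwa [div_self (mul_pos hc hG).ne'] at h
    have herr : Tendsto (fun k : ℕ => kernelReal n k / (k : ℝ) ^ (n : ℝ) *
        ((k : ℝ) ^ ((qX : ℝ) / 2) * (b ^ (k - 2) * D)) / (c * G)) atTop (𝓝 0) := by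
      have h := (hclim.mul (tendsto_rpow_mul_pow_sub hb hb1 ((qX : ℝ) / 2) D)).div_const (c * G)
      rwa [mul_zero, zero_div] at h
    have hmainC := (Complex.continuous_ofReal.tendsto 1).comp hmain
    -- After division by `c G k^(n - qX/2)`, the error is the product of the convergent `c(k) / k^n`
    -- and an exponentially small factor.
    have hdiff : Tendsto (fun k : ℕ =>
        innerProd (dirichlet Γ z₀) k (theta Γ ρ νX j k) (theta Γ ρ νY j k) /
          ((c * G * (k : ℝ) ^ ((n : ℝ) - (qX : ℝ) / 2) : ℝ) : ℂ) -
        ((kernelReal n k / (k : ℝ) ^ (n : ℝ) *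
        ((k : ℝ) ^ ((qX : ℝ) / 2) * leadingTerm νX νY k) / (c * G) : ℝ) : ℂ)) atTop (𝓝 0) := by
      refine squeeze_zero_norm' ?_ herr
      filter_upwards [eventually_ge_atTop 2] with k hk
      have hk0 : (0 : ℝ) < k := by exact_mod_cast (by omega : 0 < k)
      have hkn := Real.rpow_pos_of_pos hk0 (n : ℝ)
      have hkq := Real.rpow_pos_of_pos hk0 ((qX : ℝ) / 2)
      have h2 := hest k hk
      rw [hsplit k (by omega)]
      set I := innerProd (dirichlet Γ z₀) k (theta Γ ρ νX j k) (theta Γ ρ νY j k)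
      set T := c * G * ((k : ℝ) ^ (n : ℝ) / (k : ℝ) ^ ((qX : ℝ) / 2)) with hT
      have hT0 : 0 < T := by positivity
      have e1 : kernelReal n k / (k : ℝ) ^ (n : ℝ) *
          ((k : ℝ) ^ ((qX : ℝ) / 2) * leadingTerm νX νY k) / (c * G) =
          kernelReal n k * leadingTerm νX νY k / T := by
        rw [hT]
        field_simp
      have e2 : kernelReal n k / (k : ℝ) ^ (n : ℝ) *
          ((k : ℝ) ^ ((qX : ℝ) / 2) * (b ^ (k - 2) * D)) / (c * G) =
          kernelReal n k * (b ^ (k - 2) * D) / T := by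
        rw [hT]
        field_simp
      rw [e1, e2, Complex.ofReal_div, ← sub_div, norm_div, Complex.norm_real,
        Real.norm_of_nonneg hT0.le, Complex.ofReal_mul]
      gcongr
    have h := hdiff.add hmainC
    rw [zero_add, Complex.ofReal_one] at h
    refine h.congr fun k => ?_
    simp only [Function.comp_apply, sub_add_cancel]
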